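/- Let $\mathbb K=\mathbb R$ or $\mathbb C$. On $\mathbb P^3(\mathbb K)$ take the contact structure induced by the standard symplectic form of $\mathbb K^4$, and the affine chart $(x,y,z)\mapsto[1:x:z:2y-xz]$, in which the contact structure is the kernel of $dy-z\,dx$; $Sp(4,\mathbb K)$ acts on $\mathbb P^3(\mathbb K)$ by contact transformations. A function $H(x,y,z)$ generates the contact vector field $X_H=-H_z\partial_x+(H-zH_z)\partial_y+(H_x+zH_y)\partial_z$. For $b_0,\dots,b_6\in\mathbb K$ with $b_0\ne0$, $b_2\neq 0$, $b_5\ne b_0b_6$ put $$x(t)=\frac{b_5+b_6t^2}{b_0+t^2},\qquad y(t)=\frac{b_4t^4+b_3t^2+b_2t+b_1}{(b_0+t^2)^2},\qquad z(t)=\frac{\dot y(t)}{\dot x(t)} .$$ For $b\in\mathbb K$ let $C_{b,b_0,\dots,b_6}\subset\mathbb P^3(\mathbb K)$ be the Zariski closure of the curve $$\tilde x=x(t)-2b\,z(t),\qquad \tilde y=y(t)-b\,z(t)^2,\qquad \tilde z=z(t),$$ let $\mathcal F_{\mathbb K}$ be the set of these curves, and let $\mathcal M_{\mathbb K}=Sp(4,\mathbb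 K)\cdot\mathcal F_{\mathbb K}$ be the smallest $Sp(4,\mathbb K)$-invariant family of subsets of $\mathbb P^3(\mathbb K)$ that contains $\mathcal F_{\mathbb K}$. Then: 1. The maps $(x,y,z)\mapsto(x-2bz,\,y-bz^2,\,z)$ are the flow, with parameter $b$, of $X_{H_8}$, $H_8=z^2$. The plane curves $t\mapsto(x(t),y(t))$, completed by the point $(b_6,b_4)$ at $t=\infty$, are exactly the quartics $(y+Q(x))^2+P(x)=0$ with $\deg Q\le2$ and $P$ a quartic with one simple and one triple root in $\mathbb K$. 2. Every $C_{b,b_0,\dots,b_6}$ is a rational contact curve: the image of $\mathbb P^1(\mathbb K)$ under a linearly nondegenerate cubic map that is everywhere tangent to the contact structure. The family depends on exactly seven parameters: for fixed $b$, two parameter vectors give the same curve if and only if they are related by a rescaling $t\mapsto\lambda t$, $\lambda\in\mathbb K^*$, i.e. by $$(b_0,b_1,b_2,b_3,b_4,b_5,b_6)\mapsto(\lambda^{-2}b_0,\lambda^{-4}b_1,\lambda^{-3}b_2,\lambda^{-2}b_3,b_4,\lambda^{-2}b_5,b_6),$$ and a given curve occurs for at most three values of $b$. 3. The identity component of $Sp(4,\mathbb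 K)$ acts transitively on $\mathcal M_{\mathbb K}$. The stabiliser in $Sp(4,\mathbb K)$ of every $C\in\mathcal M_{\mathbb K}$ is isomorphic, as a topological group, to $SL(2,\mathbb K)$, and $g\mapsto gC$ induces an $Sp(4,\mathbb K)$-equivariant bijection of $Sp(4,\mathbb K)/\mathrm{Stab}(C)$ with $\mathcal M_{\mathbb K}$; thus $\mathcal M_{\mathbb K}=Sp(4,\mathbb K)/SL(2,\mathbb K)$. 4. Consider the ODE $$10(y^{(3)})^3y^{(7)}-70(y^{(3)})^2y^{(4)}y^{(6)}-49(y^{(3)})^2(y^{(5)})^2+280\,y^{(3)}(y^{(4)})^2y^{(5)}-175(y^{(4)})^4=0.$$ A real $C^7$ function $y$ on a nonempty open interval is a solution with $y'''\not\equiv0$ if and only if its lift $x\mapsto(x,y(x),y'(x))$ lies in a member of $\mathcal M_{\mathbb R}$. The solution space, i.e. the set of Zariski closures in $\mathbb P^3(\mathbb R)$ of the lifts of all such solutions, equals $\mathcal M_{\mathbb R}=Sp(4,\mathbb R)/SL(2,\mathbb R)$. It is a real form of $\mathcal M_{\mathbb C}=Sp(4,\mathbb C)/SL(2,\mathbb C)$: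 complexification of curves maps it bijectively, and equivariantly for $Sp(4,\mathbb R)\subset Sp(4,\mathbb C)$, onto the set of members of $\mathcal M_{\mathbb C}$ that are invariant under complex conjugation. -/

import Mathlib

open scoped LinearAlgebra.Projectivization Pointwise MatrixGroups

noncomputable section

namespace SubmaximalODE

/-! ### The space `ℙ³`, its contact structure, and the group `Sp(4)` -/

/-- The four-dimensional symplectic vector space `𝕜⁴`. -/
abbrev V4 (𝕜 : Type*) : Type _ := Fin 2 ⊕ Fin 2 → 𝕜

/-- Three-dimensional projective space. -/
abbrev P3 (𝕜 : Type*) [Field 𝕜] : Type _ := ℙ 𝕜 (V4 𝕜)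

/-- The symplectic group `Sp(4, 𝕜)`. It acts on `V4 𝕜` by matrix-vector multiplication, hence on
`P3 𝕜` and on subsets of `P3 𝕜`. -/
abbrev Sp4 (𝕜 : Type*) [CommRing 𝕜] : Type _ := Matrix.symplecticGroup (Fin 2) 𝕜

/-- The standard symplectic form. The contact hyperplane of `ℙ³` at `[u]` consists of the
directions `v` with `sympForm u v = 0`. -/
def sympForm {𝕜 : Type*} [CommRing 𝕜] (u v : V4 𝕜) : 𝕜 :=
  dotProduct u ((Matrix.J (Fin 2) 𝕜).mulVec v)

/-- Homogeneous coordinates of the point with affine contact coordinates `(x, y, z)`. -/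
def chartVec {𝕜 : Type*} [CommRing 𝕜] (p : 𝕜 × 𝕜 × 𝕜) : V4 𝕜 :=
  Sum.elim ![1, p.1] ![2 * p.2.1 - p.1 * p.2.2, p.2.2]

theorem chartVec_ne_zero {𝕜 : Type*} [Field 𝕜] (p : 𝕜 × 𝕜 × 𝕜) : chartVec p ≠ 0 := by
  intro h
  have := congrFun h (Sum.inl 0)
  simp [chartVec] at this

/-- The affine chart `(x, y, z) ↦ [1 : x : z : 2y - xz]` of `ℙ³`. -/
def chart {𝕜 : Type*} [Field 𝕜] (p : 𝕜 × 𝕜 × 𝕜) : P3 𝕜 :=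
  Projectivization.mk 𝕜 (chartVec p) (chartVec_ne_zero p)

/-- In the chart, the contact structure of `ℙ³` is that of the contact form `dy - z dx`. -/
theorem sympForm_chartVec {𝕜 : Type*} [RCLike 𝕜] (x y z : 𝕜 → 𝕜) (x' y' z' t : 𝕜)
    (hx : HasDerivAt x x' t) (hy : HasDerivAt y y' t) (hz : HasDerivAt z z' t) :
    ∃ w : V4 𝕜, HasDerivAt (fun s => chartVec (x s, y s, z s)) w t ∧
      sympForm (chartVec (x t, y t, z t)) w = -2 * (y' - z t * x') := by
  refine ⟨Sum.elim ![0, x'] ![2 * y' - (x' * z t + x t * z'), z'], ?_, ?_⟩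
  · rw [hasDerivAt_pi]
    rintro (i | i) <;> fin_cases i
    · exact hasDerivAt_const t (1 : 𝕜)
    · exact hx
    · exact (hy.const_mul 2).sub (hx.mul hz)
    · exact hz
  · simp [sympForm, chartVec, Matrix.J, Matrix.mulVec, dotProduct, Fintype.sum_sum_type,
      Matrix.one_apply]
    ring

/-- Zariski closure (over `𝕜`) in projective space. -/
def zariskiClosure {𝕜 : Type*} [Field 𝕜] (S : Set (P3 𝕜)) : Set (P3 𝕜) :=
  {p | ∀ (d : ℕ) (f : MvPolynomial (Fin 2 ⊕ Fin 2) 𝕜), f.IsHomogeneous d →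
    (∀ q ∈ S, MvPolynomial.eval q.rep f = 0) → MvPolynomial.eval p.rep f = 0}

/-- The binary cubic form with vector coefficients `a`. -/
def cubicMap {𝕜 : Type*} [Field 𝕜] (a : Fin 4 → V4 𝕜) (s t : 𝕜) : V4 𝕜 :=
  s ^ 3 • a 0 + (s ^ 2 * t) • a 1 + (s * t ^ 2) • a 2 + t ^ 3 • a 3

/-- `C` is a rational contact curve of degree three: the image of `ℙ¹` under a nondegenerate
cubic map (a twisted cubic) whose tangent direction is everywhere in the contact hyperplane. -/
def IsRationalContactCubic {𝕜 : Type*} [RCLike 𝕜] (C : Set (P3 𝕜)) : Prop :=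
  ∃ a : Fin 4 → V4 𝕜, LinearIndependent 𝕜 a ∧
    C = {p | ∃ (s t : 𝕜) (h : cubicMap a s t ≠ 0), p = Projectivization.mk 𝕜 (cubicMap a s t) h} ∧
    ∀ s t : 𝕜,
      sympForm (cubicMap a s t) (deriv (fun r => cubicMap a r t) s) = 0 ∧
      sympForm (cubicMap a s t) (deriv (fun r => cubicMap a s r) t) = 0

/-! ### Contact vector fields and the flow of `z²` -/

/-- The contact vector field
`X_H = -H_z ∂_x + (H - z H_z) ∂_y + (H_x + z H_y) ∂_z` of a function `H(x, y, z)`. -/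
def contactField {𝕜 : Type*} [RCLike 𝕜] (H : 𝕜 → 𝕜 → 𝕜 → 𝕜) (p : 𝕜 × 𝕜 × 𝕜) : 𝕜 × 𝕜 × 𝕜 :=
  (-deriv (fun z => H p.1 p.2.1 z) p.2.2,
    H p.1 p.2.1 p.2.2 - p.2.2 * deriv (fun z => H p.1 p.2.1 z) p.2.2,
    deriv (fun x => H x p.2.1 p.2.2) p.1 + p.2.2 * deriv (fun y => H p.1 y p.2.2) p.2.1)

/-- `Φ` is the (global) one-parameter group of contact transformations generated by `H`. -/
def IsContactFlow {𝕜 : Type*} [RCLike 𝕜] (H : 𝕜 → 𝕜 → 𝕜 → 𝕜)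
    (Φ : 𝕜 → 𝕜 × 𝕜 × 𝕜 → 𝕜 × 𝕜 × 𝕜) : Prop :=
  ∀ p, Φ 0 p = p ∧ ∀ b, HasDerivAt (fun r => Φ r p) (contactField H (Φ b p)) b

/-- The contact transformations `(x, y, z) ↦ (x - 2bz, y - bz², z)`. -/
def flowZSq {𝕜 : Type*} [CommRing 𝕜] (b : 𝕜) (p : 𝕜 × 𝕜 × 𝕜) : 𝕜 × 𝕜 × 𝕜 :=
  (p.1 - 2 * b * p.2.2, p.2.1 - b * p.2.2 ^ 2, p.2.2)

/-! ### The quartic family and the family of contact curves -/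

/-- The plane quartics `(y + Q(x))² + P(x) = 0`, with `Q` a quadratic and `P` a quartic with one
simple and one triple root. -/
def quarticCurves (𝕜 : Type*) [Field 𝕜] : Set (Set (𝕜 × 𝕜)) :=
  {Γ | ∃ Q P : Polynomial 𝕜, Q.natDegree ≤ 2 ∧
    (∃ k r s : 𝕜, k ≠ 0 ∧ r ≠ s ∧
      P = Polynomial.C k * (Polynomial.X - Polynomial.C r) ^ 3 *
        (Polynomial.X - Polynomial.C s)) ∧
    Γ = {q | (q.2 + Q.eval q.1) ^ 2 + P.eval q.1 = 0}}

/-- The nondegenerate parameter vectors `(b₀, …, b₆)`. -/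
def Admissible {𝕜 : Type*} [Field 𝕜] (c : Fin 7 → 𝕜) : Prop :=
  c 0 ≠ 0 ∧ c 2 ≠ 0 ∧ c 5 ≠ c 0 * c 6

/-- `x(t) = (b₅ + b₆ t²) / (b₀ + t²)`. -/
def xPar {𝕜 : Type*} [Field 𝕜] (c : Fin 7 → 𝕜) (t : 𝕜) : 𝕜 :=
  (c 5 + c 6 * t ^ 2) / (c 0 + t ^ 2)

/-- `y(t) = (b₄ t⁴ + b₃ t² + b₂ t + b₁) / (b₀ + t²)²`. -/
def yPar {𝕜 : Type*} [Field 𝕜] (c : Fin 7 → 𝕜) (t : 𝕜) : 𝕜 :=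
  (c 4 * t ^ 4 + c 3 * t ^ 2 + c 2 * t + c 1) / (c 0 + t ^ 2) ^ 2

/-- `z(t) = y'(t) / x'(t)`. -/
def zPar {𝕜 : Type*} [RCLike 𝕜] (c : Fin 7 → 𝕜) (t : 𝕜) : 𝕜 :=
  deriv (yPar c) t / deriv (xPar c) t

/-- The plane curve `t ↦ (x(t), y(t))`, with the point `(b₆, b₄)` at `t = ∞`. -/
def planeCurve {𝕜 : Type*} [Field 𝕜] (c : Fin 7 → 𝕜) : Set (𝕜 × 𝕜) :=
  insert (c 6, c 4) {q | ∃ t : 𝕜, c 0 + t ^ 2 ≠ 0 ∧ q = (xPar c t, yPar c t)}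

/-- The curve `t ↦ (x - 2bz, y - bz², z)` in `ℙ³`, completed by its points at infinity. (The
function `z(t)` is defined where `b₀ + t² ≠ 0` and `t ≠ 0`.) -/
def contactCurve {𝕜 : Type*} [RCLike 𝕜] (b : 𝕜) (c : Fin 7 → 𝕜) : Set (P3 𝕜) :=
  zariskiClosure {p | ∃ t : 𝕜, t ≠ 0 ∧ c 0 + t ^ 2 ≠ 0 ∧
    p = chart (flowZSq b (xPar c t, yPar c t, zPar c t))}

/-- Effect on `(b₀, …, b₆)` of replacing `t` by `l t`. -/
def rescale {𝕜 : Type*} [Field 𝕜] (l : 𝕜) (c : Fin 7 → 𝕜) : Fin 7 → 𝕜 :=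
  ![c 0 / l ^ 2, c 1 / l ^ 4, c 2 / l ^ 3, c 3 / l ^ 2, c 4, c 5 / l ^ 2, c 6]

/-- The `Sp(4)`-invariant family generated by the curves `contactCurve b c`. -/
def contactFamily (𝕜 : Type*) [RCLike 𝕜] : Set (Set (P3 𝕜)) :=
  {C | ∃ (g : Sp4 𝕜) (b : 𝕜) (c : Fin 7 → 𝕜), Admissible c ∧ C = g • contactCurve b c}

/-! ### The differential equation -/

/-- The 7th order equation at the point `x`. -/
def ODEAt (y : ℝ → ℝ) (x : ℝ) : Prop :=
  10 * iteratedDeriv 3 y x ^ 3 * iteratedDeriv 7 y x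
    - 70 * iteratedDeriv 3 y x ^ 2 * iteratedDeriv 4 y x * iteratedDeriv 6 y x
    - 49 * iteratedDeriv 3 y x ^ 2 * iteratedDeriv 5 y x ^ 2
    + 280 * iteratedDeriv 3 y x * iteratedDeriv 4 y x ^ 2 * iteratedDeriv 5 y x
    - 175 * iteratedDeriv 4 y x ^ 4 = 0

/-- `y` solves the equation on `I` and `y'''` does not vanish identically, that is, `y` is not one
of the solutions `y''' = 0` at which the leading coefficient of the equation vanishes. -/
def IsSolutionOn (y : ℝ → ℝ) (I : Set ℝ) : Prop :=
  (∀ x ∈ I, ODEAt y x) ∧ ∃ x ∈ I, iteratedDeriv 3 y x ≠ 0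

/-- The lift `x ↦ (x, y(x), y'(x))` of the graph of `y` to `ℙ³(ℝ)`. -/
def jetGraph (y : ℝ → ℝ) (I : Set ℝ) : Set (P3 ℝ) :=
  {p | ∃ x ∈ I, p = chart (x, y x, deriv y x)}

/-- The solution space of the equation: the complete integral curves in `ℙ³(ℝ)`, a local solution
being identified with the algebraic curve that it generates. -/
def solutionSpace : Set (Set (P3 ℝ)) :=
  {C | ∃ (I : Set ℝ) (y : ℝ → ℝ), IsOpen I ∧ IsConnected I ∧ ContDiffOn ℝ 7 y I ∧
    IsSolutionOn y I ∧ C = zariskiClosure (jetGraph y I)}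

/-! ### Real and complex points -/

/-- The map of projective spaces that applies a ring homomorphism `σ` to all coordinates. -/
def applyCoords {K L : Type*} [Field K] [Field L] (σ : K →+* L) : P3 K → P3 L :=
  Projectivization.map
    ({ toFun := fun v i => σ (v i)
       map_add' := fun u v => by ext i; simp
       map_smul' := fun r v => by ext i; simp } : V4 K →ₛₗ[σ] V4 L)
    (fun u v h => by
      ext i
      exact σ.injective (congrFun h i))

/-- The complexification of a real algebraic curve. -/
def complexify (C : Set (P3 ℝ)) : Set (P3 ℂ) :=
  zariskiClosure (applyCoords Complex.ofRealHom '' C)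

/-- Complex conjugation on subsets of `ℙ³(ℂ)`. -/
def conjCurve (C : Set (P3 ℂ)) : Set (P3 ℂ) :=
  applyCoords (starRingEnd ℂ) '' C

end SubmaximalODE

end

noncomputable section
namespace SubmaximalODE

/-! ### Coordinates on `𝕜⁴` -/

section Coordinates

variable {𝕜 : Type*}

/-! Everything reduces to one orbit. The twisted cubic [s : t] ↦ (s³, s²t, t³, -3st²), called
`stdMap`, is tangent to the contact structure, and three quadrics cut it out (`InCone`). A cubic map
with coefficient vectors a₀, …, a₃ is a contact map as soon as ω(a₀, a₃) = k and ω(a₁, a₂) = -3k are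
the only nonzero pairings. If k ≠ 0, scaling the vectors and the parameter turns this Gram matrix
into that of `stdMap`, so a symplectic matrix carries one cubic to the other
(`IsContactFrame.exists_sp`). Clearing denominators shows that every curve of the family is of this
kind, with k = 2(b₀b₆ - b₅)²b₂. Hence the family is the `Sp4`-orbit of the standard cubic
(`mem_contactFamily_iff`). Zariski closures cause no trouble, because an infinite subset of a
rational cubic is dense in it.

The stabiliser of the standard cubic is the image of SL(2) acting on binary cubics
(`exists_cubicRep_of_stab`): after composition with an element of SL(2), a stabilising matrix fixes
two points of the cubic and is then diagonal. So two parameter vectors with the same b and the same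
curve differ by a projective change of t, which turns out to be a scaling. The value b is read off
from a point of the curve in the plane at infinity, and that plane meets a cubic in at most three
points. The group is connected because transvections reduce every symplectic matrix to 1. A
conjugation-invariant complex curve comes from a real one because the cocycle that it defines in
SL(2) is a coboundary (`exists_coboundary`).

For the differential equation, the lift W = (1, x, 2y - xy', y') of a function satisfies W'' =
y'''·E, where E has constant derivative. If W runs in a contact cubic, six differentiations of the
quadrics, in coordinates adapted to one point, give the equation (`jetEq_of_orders`). Conversely,
the equation is exactly the condition under which W extends to a moving contact frame whose
derivative is an infinitesimal gl(2)-substitution. The cubic of such a frame does not move, and W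
stays in it (`IsJetOn.eventually_inCone`). A cubic has no inflection, even at an end point of the
lift, so the local statement propagates over the whole interval. Finally, every contact cubic has a
point near which x is a local parameter, and there it is the lift of a function. -/

/-- The vector with coordinates `(a, b, c, d)`. -/
def vec4 (a b c d : 𝕜) : V4 𝕜 := Sum.elim ![a, b] ![c, d]

@[simp] theorem vec4_inl_zero (a b c d : 𝕜) : vec4 a b c d (Sum.inl 0) = a := rfl
@[simp] theorem vec4_inl_one (a b c d : 𝕜) : vec4 a b c d (Sum.inl 1) = b := rfl
@[simp] theorem vec4_inr_zero (a b c d : 𝕜) : vec4 a b c d (Sum.inr 0) = c := rfl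
@[simp] theorem vec4_inr_one (a b c d : 𝕜) : vec4 a b c d (Sum.inr 1) = d := rfl

theorem V4.ext {u v : V4 𝕜} (h0 : u (Sum.inl 0) = v (Sum.inl 0))
    (h1 : u (Sum.inl 1) = v (Sum.inl 1)) (h2 : u (Sum.inr 0) = v (Sum.inr 0))
    (h3 : u (Sum.inr 1) = v (Sum.inr 1)) : u = v := by
  funext i
  rcases i with i | i <;> fin_cases i <;> assumption

variable [Field 𝕜]

theorem sympForm_eq (u v : V4 𝕜) : sympForm u v =
    u (Sum.inr 0) * v (Sum.inl 0) + u (Sum.inr 1) * v (Sum.inl 1)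
      - u (Sum.inl 0) * v (Sum.inr 0) - u (Sum.inl 1) * v (Sum.inr 1) := by
  simp [sympForm, Matrix.J, Matrix.mulVec, dotProduct, Fintype.sum_sum_type, Matrix.one_apply]
  ring

theorem sympForm_add_right (u v w : V4 𝕜) : sympForm u (v + w) = sympForm u v + sympForm u w := by
  simp only [sympForm_eq, Pi.add_apply]; ring

theorem sympForm_add_left (u v w : V4 𝕜) : sympForm (u + v) w = sympForm u w + sympForm v w := by
  simp only [sympForm_eq, Pi.add_apply]; ring

theorem sympForm_sub_right (u v w : V4 𝕜) : sympForm u (v - w) = sympForm u v - sympForm u w := by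
  simp only [sympForm_eq, Pi.sub_apply]; ring

theorem sympForm_sub_left (u v w : V4 𝕜) : sympForm (u - v) w = sympForm u w - sympForm v w := by
  simp only [sympForm_eq, Pi.sub_apply]; ring

theorem sympForm_smul_right (c : 𝕜) (u v : V4 𝕜) : sympForm u (c • v) = c * sympForm u v := by
  simp only [sympForm_eq, Pi.smul_apply, smul_eq_mul]; ring

theorem sympForm_smul_left (c : 𝕜) (u v : V4 𝕜) : sympForm (c • u) v = c * sympForm u v := by
  simp only [sympForm_eq, Pi.smul_apply, smul_eq_mul]; ring

theorem sympForm_self (u : V4 𝕜) : sympForm u u = 0 := by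
  rw [sympForm_eq]; ring

theorem sympForm_swap (u v : V4 𝕜) : sympForm u v = -sympForm v u := by
  simp only [sympForm_eq]; ring

/-! ### The symplectic group -/

theorem sp_smul_eq (g : Sp4 𝕜) (v : V4 𝕜) : g • v = (g : Matrix _ _ 𝕜).mulVec v := rfl

theorem sp_smul_add (g : Sp4 𝕜) (u v : V4 𝕜) : g • (u + v) = g • u + g • v :=
  Matrix.mulVec_add _ u v

theorem sp_smul_smul (g : Sp4 𝕜) (c : 𝕜) (v : V4 𝕜) : g • (c • v) = c • (g • v) :=
  Matrix.mulVec_smul _ c v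

theorem mem_symplecticGroup_iff {A : Matrix (Fin 2 ⊕ Fin 2) (Fin 2 ⊕ Fin 2) 𝕜} :
    A ∈ Matrix.symplecticGroup (Fin 2) 𝕜 ↔
      ∀ i j, sympForm (A.col i) (A.col j) = Matrix.J (Fin 2) 𝕜 i j := by
  rw [SymplecticGroup.mem_iff', ← Matrix.ext_iff]
  refine forall₂_congr fun i j => ?_
  rw [Matrix.mul_assoc, Matrix.mul_apply]
  rfl

theorem sympForm_sp_smul (g : Sp4 𝕜) (u v : V4 𝕜) : sympForm (g • u) (g • v) = sympForm u v := by
  have h := SymplecticGroup.mem_iff'.1 g.2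
  rw [sympForm, sympForm, sp_smul_eq, sp_smul_eq]
  conv_rhs => rw [← h]
  rw [Matrix.mulVec_mulVec, Matrix.dotProduct_mulVec, Matrix.vecMul_mulVec,
    ← Matrix.dotProduct_mulVec, Matrix.mul_assoc]

/-- The linear combination of four vectors with coefficients the coordinates of `v`. -/
def combination (c0 c1 d0 d1 v : V4 𝕜) : V4 𝕜 :=
  v (Sum.inl 0) • c0 + v (Sum.inl 1) • c1 + v (Sum.inr 0) • d0 + v (Sum.inr 1) • d1

/-- Four vectors with the Gram matrix of the standard basis are the columns of a symplectic
matrix. -/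
theorem exists_sp_of_gram (c0 c1 d0 d1 : V4 𝕜) (h00 : sympForm c0 d0 = -1)
    (h11 : sympForm c1 d1 = -1) (hc : sympForm c0 c1 = 0) (hd : sympForm d0 d1 = 0)
    (h01 : sympForm c0 d1 = 0) (h10 : sympForm c1 d0 = 0) :
    ∃ g : Sp4 𝕜, ∀ v, g • v = combination c0 c1 d0 d1 v := by
  refine ⟨⟨Matrix.of fun i j => Sum.elim ![c0, c1] ![d0, d1] j i, ?_⟩, fun v => ?_⟩
  · rw [mem_symplecticGroup_iff]
    have hcol : ∀ j, (Matrix.of fun i j => Sum.elim ![c0, c1] ![d0, d1] j i).col j =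
        Sum.elim ![c0, c1] ![d0, d1] j := fun j => rfl
    simp only [hcol]
    rintro (i | i) (j | j) <;> fin_cases i <;> fin_cases j <;>
      simp [Matrix.J, sympForm_self, h00, h11, hc, hd, h01, h10, sympForm_swap d0 c0,
        sympForm_swap d1 c1, sympForm_swap c1 c0, sympForm_swap d1 d0, sympForm_swap d1 c0,
        sympForm_swap d0 c1]
  · rw [sp_smul_eq]
    funext i
    simp [Matrix.mulVec, dotProduct, combination, Fintype.sum_sum_type]
    ring

/-! ### The standard contact cubic and its cone. -/

/-- The contact cubic with parametrization `[s : t] ↦ (s³, s²t, t³, -3st²)`. -/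
def stdMap (s t : 𝕜) : V4 𝕜 := vec4 (s ^ 3) (s ^ 2 * t) (t ^ 3) (-3 * s * t ^ 2)

/-- The equations of the cone over the standard contact cubic. -/
def InCone (u : V4 𝕜) : Prop :=
  u (Sum.inl 0) * u (Sum.inr 1) + 3 * u (Sum.inl 1) ^ 2 = 0 ∧
  3 * u (Sum.inl 0) * u (Sum.inr 0) + u (Sum.inl 1) * u (Sum.inr 1) = 0 ∧
  u (Sum.inr 1) ^ 2 - 9 * u (Sum.inl 1) * u (Sum.inr 0) = 0

theorem inCone_stdMap (s t : 𝕜) : InCone (stdMap s t) := by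
  simp only [InCone, stdMap, vec4_inl_zero, vec4_inl_one, vec4_inr_zero, vec4_inr_one]
  refine ⟨?_, ?_, ?_⟩ <;> ring

theorem InCone.smul {u : V4 𝕜} (h : InCone u) (c : 𝕜) : InCone (c • u) := by
  obtain ⟨h1, h2, h3⟩ := h
  simp only [InCone, Pi.smul_apply, smul_eq_mul]
  exact ⟨by linear_combination c ^ 2 * h1, by linear_combination c ^ 2 * h2,
    by linear_combination c ^ 2 * h3⟩

theorem inCone_smul_iff {u : V4 𝕜} {c : 𝕜} (hc : c ≠ 0) : InCone (c • u) ↔ InCone u :=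
  ⟨fun h => by simpa [smul_smul, hc] using h.smul c⁻¹, fun h => h.smul c⟩

theorem stdMap_ne_zero {s t : 𝕜} (h : s ≠ 0 ∨ t ≠ 0) : stdMap s t ≠ 0 := by
  intro h0
  have h1 := congrFun h0 (Sum.inl 0)
  have h2 := congrFun h0 (Sum.inr 0)
  simp [stdMap] at h1 h2
  tauto

theorem stdMap_mul (c s t : 𝕜) : stdMap (c * s) (c * t) = c ^ 3 • stdMap s t := by
  refine V4.ext ?_ ?_ ?_ ?_ <;>
  simp only [stdMap, Pi.smul_apply, smul_eq_mul, vec4_inl_zero, vec4_inl_one, vec4_inr_zero,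
    vec4_inr_one] <;> ring

/-- If the first coordinate is nonzero, the parameter is the quotient of the second by the first,
and the first two quadrics determine the rest. If it vanishes, the quadrics leave only the
coordinate `Sum.inr 0`. -/
theorem InCone.exists_stdMap [CharZero 𝕜] {u : V4 𝕜} (h : InCone u) :
    (∃ l t : 𝕜, u = l • stdMap 1 t) ∨ ∃ l : 𝕜, u = l • stdMap 0 1 := by
  obtain ⟨h1, h2, h3⟩ := h
  by_cases h0 : u (Sum.inl 0) = 0
  · right
    rw [h0] at h1
    have h4 : u (Sum.inl 1) = 0 := by simpa using h1
    have h5 : u (Sum.inr 1) = 0 := by simpa [h4] using h3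
    refine ⟨u (Sum.inr 0), V4.ext ?_ ?_ ?_ ?_⟩ <;> simp [stdMap, h0, h4, h5]
  · left
    refine ⟨u (Sum.inl 0), u (Sum.inl 1) / u (Sum.inl 0), V4.ext ?_ ?_ ?_ ?_⟩ <;>
      simp only [stdMap, Pi.smul_apply, smul_eq_mul, vec4_inl_zero, vec4_inl_one, vec4_inr_zero,
        vec4_inr_one]
    · ring
    · field_simp
    · have h30 : (3 : 𝕜) ≠ 0 := by norm_num
      field_simp
      refine mul_left_cancel₀ h30 ?_
      linear_combination u (Sum.inl 0) * h2 - u (Sum.inl 1) * h1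
    · field_simp
      linear_combination h1

theorem InCone.exists_stdMap' [CharZero 𝕜] {u : V4 𝕜} (h : InCone u) :
    ∃ l s t : 𝕜, (s ≠ 0 ∨ t ≠ 0) ∧ u = l • stdMap s t := by
  obtain ⟨l, t, h⟩ | ⟨l, h⟩ := h.exists_stdMap
  · exact ⟨l, 1, t, by simp, h⟩
  · exact ⟨l, 0, 1, by simp, h⟩

/-- The standard contact cubic. -/
def stdCurve (𝕜 : Type*) [Field 𝕜] : Set (P3 𝕜) := {p | InCone p.rep}

theorem mk_mem_stdCurve {v : V4 𝕜} (hv : v ≠ 0) :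
    Projectivization.mk 𝕜 v hv ∈ stdCurve 𝕜 ↔ InCone v := by
  obtain ⟨c, hc⟩ := Projectivization.exists_smul_eq_mk_rep 𝕜 v hv
  change InCone _ ↔ _
  rw [← hc]
  exact inCone_smul_iff c.ne_zero

theorem mk_mem_smul_stdCurve (g : Sp4 𝕜) {v : V4 𝕜} (hv : v ≠ 0) :
    Projectivization.mk 𝕜 v hv ∈ g • stdCurve 𝕜 ↔ InCone (g⁻¹ • v) := by
  rw [Set.mem_smul_set_iff_inv_smul_mem, Projectivization.smul_mk, mk_mem_stdCurve]

theorem smul_stdMap_mem (g : Sp4 𝕜) {s t : 𝕜} (h : g • stdMap s t ≠ 0) :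
    Projectivization.mk 𝕜 (g • stdMap s t) h ∈ g • stdCurve 𝕜 := by
  rw [mk_mem_smul_stdCurve, inv_smul_smul]
  exact inCone_stdMap s t

end Coordinates

end SubmaximalODE
end

noncomputable section
set_option linter.unusedSectionVars false
namespace SubmaximalODE

/-! ### The cubic representation of `SL(2)` -/

section CubicRepresentation

variable {𝕜 : Type*} [Field 𝕜] [CharZero 𝕜]

/-- The columns of the matrix of the substitution `(s, t) ↦ (ps + qt, rs + wt)` in `stdMap`. -/
def cubicCol (p q r w : 𝕜) : Fin 2 ⊕ Fin 2 → V4 𝕜 :=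
  Sum.elim
    ![vec4 (p ^ 3) (p ^ 2 * r) (r ^ 3) (-3 * p * r ^ 2),
      vec4 (3 * p ^ 2 * q) (p ^ 2 * w + 2 * p * q * r) (3 * r ^ 2 * w)
        (-3 * (2 * p * r * w + q * r ^ 2))]
    ![vec4 (q ^ 3) (q ^ 2 * w) (w ^ 3) (-3 * q * w ^ 2),
      vec4 (-(p * q ^ 2)) (-(2 * p * q * w + q ^ 2 * r) / 3) (-(r * w ^ 2))
        (p * w ^ 2 + 2 * q * r * w)]

/-- The symplectic form is the invariant pairing of binary cubics. A linear substitution multiplies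
it by the cube of its determinant, here 1. -/
theorem exists_cubicRep (m : Matrix.SpecialLinearGroup (Fin 2) 𝕜) :
    ∃ g : Sp4 𝕜, ∀ i j, (g : Matrix _ _ 𝕜) i j =
      cubicCol (m.1 0 0) (m.1 0 1) (m.1 1 0) (m.1 1 1) j i := by
  have hdet := m.2
  rw [Matrix.det_fin_two] at hdet
  generalize m.1 0 0 = p at *
  generalize m.1 0 1 = q at *
  generalize m.1 1 0 = r at *
  generalize m.1 1 1 = w at *
  refine ⟨⟨Matrix.of fun i j => cubicCol p q r w j i, ?_⟩, fun i j => rfl⟩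
  rw [mem_symplecticGroup_iff]
  have hcol : ∀ j, (Matrix.of fun i j => cubicCol p q r w j i).col j =
    cubicCol p q r w j := fun j => rfl
  simp only [hcol, sympForm_eq]
  have h3 : (p * w - q * r) ^ 3 = 1 := by rw [hdet, one_pow]
  rintro (i | i) (j | j) <;> fin_cases i <;> fin_cases j <;>
    simp [Matrix.J, cubicCol] <;>
    first
    | ring1
    | linear_combination h3
    | linear_combination -h3

/-- The action of `SL(2)` on binary cubic forms, as a symplectic matrix. -/
def cubicRepFun (m : Matrix.SpecialLinearGroup (Fin 2) 𝕜) : Sp4 𝕜 := (exists_cubicRep m).choose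

theorem cubicRepFun_apply (m : Matrix.SpecialLinearGroup (Fin 2) 𝕜) (i j : Fin 2 ⊕ Fin 2) :
    (cubicRepFun m : Matrix _ _ 𝕜) i j =
      cubicCol (m.1 0 0) (m.1 0 1) (m.1 1 0) (m.1 1 1) j i :=
  (exists_cubicRep m).choose_spec i j

theorem cubicRepFun_smul_stdMap (m : Matrix.SpecialLinearGroup (Fin 2) 𝕜) (s t : 𝕜) :
    cubicRepFun m • stdMap s t =
      stdMap (m.1 0 0 * s + m.1 0 1 * t) (m.1 1 0 * s + m.1 1 1 * t) := by
  rw [sp_smul_eq]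
  refine V4.ext ?_ ?_ ?_ ?_ <;>
    simp [Matrix.mulVec, dotProduct, Fintype.sum_sum_type, cubicRepFun_apply, cubicCol, stdMap] <;>
    ring

/-- The entries of the standard cubic span all linear functionals. -/
theorem sp_ext_stdMap {g h : Sp4 𝕜} (H : ∀ s t : 𝕜, g • stdMap s t = h • stdMap s t) : g = h := by
  apply Subtype.ext
  apply Matrix.ext
  intro i j
  have key : ∀ s t : 𝕜,
      (g.1 i (Sum.inl 0) - h.1 i (Sum.inl 0)) * s ^ 3 +
      (g.1 i (Sum.inl 1) - h.1 i (Sum.inl 1)) * (s ^ 2 * t) +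
      (g.1 i (Sum.inr 0) - h.1 i (Sum.inr 0)) * t ^ 3 +
      (g.1 i (Sum.inr 1) - h.1 i (Sum.inr 1)) * (-3 * s * t ^ 2) = 0 := by
    intro s t
    have := congrFun (H s t) i
    simp [sp_smul_eq, Matrix.mulVec, dotProduct, Fintype.sum_sum_type, stdMap] at this
    linear_combination this
  have e0 := key 1 0
  have e1 := key 0 1
  have e2 := key 1 1
  have e3 := key 1 (-1)
  have h0 : g.1 i (Sum.inl 0) - h.1 i (Sum.inl 0) = 0 := by linear_combination e0
  have h2 : g.1 i (Sum.inr 0) - h.1 i (Sum.inr 0) = 0 := by linear_combination e1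
  have h3 : g.1 i (Sum.inr 1) - h.1 i (Sum.inr 1) = 0 := by
    have h60 : (6 : 𝕜) ≠ 0 := by norm_num
    refine mul_left_cancel₀ h60 ?_
    linear_combination -e2 - e3 + 2 * h0
  have h1 : g.1 i (Sum.inl 1) - h.1 i (Sum.inl 1) = 0 := by
    linear_combination e2 - h0 - h2 + 3 * h3
  rcases j with j | j <;> fin_cases j
  · exact sub_eq_zero.1 h0
  · exact sub_eq_zero.1 h1
  · exact sub_eq_zero.1 h2
  · exact sub_eq_zero.1 h3

/-- The action of `SL(2)` on binary cubic forms, as a homomorphism to `Sp(4)`. -/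
def cubicRep : Matrix.SpecialLinearGroup (Fin 2) 𝕜 →* Sp4 𝕜 where
  toFun := cubicRepFun
  map_one' := by
    refine sp_ext_stdMap fun s t => ?_
    rw [cubicRepFun_smul_stdMap, one_smul]
    simp
  map_mul' m n := by
    refine sp_ext_stdMap fun s t => ?_
    rw [mul_smul, cubicRepFun_smul_stdMap, cubicRepFun_smul_stdMap, cubicRepFun_smul_stdMap]
    simp only [Matrix.SpecialLinearGroup.coe_mul, Matrix.mul_apply, Fin.sum_univ_two]
    congr 1 <;> ring

theorem cubicRep_apply (m : Matrix.SpecialLinearGroup (Fin 2) 𝕜) (i j : Fin 2 ⊕ Fin 2) :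
    (cubicRep m : Matrix _ _ 𝕜) i j =
      cubicCol (m.1 0 0) (m.1 0 1) (m.1 1 0) (m.1 1 1) j i :=
  cubicRepFun_apply m i j

theorem cubicRep_smul_stdMap (m : Matrix.SpecialLinearGroup (Fin 2) 𝕜) (s t : 𝕜) :
    cubicRep m • stdMap s t =
      stdMap (m.1 0 0 * s + m.1 0 1 * t) (m.1 1 0 * s + m.1 1 1 * t) :=
  cubicRepFun_smul_stdMap m s t

/-! ### The stabiliser of the standard cubic -/

theorem smul_stdCurve_subset_of {g : Sp4 𝕜} (h : ∀ s t : 𝕜, InCone (g • stdMap s t)) :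
    g • stdCurve 𝕜 ⊆ stdCurve 𝕜 := by
  rintro _ ⟨p, hp, rfl⟩
  obtain ⟨l, s, t, -, hst⟩ := InCone.exists_stdMap' hp
  change g • p ∈ _
  have hv := p.rep_nonzero
  rw [← p.mk_rep, Projectivization.smul_mk, mk_mem_stdCurve, hst, sp_smul_smul]
  exact (h s t).smul l

theorem cubicRep_smul_stdCurve (m : Matrix.SpecialLinearGroup (Fin 2) 𝕜) :
    cubicRep m • stdCurve 𝕜 = stdCurve 𝕜 := by
  have H : ∀ m : Matrix.SpecialLinearGroup (Fin 2) 𝕜, cubicRep m • stdCurve 𝕜 ⊆ stdCurve 𝕜 := by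
    intro m
    refine smul_stdCurve_subset_of fun s t => ?_
    rw [cubicRep_smul_stdMap]
    exact inCone_stdMap _ _
  refine (H m).antisymm ?_
  rw [Set.subset_smul_set_iff, ← map_inv]
  exact H _

theorem inCone_smul_stdMap_of_stab {g : Sp4 𝕜} (hg : g • stdCurve 𝕜 = stdCurve 𝕜) (s t : 𝕜) :
    InCone (g • stdMap s t) := by
  by_cases h : s ≠ 0 ∨ t ≠ 0
  · have h0 := stdMap_ne_zero h
    have h1 : g • stdMap s t ≠ 0 := (smul_ne_zero_iff_ne g).2 h0
    rw [← mk_mem_stdCurve h1, ← hg, mk_mem_smul_stdCurve, inv_smul_smul]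
    exact inCone_stdMap s t
  · push Not at h
    rw [h.1, h.2]
    have : stdMap (0 : 𝕜) 0 = 0 := by
      refine V4.ext ?_ ?_ ?_ ?_ <;> simp [stdMap]
    rw [this, smul_zero]
    simp [InCone]

theorem exists_SL2_entries {p q r w : 𝕜} (h : p * w - q * r = 1) :
    ∃ m : Matrix.SpecialLinearGroup (Fin 2) 𝕜,
      m.1 0 0 = p ∧ m.1 0 1 = q ∧ m.1 1 0 = r ∧ m.1 1 1 = w :=
  ⟨⟨!![p, q; r, w], by rw [Matrix.det_fin_two_of, h]⟩, rfl, rfl, rfl, rfl⟩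

/-- Besides the two points, `g` preserves the symplectic complement of the plane that they span. The
cone equations make the remaining 2×2 block diagonal, and `g` becomes the image of a diagonal
matrix. -/
theorem stab_of_fixes_lines {g : Sp4 𝕜} (hg : g • stdCurve 𝕜 = stdCurve 𝕜) {a b : 𝕜}
    (h0 : g • stdMap (1 : 𝕜) 0 = a • stdMap 1 0) (h1 : g • stdMap (0 : 𝕜) 1 = b • stdMap 0 1) :
    ∃ m, cubicRep m = g := by
  have e0 : stdMap (1 : 𝕜) 0 = vec4 1 0 0 0 := by simp [stdMap]
  have e1 : stdMap (0 : 𝕜) 1 = vec4 0 0 1 0 := by simp [stdMap]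
  rw [e0] at h0
  rw [e1] at h1
  have hab : a * b = 1 := by
    have := sympForm_sp_smul g (vec4 (1 : 𝕜) 0 0 0) (vec4 0 0 1 0)
    rw [h0, h1, sympForm_smul_left, sympForm_smul_right] at this
    simp [sympForm_eq] at this
    exact this
  have ha : a ≠ 0 := left_ne_zero_of_mul_eq_one hab
  have hb : b ≠ 0 := right_ne_zero_of_mul_eq_one hab
  set u := g • vec4 (0 : 𝕜) 1 0 0 with hu
  set v := g • vec4 (0 : 𝕜) 0 0 1 with hv
  have hu2 : u (Sum.inr 0) = 0 := by
    have := sympForm_sp_smul g (vec4 (1 : 𝕜) 0 0 0) (vec4 0 1 0 0)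
    rw [h0, sympForm_smul_left, ← hu] at this
    simpa [sympForm_eq, ha] using this
  have hv2 : v (Sum.inr 0) = 0 := by
    have := sympForm_sp_smul g (vec4 (1 : 𝕜) 0 0 0) (vec4 0 0 0 1)
    rw [h0, sympForm_smul_left, ← hv] at this
    simpa [sympForm_eq, ha] using this
  have hu0 : u (Sum.inl 0) = 0 := by
    have := sympForm_sp_smul g (vec4 (0 : 𝕜) 0 1 0) (vec4 0 1 0 0)
    rw [h1, sympForm_smul_left, ← hu] at this
    simpa [sympForm_eq, hb] using this
  have hv0 : v (Sum.inl 0) = 0 := by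
    have := sympForm_sp_smul g (vec4 (0 : 𝕜) 0 1 0) (vec4 0 0 0 1)
    rw [h1, sympForm_smul_left, ← hv] at this
    simpa [sympForm_eq, hb] using this
  have hexp : ∀ s t : 𝕜, g • stdMap s t = vec4 (s ^ 3 * a)
      (s ^ 2 * t * u (Sum.inl 1) + -3 * s * t ^ 2 * v (Sum.inl 1)) (t ^ 3 * b)
      (s ^ 2 * t * u (Sum.inr 1) + -3 * s * t ^ 2 * v (Sum.inr 1)) := by
    intro s t
    have : stdMap s t = s ^ 3 • vec4 1 0 0 0 + (s ^ 2 * t) • vec4 0 1 0 0 +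
        t ^ 3 • vec4 0 0 1 0 + (-3 * s * t ^ 2) • vec4 0 0 0 1 := by
      refine V4.ext ?_ ?_ ?_ ?_ <;> simp [stdMap]
    rw [this, sp_smul_add, sp_smul_add, sp_smul_add, sp_smul_smul, sp_smul_smul, sp_smul_smul,
      sp_smul_smul, h0, h1, ← hu, ← hv]
    refine V4.ext ?_ ?_ ?_ ?_ <;> simp [hu0, hu2, hv0, hv2]
  have huv : u (Sum.inr 1) * v (Sum.inl 1) - u (Sum.inl 1) * v (Sum.inr 1) = -1 := by
    have := sympForm_sp_smul g (vec4 (0 : 𝕜) 1 0 0) (vec4 0 0 0 1)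
    rw [← hu, ← hv] at this
    simpa [sympForm_eq, hu2, hv2] using this
  have hcone := fun s t => inCone_smul_stdMap_of_stab hg s t
  simp only [hexp, InCone, vec4_inl_zero, vec4_inl_one, vec4_inr_zero, vec4_inr_one] at hcone
  generalize u (Sum.inl 1) = u1 at *
  generalize u (Sum.inr 1) = u3 at *
  generalize v (Sum.inl 1) = v1 at *
  generalize v (Sum.inr 1) = v3 at *
  -- At s = 1 the first quadric is a polynomial in t without constant term. The values at ±1 and ±2
  -- isolate its coefficients: 27·v1² at t⁴ and a·u3 at t.
  have q1 := (hcone 1 1).1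
  have q2 := (hcone 1 (-1)).1
  have q3 := (hcone 1 2).1
  have q4 := (hcone 1 (-2)).1
  have hv1 : v1 = 0 := by
    have : (648 : 𝕜) * v1 ^ 2 = 0 := by linear_combination q3 + q4 - 4 * q1 - 4 * q2
    simpa using this
  have hu3 : u3 = 0 := by
    have : (12 : 𝕜) * (a * u3) = 0 := by linear_combination 8 * q1 - 8 * q2 - q3 + q4
    simpa [ha] using this
  subst hv1 hu3
  have h13 : u1 * v3 = 1 := by linear_combination -huv
  have hav : a * v3 = u1 ^ 2 := by
    have h30 : (3 : 𝕜) ≠ 0 := by norm_num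
    refine mul_left_cancel₀ h30 ?_
    linear_combination -q1
  have ha' : a = u1 ^ 3 := by linear_combination u1 * hav - a * h13
  have hb' : b = v3 ^ 3 := by
    refine mul_left_cancel₀ ha ?_
    rw [hab, ha', ← mul_pow, h13, one_pow]
  obtain ⟨m, hm0, hm1, hm2, hm3⟩ :=
    exists_SL2_entries (p := u1) (q := 0) (r := 0) (w := v3) (by linear_combination h13)
  refine ⟨m, sp_ext_stdMap fun s t => ?_⟩
  rw [cubicRep_smul_stdMap, hexp, ha', hb', hm0, hm1, hm2, hm3]
  refine V4.ext ?_ ?_ ?_ ?_ <;> simp [stdMap]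
  · ring
  · linear_combination u1 * s ^ 2 * t * h13
  · ring
  · linear_combination 3 * s * t ^ 2 * v3 * h13

/-- The images of [1 : 0] and [0 : 1] remain distinct, since the symplectic form of two points of
the cubic is, up to sign, the cube of the determinant of their parameters. An element of SL(2) moves
them back, which leaves the case of two fixed points. -/
theorem exists_cubicRep_of_stab {g : Sp4 𝕜} (hg : g • stdCurve 𝕜 = stdCurve 𝕜) :
    ∃ m, cubicRep m = g := by
  obtain ⟨l, s, t, -, h0⟩ := (inCone_smul_stdMap_of_stab hg 1 0).exists_stdMap'
  obtain ⟨l', s', t', -, h1⟩ := (inCone_smul_stdMap_of_stab hg 0 1).exists_stdMap'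
  have hne : s * t' - s' * t ≠ 0 := by
    intro hdet
    have := sympForm_sp_smul g (stdMap (1 : 𝕜) 0) (stdMap 0 1)
    rw [h0, h1, sympForm_smul_left, sympForm_smul_right] at this
    simp [sympForm_eq, stdMap] at this
    have h3 : (s * t' - s' * t) ^ 3 = 0 := by rw [hdet]; ring
    exact one_ne_zero (α := 𝕜) (by linear_combination this + l * l' * h3)
  -- The second column is divided by the determinant to land in SL(2). As `stdMap` is cubic, this is
  -- paid for by the cube of the determinant in the second eigenvalue below.
  obtain ⟨m, hm0, hm2, hm1, hm3⟩ := exists_SL2_entries (p := s) (r := t)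
    (q := (s * t' - s' * t)⁻¹ * s') (w := (s * t' - s' * t)⁻¹ * t') (by field_simp)
  have hd : (s * t' - s' * t)⁻¹ ≠ 0 := inv_ne_zero hne
  have hstab : ((cubicRep m)⁻¹ * g) • stdCurve 𝕜 = stdCurve 𝕜 := by
    rw [mul_smul, hg, inv_smul_eq_iff, cubicRep_smul_stdCurve]
  obtain ⟨n, hn⟩ := stab_of_fixes_lines (a := l) (b := l' * (s * t' - s' * t) ^ 3) hstab
    (by
      rw [mul_smul, h0, inv_smul_eq_iff, sp_smul_smul, cubicRep_smul_stdMap, hm0, hm1]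
      simp)
    (by
      rw [mul_smul, h1, inv_smul_eq_iff, sp_smul_smul, cubicRep_smul_stdMap, hm2, hm3]
      simp only [mul_zero, mul_one, zero_add]
      rw [stdMap_mul, smul_smul, mul_assoc, ← mul_pow, mul_inv_cancel₀ hne, one_pow, mul_one])
  exact ⟨m * n, by rw [map_mul, hn, mul_inv_cancel_left]⟩

end CubicRepresentation

end SubmaximalODE
end

noncomputable section
set_option linter.unusedSectionVars false
namespace SubmaximalODE

/-! ### Zariski closures -/

section Zariski

variable {𝕜 : Type*} [Field 𝕜]

theorem eval_smul_of_isHomogeneous {d : ℕ} {f : MvPolynomial (Fin 2 ⊕ Fin 2) 𝕜}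
    (hf : f.IsHomogeneous d) (c : 𝕜) (v : V4 𝕜) :
    MvPolynomial.eval (c • v) f = c ^ d * MvPolynomial.eval v f := by
  rw [MvPolynomial.eval_eq', MvPolynomial.eval_eq', Finset.mul_sum]
  refine Finset.sum_congr rfl fun e he => ?_
  have hd : ∑ i, e i = d := by
    have := hf (MvPolynomial.mem_support_iff.1 he)
    simpa [Finsupp.weight_apply, Finsupp.sum_fintype] using this
  simp only [Pi.smul_apply, smul_eq_mul, mul_pow, Finset.prod_mul_distrib]
  rw [Finset.prod_pow_eq_pow_sum, hd]
  ring

theorem eval_mk_rep_eq_zero_iff {d : ℕ} {f : MvPolynomial (Fin 2 ⊕ Fin 2) 𝕜}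
    (hf : f.IsHomogeneous d) {v : V4 𝕜} (hv : v ≠ 0) :
    MvPolynomial.eval (Projectivization.mk 𝕜 v hv).rep f = 0 ↔ MvPolynomial.eval v f = 0 := by
  obtain ⟨c, hc⟩ := Projectivization.exists_smul_eq_mk_rep 𝕜 v hv
  rw [← hc, Units.smul_def, eval_smul_of_isHomogeneous hf]
  simp

theorem eval_smul_rep_eq_zero_iff {d : ℕ} {f : MvPolynomial (Fin 2 ⊕ Fin 2) 𝕜}
    (hf : f.IsHomogeneous d) (g : Sp4 𝕜) (p : P3 𝕜) :
    MvPolynomial.eval (g • p).rep f = 0 ↔ MvPolynomial.eval (g • p.rep) f = 0 := by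
  conv_lhs => rw [← p.mk_rep, Projectivization.smul_mk]
  exact eval_mk_rep_eq_zero_iff hf _

theorem eval_aeval_eq (f : MvPolynomial (Fin 2 ⊕ Fin 2) 𝕜)
    (w : Fin 2 ⊕ Fin 2 → MvPolynomial (Fin 2 ⊕ Fin 2) 𝕜) (v : V4 𝕜) :
    MvPolynomial.eval v (MvPolynomial.aeval w f) =
      MvPolynomial.eval (fun i => MvPolynomial.eval v (w i)) f := by
  induction f using MvPolynomial.induction_on with
  | C a => simp
  | add p q hp hq => rw [map_add, map_add, map_add, hp, hq]
  | mul_X p i hp =>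
    rw [map_mul, map_mul, map_mul, hp, MvPolynomial.aeval_X, MvPolynomial.eval_X]

theorem exists_comp_linear {d : ℕ} {f : MvPolynomial (Fin 2 ⊕ Fin 2) 𝕜}
    (hf : f.IsHomogeneous d) (g : Sp4 𝕜) :
    ∃ f' : MvPolynomial (Fin 2 ⊕ Fin 2) 𝕜, f'.IsHomogeneous d ∧
      ∀ v, MvPolynomial.eval v f' = MvPolynomial.eval (g • v) f := by
  refine ⟨MvPolynomial.aeval (fun i => ∑ j, MvPolynomial.C (g.1 i j) * MvPolynomial.X j) f,
    ?_, fun v => ?_⟩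
  · have := hf.aeval (fun i => ∑ j, MvPolynomial.C (g.1 i j) * MvPolynomial.X j) (n := 1)
      (fun i => MvPolynomial.IsHomogeneous.sum _ _ _ fun j _ => by
        simpa using (MvPolynomial.isHomogeneous_C _ (g.1 i j)).mul
          (MvPolynomial.isHomogeneous_X 𝕜 j))
    simpa using this
  · rw [eval_aeval_eq]
    congr 2
    funext i
    simp [sp_smul_eq, Matrix.mulVec, dotProduct]

theorem zariskiClosure_smul_subset (g : Sp4 𝕜) (S : Set (P3 𝕜)) :
    g • zariskiClosure S ⊆ zariskiClosure (g • S) := by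
  rintro _ ⟨p, hp, rfl⟩ d f hf hS
  obtain ⟨f', hf', h⟩ := exists_comp_linear hf g
  refine (eval_smul_rep_eq_zero_iff hf g p).2 ?_
  rw [← h]
  refine hp d f' hf' fun q hq => ?_
  rw [h]
  exact (eval_smul_rep_eq_zero_iff hf g q).1 (hS _ (Set.smul_mem_smul_set hq))

theorem zariskiClosure_smul (g : Sp4 𝕜) (S : Set (P3 𝕜)) :
    zariskiClosure (g • S) = g • zariskiClosure S := by
  refine Set.Subset.antisymm ?_ (zariskiClosure_smul_subset g S)
  rw [Set.subset_smul_set_iff]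
  simpa using zariskiClosure_smul_subset g⁻¹ (g • S)

theorem isHomogeneous_quadric (c : 𝕜) (i j : Fin 2 ⊕ Fin 2) :
    (MvPolynomial.C c * (MvPolynomial.X i * MvPolynomial.X j)).IsHomogeneous 2 := by
  have := (MvPolynomial.isHomogeneous_C _ c).mul
    ((MvPolynomial.isHomogeneous_X 𝕜 i).mul (MvPolynomial.isHomogeneous_X 𝕜 j))
  simpa using this

theorem quadric_eq_zero_of_mem_zariskiClosure {S : Set (P3 𝕜)} {p : P3 𝕜}
    (hp : p ∈ zariskiClosure S) (c c' : 𝕜) (i j i' j' : Fin 2 ⊕ Fin 2)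
    (hS : ∀ q ∈ S, c * (q.rep i * q.rep j) + c' * (q.rep i' * q.rep j') = 0) :
    c * (p.rep i * p.rep j) + c' * (p.rep i' * p.rep j') = 0 := by
  have := hp 2 _ ((isHomogeneous_quadric c i j).add (isHomogeneous_quadric c' i' j'))
    (fun q hq => by simpa using hS q hq)
  simpa using this

theorem zariskiClosure_subset_stdCurve {S : Set (P3 𝕜)} (hS : S ⊆ stdCurve 𝕜) :
    zariskiClosure S ⊆ stdCurve 𝕜 := by
  intro p hp
  refine ⟨?_, ?_, ?_⟩
  · linear_combination quadric_eq_zero_of_mem_zariskiClosure hp 1 3 (.inl 0) (.inr 1) (.inl 1)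
      (.inl 1) fun q hq => by linear_combination (hS hq).1
  · linear_combination quadric_eq_zero_of_mem_zariskiClosure hp 3 1 (.inl 0) (.inr 0) (.inl 1)
      (.inr 1) fun q hq => by linear_combination (hS hq).2.1
  · linear_combination quadric_eq_zero_of_mem_zariskiClosure hp 1 (-9) (.inr 1) (.inr 1) (.inl 1)
      (.inr 0) fun q hq => by linear_combination (hS hq).2.2

theorem exists_polynomial_eval (f : MvPolynomial (Fin 2 ⊕ Fin 2) 𝕜)
    (w : Fin 2 ⊕ Fin 2 → Polynomial 𝕜) :
    ∃ p : Polynomial 𝕜, ∀ t, p.eval t = MvPolynomial.eval (fun i => (w i).eval t) f := by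
  refine ⟨MvPolynomial.aeval w f, fun t => ?_⟩
  induction f using MvPolynomial.induction_on with
  | C a => simp
  | add p q hp hq => simp [hp, hq]
  | mul_X p i hp => simp [hp]

/-- An infinite set of points of the standard cubic is Zariski dense in it. -/
theorem zariskiClosure_eq_stdCurve [CharZero 𝕜] {S : Set (P3 𝕜)} (hS : S ⊆ stdCurve 𝕜)
    (hinf : {t : 𝕜 | ∃ h, Projectivization.mk 𝕜 (stdMap 1 t) h ∈ S}.Infinite) :
    zariskiClosure S = stdCurve 𝕜 := by
  refine (zariskiClosure_subset_stdCurve hS).antisymm fun p hp d f hf hfS => ?_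
  obtain ⟨P, hP⟩ := exists_polynomial_eval f
    (Sum.elim ![1, Polynomial.X] ![Polynomial.X ^ 3, -3 * Polynomial.X ^ 2])
  have hP' : ∀ t, P.eval t = MvPolynomial.eval (stdMap 1 t) f := by
    intro t
    rw [hP]
    congr 2
    refine V4.ext ?_ ?_ ?_ ?_ <;> simp [stdMap]
  have hP0 : P = 0 := by
    refine P.eq_zero_of_infinite_isRoot (hinf.mono ?_)
    rintro t ⟨h, ht⟩
    change P.eval t = 0
    rw [hP', ← eval_mk_rep_eq_zero_iff hf h]
    exact hfS _ ht
  have h1 : ∀ t, MvPolynomial.eval (stdMap 1 t) f = 0 := by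
    intro t
    rw [← hP', hP0, Polynomial.eval_zero]
  -- The chart [1 : t] misses the point [0 : 1]. In the chart [t : 1] the form vanishes for t ≠ 0,
  -- hence also at t = 0.
  obtain ⟨R, hR⟩ := exists_polynomial_eval f
    (Sum.elim ![Polynomial.X ^ 3, Polynomial.X ^ 2] ![1, -3 * Polynomial.X])
  have hR' : ∀ t, R.eval t = MvPolynomial.eval (stdMap t 1) f := by
    intro t
    rw [hR]
    congr 2
    refine V4.ext ?_ ?_ ?_ ?_ <;> simp [stdMap]
  have hR0 : R = 0 := by
    refine R.eq_zero_of_infinite_isRoot ((Set.finite_singleton (0 : 𝕜)).infinite_compl.mono ?_)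
    intro t ht
    have ht0 : t ≠ 0 := ht
    change R.eval t = 0
    have := stdMap_mul t 1 t⁻¹
    rw [mul_one, mul_inv_cancel₀ ht0] at this
    rw [hR', this, eval_smul_of_isHomogeneous hf, h1, mul_zero]
  obtain ⟨l, t, h⟩ | ⟨l, h⟩ := InCone.exists_stdMap hp
  · rw [h, eval_smul_of_isHomogeneous hf, h1, mul_zero]
  · rw [h, eval_smul_of_isHomogeneous hf, ← hR', hR0, Polynomial.eval_zero, mul_zero]

theorem zariskiClosure_eq_smul_stdCurve [CharZero 𝕜] {S : Set (P3 𝕜)} (g : Sp4 𝕜)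
    (hS : S ⊆ g • stdCurve 𝕜) (hinf : S.Infinite) : zariskiClosure S = g • stdCurve 𝕜 := by
  have hS' : g⁻¹ • S ⊆ stdCurve 𝕜 := by
    rwa [Set.smul_set_subset_iff_subset_inv_smul_set, inv_inv]
  have : zariskiClosure (g⁻¹ • S) = stdCurve 𝕜 := by
    refine zariskiClosure_eq_stdCurve hS' ?_
    have hinf' : (g⁻¹ • S).Infinite := by
      rwa [Set.infinite_smul_set]
    have h01 : stdMap (0 : 𝕜) 1 ≠ 0 := stdMap_ne_zero (by simp)
    have hinf2 := hinf'.sdiff (Set.finite_singleton (Projectivization.mk 𝕜 (stdMap 0 1) h01))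
    have h1 : ∀ t : 𝕜, stdMap 1 t ≠ 0 := fun t => stdMap_ne_zero (by simp)
    refine Set.Infinite.of_image (fun t => Projectivization.mk 𝕜 (stdMap 1 t) (h1 t))
      (hinf2.mono ?_)
    rintro p ⟨hp, hp0⟩
    obtain ⟨l, t, h⟩ | ⟨l, h⟩ := InCone.exists_stdMap (hS' hp)
    · have hpt : p = Projectivization.mk 𝕜 (stdMap 1 t) (h1 t) := by
        rw [← p.mk_rep, Projectivization.mk_eq_mk_iff']
        exact ⟨l, h.symm⟩
      exact ⟨t, ⟨h1 t, hpt ▸ hp⟩, hpt.symm⟩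
    · refine absurd ?_ hp0
      rw [Set.mem_singleton_iff, ← p.mk_rep, Projectivization.mk_eq_mk_iff']
      exact ⟨l, h.symm⟩
  rw [← this, zariskiClosure_smul, smul_inv_smul]

end Zariski

end SubmaximalODE
end

noncomputable section
set_option linter.unusedSectionVars false
namespace SubmaximalODE

/-! ### Contact cubics and their frames -/

section Frames

variable {𝕜 : Type*} [Field 𝕜] [CharZero 𝕜]

/-- The Gram matrix of the coefficient vectors of a contact cubic. -/
structure IsContactFrame (a : Fin 4 → V4 𝕜) (k : 𝕜) : Prop where
  h01 : sympForm (a 0) (a 1) = 0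
  h02 : sympForm (a 0) (a 2) = 0
  h03 : sympForm (a 0) (a 3) = k
  h12 : sympForm (a 1) (a 2) = -3 * k
  h13 : sympForm (a 1) (a 3) = 0
  h23 : sympForm (a 2) (a 3) = 0

/-- The substitution t ↦ -kt and the factor k⁻² multiply ω(a₀, a₃) by (-k)³k⁻⁴ and thus replace the
constant k by -1, the constant of the standard cubic. No root has to be extracted, so this works
over any field of characteristic zero. -/
theorem IsContactFrame.exists_sp {a : Fin 4 → V4 𝕜} {k : 𝕜} (h : IsContactFrame a k)
    (hk : k ≠ 0) :
    ∃ g : Sp4 𝕜, ∀ s t, g • stdMap s t = (k ^ 2)⁻¹ • cubicMap a s (-k * t) := by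
  obtain ⟨g, hg⟩ := exists_sp_of_gram ((k ^ 2)⁻¹ • a 0) (((k ^ 2)⁻¹ * -k) • a 1)
    (((k ^ 2)⁻¹ * (-k) ^ 3) • a 3) ((-(k ^ 2)⁻¹ * (-k) ^ 2 / 3) • a 2)
    (by rw [sympForm_smul_left, sympForm_smul_right, h.h03]; field_simp)
    (by rw [sympForm_smul_left, sympForm_smul_right, h.h12]; field_simp)
    (by rw [sympForm_smul_left, sympForm_smul_right, h.h01]; ring)
    (by rw [sympForm_smul_left, sympForm_smul_right, sympForm_swap, h.h23]; ring)
    (by rw [sympForm_smul_left, sympForm_smul_right, h.h02]; ring)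
    (by rw [sympForm_smul_left, sympForm_smul_right, h.h13]; ring)
  refine ⟨g, fun s t => ?_⟩
  rw [hg]
  simp only [combination, stdMap, cubicMap, vec4_inl_zero, vec4_inl_one, vec4_inr_zero,
    vec4_inr_one]
  module

/-- The coefficient vectors of the standard contact cubic. -/
def stdFrame (𝕜 : Type*) [Field 𝕜] : Fin 4 → V4 𝕜 :=
  ![vec4 1 0 0 0, vec4 0 1 0 0, vec4 0 0 0 (-3), vec4 0 0 1 0]

theorem cubicMap_smul_stdFrame (g : Sp4 𝕜) (s t : 𝕜) :
    cubicMap (fun i => g • stdFrame 𝕜 i) s t = g • stdMap s t := by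
  simp only [cubicMap, ← sp_smul_smul, ← sp_smul_add]
  congr 1
  refine V4.ext ?_ ?_ ?_ ?_ <;> simp [stdFrame, stdMap]
  ring

theorem isContactFrame_smul_stdFrame (g : Sp4 𝕜) :
    IsContactFrame (fun i => g • stdFrame 𝕜 i) (-1) := by
  constructor <;> rw [sympForm_sp_smul] <;> simp [sympForm_eq, stdFrame]

theorem linearIndependent_smul_stdFrame (g : Sp4 𝕜) :
    LinearIndependent 𝕜 fun i => g • stdFrame 𝕜 i := by
  rw [Fintype.linearIndependent_iff]
  intro c hc
  simp only [Fin.sum_univ_four, ← sp_smul_smul, ← sp_smul_add] at hc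
  rw [smul_eq_zero_iff_eq] at hc
  have h0 := congrFun hc (Sum.inl 0)
  have h1 := congrFun hc (Sum.inl 1)
  have h2 := congrFun hc (Sum.inr 1)
  have h3 := congrFun hc (Sum.inr 0)
  simp [stdFrame] at h0 h1 h2 h3
  intro i
  fin_cases i <;> assumption

theorem stdMap_one_injective {t t' l : 𝕜} (h : l • stdMap 1 t' = stdMap 1 t) : t = t' := by
  have h0 := congrFun h (Sum.inl 0)
  have h1 := congrFun h (Sum.inl 1)
  simp [stdMap] at h0 h1
  rw [← h1, h0, one_mul]

end Frames

section Contact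

variable {𝕜 : Type*} [RCLike 𝕜]

/-- Only the pairs (0, 3) and (1, 2) contribute, and their contributions cancel because 3ω(a₀, a₃) +
ω(a₁, a₂) = 0. -/
theorem IsContactFrame.sympForm_deriv {a : Fin 4 → V4 𝕜} {k : 𝕜} (h : IsContactFrame a k)
    (s t : 𝕜) :
    sympForm (cubicMap a s t) (deriv (fun r => cubicMap a r t) s) = 0 ∧
      sympForm (cubicMap a s t) (deriv (fun r => cubicMap a s r) t) = 0 := by
  have d1 : HasDerivAt (fun r => cubicMap a r t)
      ((3 * s ^ 2) • a 0 + (2 * s * t) • a 1 + (t ^ 2) • a 2) s := by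
    have := ((((hasDerivAt_pow 3 s).smul_const (a 0)).add
      (((hasDerivAt_pow 2 s).mul_const t).smul_const (a 1))).add
      (((hasDerivAt_id s).mul_const (t ^ 2)).smul_const (a 2))).add_const (t ^ 3 • a 3)
    refine this.congr_deriv ?_
    simp
  have d2 : HasDerivAt (fun r => cubicMap a s r)
      ((s ^ 2) • a 1 + (2 * s * t) • a 2 + (3 * t ^ 2) • a 3) t := by
    have := ((((hasDerivAt_const t (s ^ 3 • a 0))).add
      (((hasDerivAt_id t).const_mul (s ^ 2)).smul_const (a 1))).add
      (((hasDerivAt_pow 2 t).const_mul s).smul_const (a 2))).add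
      ((hasDerivAt_pow 3 t).smul_const (a 3))
    refine this.congr_deriv ?_
    simp
    ring_nf
  rw [d1.deriv, d2.deriv]
  simp only [cubicMap, sympForm_add_left, sympForm_add_right, sympForm_smul_left,
    sympForm_smul_right, sympForm_self, h.h01, h.h02, h.h03, h.h12, h.h13, h.h23,
    sympForm_swap (a 1) (a 0), sympForm_swap (a 2) (a 0), sympForm_swap (a 3) (a 0),
    sympForm_swap (a 2) (a 1), sympForm_swap (a 3) (a 1), sympForm_swap (a 3) (a 2)]
  constructor <;> ring

theorem isRationalContactCubic_smul_stdCurve (g : Sp4 𝕜) :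
    IsRationalContactCubic (g • stdCurve 𝕜) := by
  refine ⟨fun i => g • stdFrame 𝕜 i, linearIndependent_smul_stdFrame g, ?_,
    (isContactFrame_smul_stdFrame g).sympForm_deriv⟩
  simp only [cubicMap_smul_stdFrame]
  ext p
  constructor
  · rintro ⟨q, hq, rfl⟩
    obtain ⟨l, s, t, hst, h⟩ := InCone.exists_stdMap' hq
    have hne : g • stdMap s t ≠ 0 := (smul_ne_zero_iff_ne g).2 (stdMap_ne_zero hst)
    refine ⟨s, t, hne, ?_⟩
    change g • q = _
    conv_lhs => rw [← q.mk_rep, Projectivization.smul_mk]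
    rw [Projectivization.mk_eq_mk_iff']
    exact ⟨l, by rw [h, sp_smul_smul]⟩
  · rintro ⟨s, t, h, rfl⟩
    exact smul_stdMap_mem g h

/-! ### The parametrized family -/

/-- The coefficients of the numerator of `z(t)`. -/
def zNum (c : Fin 7 → 𝕜) : Fin 4 → 𝕜 :=
  ![c 0 * c 2, 2 * c 0 * c 3 - 4 * c 1, -3 * c 2, 4 * c 0 * c 4 - 2 * c 3]

/-- The coefficients of the numerator of `2y(t) - x(t)z(t)`. -/
def wNum (c : Fin 7 → 𝕜) : Fin 4 → 𝕜 :=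
  ![-(c 5 * c 2),
    4 * (c 0 * c 6 - c 5) * c 3 - c 6 * (2 * c 0 * c 3 - 4 * c 1)
      - c 5 * (4 * c 0 * c 4 - 2 * c 3)
      - c 0 * (4 * (c 0 * c 6 - c 5) * c 4 - c 6 * (4 * c 0 * c 4 - 2 * c 3)),
    3 * c 6 * c 2,
    4 * (c 0 * c 6 - c 5) * c 4 - c 6 * (4 * c 0 * c 4 - 2 * c 3)]

/-- The coefficient vectors of the cubic parametrization of `contactCurve b c`. -/
def curveFrame (b : 𝕜) (c : Fin 7 → 𝕜) : Fin 4 → V4 𝕜 :=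
  ![vec4 0 (-2 * b * zNum c 0) (wNum c 0) (zNum c 0),
    vec4 (2 * (c 0 * c 6 - c 5) * c 0) (2 * (c 0 * c 6 - c 5) * c 5 - 2 * b * zNum c 1)
      (wNum c 1) (zNum c 1),
    vec4 0 (-2 * b * zNum c 2) (wNum c 2) (zNum c 2),
    vec4 (2 * (c 0 * c 6 - c 5)) (2 * (c 0 * c 6 - c 5) * c 6 - 2 * b * zNum c 3)
      (wNum c 3) (zNum c 3)]

/-- The constant does not depend on `b`, and for admissible `c` it is nonzero. -/
theorem isContactFrame_curveFrame (b : 𝕜) (c : Fin 7 → 𝕜) :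
    IsContactFrame (curveFrame b c) (2 * (c 0 * c 6 - c 5) ^ 2 * c 2) := by
  constructor <;> simp [sympForm_eq, curveFrame, zNum, wNum] <;> ring

theorem zPar_eq {c : Fin 7 → 𝕜} (hc : Admissible c) {t : 𝕜} (ht : t ≠ 0)
    (hD : c 0 + t ^ 2 ≠ 0) :
    zPar c t = (zNum c 0 + zNum c 1 * t + zNum c 2 * t ^ 2 + zNum c 3 * t ^ 3) /
      (2 * (c 0 * c 6 - c 5) * t * (c 0 + t ^ 2)) := by
  have hk : c 0 * c 6 - c 5 ≠ 0 := sub_ne_zero.2 (Ne.symm hc.2.2)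
  have hDt : HasDerivAt (fun t => c 0 + t ^ 2) (2 * t) t := by
    simpa using (hasDerivAt_pow 2 t).const_add (c 0)
  have hx : HasDerivAt (xPar c) (2 * (c 0 * c 6 - c 5) * t / (c 0 + t ^ 2) ^ 2) t := by
    have h1 : HasDerivAt (fun t => c 5 + c 6 * t ^ 2) (c 6 * (2 * t)) t := by
      simpa using ((hasDerivAt_pow 2 t).const_mul (c 6)).const_add (c 5)
    refine (h1.div hDt hD).congr_deriv ?_
    field_simp
    ring
  have hy : HasDerivAt (yPar c)
      ((zNum c 0 + zNum c 1 * t + zNum c 2 * t ^ 2 + zNum c 3 * t ^ 3) / (c 0 + t ^ 2) ^ 3) t := by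
    have h1 : HasDerivAt (fun t => c 4 * t ^ 4 + c 3 * t ^ 2 + c 2 * t + c 1)
        (c 4 * (4 * t ^ 3) + c 3 * (2 * t) + c 2) t := by
      have := ((((hasDerivAt_pow 4 t).const_mul (c 4)).add
        ((hasDerivAt_pow 2 t).const_mul (c 3))).add
        ((hasDerivAt_id t).const_mul (c 2))).add_const (c 1)
      refine this.congr_deriv ?_
      simp
    refine (h1.div (hDt.pow 2) (pow_ne_zero 2 hD)).congr_deriv ?_
    simp only [zNum, Matrix.cons_val, Pi.pow_apply]
    field_simp
    ring
  rw [zPar, hx.deriv, hy.deriv]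
  field_simp

/-- The flow of z² acts on homogeneous coordinates as a linear shear: 2y - xz is unchanged and only
x receives -2bz. In 2y - xz one of the two factors b₀ + t² of the denominator cancels, so the stated
multiplier clears all denominators and leaves cubics. -/
theorem chartVec_flowZSq_eq (b : 𝕜) {c : Fin 7 → 𝕜} (hc : Admissible c) {t : 𝕜} (ht : t ≠ 0)
    (hD : c 0 + t ^ 2 ≠ 0) :
    (2 * (c 0 * c 6 - c 5) * t * (c 0 + t ^ 2)) •
      chartVec (flowZSq b (xPar c t, yPar c t, zPar c t)) = cubicMap (curveFrame b c) 1 t := by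
  have hk : c 0 * c 6 - c 5 ≠ 0 := sub_ne_zero.2 (Ne.symm hc.2.2)
  rw [zPar_eq hc ht hD]
  refine V4.ext ?_ ?_ ?_ ?_ <;>
    simp [chartVec, flowZSq, cubicMap, curveFrame, xPar, yPar, zNum, wNum] <;> field_simp <;> ring

/-- Each curve of the family is a translate of the standard contact cubic. -/
theorem exists_contactCurve_eq_smul (b : 𝕜) {c : Fin 7 → 𝕜} (hc : Admissible c) :
    ∃ (g : Sp4 𝕜) (k : 𝕜), k ≠ 0 ∧ contactCurve b c = g • stdCurve 𝕜 ∧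
      ∀ s t, g • stdMap s t = (k ^ 2)⁻¹ • cubicMap (curveFrame b c) s (-k * t) := by
  have hk0 : c 0 * c 6 - c 5 ≠ 0 := sub_ne_zero.2 (Ne.symm hc.2.2)
  have hk : 2 * (c 0 * c 6 - c 5) ^ 2 * c 2 ≠ 0 :=
    mul_ne_zero (mul_ne_zero two_ne_zero (pow_ne_zero 2 hk0)) hc.2.1
  obtain ⟨g, hg⟩ := (isContactFrame_curveFrame b c).exists_sp hk
  set k := 2 * (c 0 * c 6 - c 5) ^ 2 * c 2
  refine ⟨g, k, hk, ?_, hg⟩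
  have key : ∀ t : 𝕜, t ≠ 0 → c 0 + t ^ 2 ≠ 0 → ∃ h : g • stdMap 1 (-k⁻¹ * t) ≠ 0,
      chart (flowZSq b (xPar c t, yPar c t, zPar c t)) =
        Projectivization.mk 𝕜 (g • stdMap 1 (-k⁻¹ * t)) h := by
    intro t ht hD
    refine ⟨(smul_ne_zero_iff_ne g).2 (stdMap_ne_zero (by simp)), ?_⟩
    rw [chart, Projectivization.mk_eq_mk_iff']
    refine ⟨k ^ 2 * (2 * (c 0 * c 6 - c 5) * t * (c 0 + t ^ 2))⁻¹, ?_⟩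
    have h1 : -k * (-k⁻¹ * t) = t := by field_simp
    have h2 : 2 * (c 0 * c 6 - c 5) * t * (c 0 + t ^ 2) ≠ 0 :=
      mul_ne_zero (mul_ne_zero (mul_ne_zero two_ne_zero hk0) ht) hD
    rw [hg, h1, ← chartVec_flowZSq_eq b hc ht hD, smul_smul, smul_smul]
    convert one_smul 𝕜 _
    field_simp
  refine zariskiClosure_eq_smul_stdCurve g ?_ ?_
  · rintro _ ⟨t, ht, hD, rfl⟩
    obtain ⟨h, ht⟩ := key t ht hD
    rw [ht]
    exact smul_stdMap_mem g h
  · have hT : {t : 𝕜 | t ≠ 0 ∧ c 0 + t ^ 2 ≠ 0}.Infinite := by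
      have hP : (Polynomial.X * (Polynomial.C (c 0) + Polynomial.X ^ 2) : Polynomial 𝕜) ≠ 0 := by
        intro h
        have := congrArg (Polynomial.eval 1) h
        have h2 := congrArg (Polynomial.eval 2) h
        simp at this h2
        exact one_ne_zero (α := 𝕜) (by linear_combination (h2 - this) / 3)
      have hfin := Polynomial.finite_setOfPred_isRoot hP
      refine hfin.infinite_compl.mono fun t ht => ?_
      simpa [Polynomial.IsRoot] using ht
    refine (hT.image (f := fun t => chart (flowZSq b (xPar c t, yPar c t, zPar c t))) ?_).mono ?_
    · rintro t ⟨ht, hD⟩ t' ⟨ht', hD'⟩ h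
      obtain ⟨h1, h1'⟩ := key t ht hD
      obtain ⟨h2, h2'⟩ := key t' ht' hD'
      simp only at h
      rw [h1', h2', Projectivization.mk_eq_mk_iff'] at h
      obtain ⟨l, hl⟩ := h
      rw [← sp_smul_smul] at hl
      have := stdMap_one_injective (MulAction.injective g hl)
      exact mul_left_cancel₀ (neg_ne_zero.2 (inv_ne_zero hk)) this
    · rintro _ ⟨t, ⟨ht, hD⟩, rfl⟩
      exact ⟨t, ht, hD, rfl⟩

theorem isRationalContactCubic_contactCurve (b : 𝕜) {c : Fin 7 → 𝕜} (hc : Admissible c) :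
    IsRationalContactCubic (contactCurve b c) := by
  obtain ⟨g, k, -, h, -⟩ := exists_contactCurve_eq_smul b hc
  rw [h]
  exact isRationalContactCubic_smul_stdCurve g

/-- The family is the orbit of the standard contact cubic. -/
theorem mem_contactFamily_iff {C : Set (P3 𝕜)} :
    C ∈ contactFamily 𝕜 ↔ ∃ g : Sp4 𝕜, C = g • stdCurve 𝕜 := by
  constructor
  · rintro ⟨g, b, c, hc, rfl⟩
    obtain ⟨h, k, -, hh, -⟩ := exists_contactCurve_eq_smul b hc
    exact ⟨g * h, by rw [hh, mul_smul]⟩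
  · rintro ⟨g, rfl⟩
    -- A single admissible vector suffices: its curve is a translate of the standard cubic, so the
    -- orbit of the latter lies in the family.
    have hc : Admissible (𝕜 := 𝕜) ![1, 0, 1, 0, 0, 1, 0] := by simp [Admissible]
    obtain ⟨h, k, -, hh, -⟩ := exists_contactCurve_eq_smul 0 hc
    exact ⟨g * h⁻¹, 0, _, hc, by rw [hh, mul_smul, inv_smul_smul]⟩

end Contact

end SubmaximalODE
end

noncomputable section
set_option linter.unusedSectionVars false
namespace SubmaximalODE

/-! ### The flow of `z²` and the plane quartics -/

section Parameters

variable {𝕜 : Type*} [RCLike 𝕜]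

theorem isContactFlow_flowZSq :
    IsContactFlow (𝕜 := 𝕜) (fun _ _ z => z ^ 2) flowZSq := by
  intro p
  refine ⟨by simp [flowZSq], fun b => ?_⟩
  have hfield : contactField (fun _ _ z => z ^ 2) (flowZSq b p) =
      (-(2 * p.2.2), -p.2.2 ^ 2, 0) := by
    have h : deriv (fun z : 𝕜 => z ^ 2) p.2.2 = 2 * p.2.2 := by
      simp
    simp only [contactField, flowZSq, h, deriv_const, Prod.mk.injEq]
    refine ⟨trivial, by ring, by ring⟩
  rw [hfield]
  refine HasDerivAt.prodMk ?_ (HasDerivAt.prodMk ?_ ?_)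
  · refine (((((hasDerivAt_id b).const_mul 2).mul_const p.2.2)).const_sub p.1).congr_deriv ?_
    simp
  · refine ((((hasDerivAt_id b).mul_const (p.2.2 ^ 2))).const_sub p.2.1).congr_deriv ?_
    simp
  · exact hasDerivAt_const b p.2.2

/-- The parameter is t = (y + Q(x))/(x - r)². The equation becomes t² + k = k(s - r)/(x - r), which
gives x as a function of t² and then y. The point with x = r corresponds to t = ∞. -/
theorem quartic_eq_planeCurve {k r s q0 q1 q2 : 𝕜} (hk : k ≠ 0) (hrs : r ≠ s) :
    {q : 𝕜 × 𝕜 | (q.2 + (q0 + q1 * q.1 + q2 * q.1 ^ 2)) ^ 2 +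
      k * (q.1 - r) ^ 3 * (q.1 - s) = 0} = planeCurve
        ![k, k ^ 2 * (-(q0 + q1 * s + q2 * s ^ 2)), k ^ 2 * (s - r) ^ 2,
          k * (-(2 * q0 + q1 * (r + s) + 2 * q2 * r * s)), -(q0 + q1 * r + q2 * r ^ 2),
          k * s, r] := by
  have hsr : s - r ≠ 0 := sub_ne_zero.2 (Ne.symm hrs)
  ext ⟨x, y⟩
  simp only [planeCurve, xPar, yPar, Matrix.cons_val, Set.mem_insert_iff, Set.mem_ofPred_eq,
    Prod.mk.injEq]
  constructor
  · intro h
    by_cases hx : x = r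
    · left
      subst hx
      refine ⟨rfl, ?_⟩
      simp at h
      linear_combination h
    · right
      have hx' : x - r ≠ 0 := sub_ne_zero.2 hx
      have hD : k + ((y + (q0 + q1 * x + q2 * x ^ 2)) / (x - r) ^ 2) ^ 2 =
          k * (s - r) / (x - r) := by
        field_simp
        linear_combination h
      refine ⟨(y + (q0 + q1 * x + q2 * x ^ 2)) / (x - r) ^ 2, ?_, ?_, ?_⟩
      · rw [hD]
        exact div_ne_zero (mul_ne_zero hk hsr) hx'
      · rw [hD]
        have ht : ((y + (q0 + q1 * x + q2 * x ^ 2)) / (x - r) ^ 2) ^ 2 =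
          k * (s - r) / (x - r) - k := by linear_combination hD
        rw [ht]
        field_simp
        ring
      · have ht : ((y + (q0 + q1 * x + q2 * x ^ 2)) / (x - r) ^ 2) ^ 2 =
          k * (s - r) / (x - r) - k := by linear_combination hD
        rw [hD]
        have ht4 : ((y + (q0 + q1 * x + q2 * x ^ 2)) / (x - r) ^ 2) ^ 4 =
          (k * (s - r) / (x - r) - k) ^ 2 := by rw [← ht]; ring
        rw [ht, ht4]
        field_simp
        ring
  · rintro (⟨rfl, rfl⟩ | ⟨t, hD, rfl, rfl⟩)
    · ring
    · field_simp
      ring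

theorem xPar_rescale {l : 𝕜} (hl : l ≠ 0) (c : Fin 7 → 𝕜) (t : 𝕜) :
    xPar (rescale l c) t = xPar c (l * t) := by
  simp only [xPar, rescale, Matrix.cons_val]
  rw [show c 5 / l ^ 2 + c 6 * t ^ 2 = (c 5 + c 6 * (l * t) ^ 2) / l ^ 2 by field_simp,
    show c 0 / l ^ 2 + t ^ 2 = (c 0 + (l * t) ^ 2) / l ^ 2 by field_simp]
  exact div_div_div_cancel_right₀ (pow_ne_zero 2 hl) _ _

theorem yPar_rescale {l : 𝕜} (hl : l ≠ 0) (c : Fin 7 → 𝕜) (t : 𝕜) :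
    yPar (rescale l c) t = yPar c (l * t) := by
  simp only [yPar, rescale, Matrix.cons_val]
  rw [show c 4 * t ^ 4 + c 3 / l ^ 2 * t ^ 2 + c 2 / l ^ 3 * t + c 1 / l ^ 4 =
      (c 4 * (l * t) ^ 4 + c 3 * (l * t) ^ 2 + c 2 * (l * t) + c 1) / l ^ 4 by field_simp,
    show (c 0 / l ^ 2 + t ^ 2) ^ 2 = (c 0 + (l * t) ^ 2) ^ 2 / l ^ 4 by field_simp]
  exact div_div_div_cancel_right₀ (pow_ne_zero 4 hl) _ _

theorem zPar_rescale {l : 𝕜} (hl : l ≠ 0) (c : Fin 7 → 𝕜) (t : 𝕜) :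
    zPar (rescale l c) t = zPar c (l * t) := by
  have hx : xPar (rescale l c) = fun t => xPar c (l * t) := funext (xPar_rescale hl c)
  have hy : yPar (rescale l c) = fun t => yPar c (l * t) := funext (yPar_rescale hl c)
  rw [zPar, hx, hy, deriv_comp_mul_left, deriv_comp_mul_left, smul_eq_mul, smul_eq_mul,
    mul_div_mul_left _ _ hl, zPar]

theorem rescale_denominator_ne_zero {l : 𝕜} (hl : l ≠ 0) (c : Fin 7 → 𝕜) (t : 𝕜) :
    rescale l c 0 + t ^ 2 ≠ 0 ↔ c 0 + (l * t) ^ 2 ≠ 0 := by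
  have h : l ^ 2 * (rescale l c 0 + t ^ 2) = c 0 + (l * t) ^ 2 := by
    simp only [rescale, Matrix.cons_val]
    field_simp
  rw [← h]
  simp [hl]

theorem planeCurve_rescale {l : 𝕜} (hl : l ≠ 0) (c : Fin 7 → 𝕜) :
    planeCurve (rescale l c) = planeCurve c := by
  refine congrArg (insert (c 6, c 4)) (Set.ext fun q => ?_)
  simp only [Set.mem_ofPred_eq, rescale_denominator_ne_zero hl, xPar_rescale hl, yPar_rescale hl]
  exact (mul_left_surjective₀ hl).exists
    (p := fun t => c 0 + t ^ 2 ≠ 0 ∧ q = (xPar c t, yPar c t)) |>.symm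

theorem contactCurve_rescale {l : 𝕜} (hl : l ≠ 0) (b : 𝕜) (c : Fin 7 → 𝕜) :
    contactCurve b (rescale l c) = contactCurve b c := by
  refine congrArg zariskiClosure (Set.ext fun q => ?_)
  simp only [Set.mem_ofPred_eq, rescale_denominator_ne_zero hl, xPar_rescale hl, yPar_rescale hl,
    zPar_rescale hl]
  conv_rhs => rw [(mul_left_surjective₀ hl).exists]
  simp [hl]

theorem quarticCurves_eq :
    quarticCurves 𝕜 = {Γ | ∃ c : Fin 7 → 𝕜, Admissible c ∧ Γ = planeCurve c} := by
  ext Γ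
  constructor
  · rintro ⟨Q, P, hQ, ⟨k, r, s, hk, hrs, rfl⟩, rfl⟩
    have hsr : s - r ≠ 0 := sub_ne_zero.2 (Ne.symm hrs)
    refine ⟨![k, k ^ 2 * (-(Q.coeff 0 + Q.coeff 1 * s + Q.coeff 2 * s ^ 2)), k ^ 2 * (s - r) ^ 2,
          k * (-(2 * Q.coeff 0 + Q.coeff 1 * (r + s) + 2 * Q.coeff 2 * r * s)),
          -(Q.coeff 0 + Q.coeff 1 * r + Q.coeff 2 * r ^ 2), k * s, r], ?_, ?_⟩
    · simp [Admissible, hk, hsr, Ne.symm hrs]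
    · rw [← quartic_eq_planeCurve (q0 := Q.coeff 0) (q1 := Q.coeff 1) (q2 := Q.coeff 2) hk hrs]
      ext ⟨x, y⟩
      have : Q.eval x = Q.coeff 0 + Q.coeff 1 * x + Q.coeff 2 * x ^ 2 := by
        rw [Polynomial.eval_eq_sum_range' (n := 3) (by omega)]
        simp [Finset.sum_range_succ]
      simp [this]
  · rintro ⟨c, hc, rfl⟩
    obtain ⟨h0, h2, h5⟩ := hc
    have h5' : c 5 - c 0 * c 6 ≠ 0 := sub_ne_zero.2 h5
    -- Parameter vectors that come from quartics satisfy b₂ = (b₅ - b₀b₆)². Rescaling by this `l`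
    -- puts an arbitrary admissible vector into that slice.
    obtain ⟨l, hl, hl2⟩ : ∃ l, l ≠ 0 ∧ c 2 * l = (c 5 - c 0 * c 6) ^ 2 :=
      ⟨(c 5 - c 0 * c 6) ^ 2 / c 2, div_ne_zero (pow_ne_zero 2 h5') h2, by field_simp⟩
    obtain ⟨k, hk⟩ : ∃ k, k = c 0 / l ^ 2 := ⟨_, rfl⟩
    obtain ⟨r, hr⟩ : ∃ r, r = c 6 := ⟨_, rfl⟩
    obtain ⟨s, hs⟩ : ∃ s, s = c 5 / c 0 := ⟨_, rfl⟩
    have hk0 : k ≠ 0 := hk ▸ div_ne_zero h0 (pow_ne_zero 2 hl)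
    have hrs : r - s ≠ 0 := by
      rw [hr, hs]
      intro h
      apply h5'
      field_simp at h
      linear_combination -h
    -- The three conditions prescribe Q(r), Q(s) and the polar value of Q at (r, s). As r ≠ s, these
    -- determine a quadratic polynomial.
    obtain ⟨q0, q1, q2, hq1, hq2, hq3⟩ : ∃ q0 q1 q2 : 𝕜,
        -(q0 + q1 * r + q2 * r ^ 2) = c 4 ∧
        k * (-(2 * q0 + q1 * (r + s) + 2 * q2 * r * s)) = c 3 / l ^ 2 ∧
        k ^ 2 * (-(q0 + q1 * s + q2 * s ^ 2)) = c 1 / l ^ 4 := by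
      generalize c 3 / l ^ 2 = B
      generalize c 1 / l ^ 4 = A
      refine ⟨(s ^ 2 * -c 4 + r * s * (B / k) + r ^ 2 * (-A / k ^ 2)) / (r - s) ^ 2,
        (-2 * s * -c 4 - (r + s) * (B / k) - 2 * r * (-A / k ^ 2)) / (r - s) ^ 2,
        (-c 4 + B / k - A / k ^ 2) / (r - s) ^ 2, ?_, ?_, ?_⟩ <;> field_simp <;> ring
    have hc : rescale l c = ![k, k ^ 2 * (-(q0 + q1 * s + q2 * s ^ 2)), k ^ 2 * (s - r) ^ 2,
          k * (-(2 * q0 + q1 * (r + s) + 2 * q2 * r * s)), -(q0 + q1 * r + q2 * r ^ 2),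
          k * s, r] := by
      rw [hq1, hq2, hq3, rescale, hk, hr, hs]
      have e2 : c 2 / l ^ 3 = (c 0 / l ^ 2) ^ 2 * (c 5 / c 0 - c 6) ^ 2 := by
        field_simp
        linear_combination hl2
      have e5 : c 5 / l ^ 2 = c 0 / l ^ 2 * (c 5 / c 0) := by field_simp
      rw [e2, e5]
    refine ⟨.C q0 + .C q1 * .X + .C q2 * .X ^ 2, _, ?_, ⟨k, r, s, hk0, sub_ne_zero.1 hrs, rfl⟩, ?_⟩
    · compute_degree
    · rw [← planeCurve_rescale hl, hc, ← quartic_eq_planeCurve hk0 (sub_ne_zero.1 hrs)]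
      simp

/-! ### Parameter vectors that define the same curve. -/

theorem cubicMap_injective {a a' : Fin 4 → V4 𝕜}
    (h : ∀ s t, cubicMap a s t = cubicMap a' s t) : a = a' := by
  have e0 := h 1 0
  have e3 := h 0 1
  have e1 := h 1 1
  have e2 := h 1 (-1)
  simp only [cubicMap] at e0 e1 e2 e3
  have h0 : a 0 = a' 0 := by simpa using e0
  have h3 : a 3 = a' 3 := by simpa using e3
  rw [h0, h3] at e1 e2
  have h2 : a 2 = a' 2 := by
    funext i
    have f1 := congrFun e1 i
    have f2 := congrFun e2 i
    simp only [Pi.add_apply, Pi.smul_apply, smul_eq_mul] at f1 f2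
    linear_combination (f1 + f2) / 2
  have h1 : a 1 = a' 1 := by
    funext i
    have f1 := congrFun e1 i
    rw [h2] at f1
    simp only [Pi.add_apply, Pi.smul_apply, smul_eq_mul] at f1
    linear_combination f1
  funext i
  fin_cases i <;> assumption

/-- A projective change of parameter between two of the curves with the same `b` is a rescaling. -/
theorem eq_rescale_of_cubicMap_eq {b : 𝕜} {c c' : Fin 7 → 𝕜} (hc : Admissible c)
    (hc' : Admissible c') {e p q r w : 𝕜} (he : e ≠ 0) (hdet : p * w - q * r ≠ 0)
    (H : ∀ s t, cubicMap (curveFrame b c) s t =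
      e • cubicMap (curveFrame b c') (p * s + q * t) (r * s + w * t)) :
    ∃ l : 𝕜, l ≠ 0 ∧ c' = rescale l c := by
  obtain ⟨k, hk⟩ : ∃ k, k = c 0 * c 6 - c 5 := ⟨_, rfl⟩
  obtain ⟨k', hk'⟩ : ∃ k', k' = c' 0 * c' 6 - c' 5 := ⟨_, rfl⟩
  have hk0 : k ≠ 0 := hk ▸ sub_ne_zero.2 (Ne.symm hc.2.2)
  have hk0' : k' ≠ 0 := hk' ▸ sub_ne_zero.2 (Ne.symm hc'.2.2)
  have hc0' : c' 0 ≠ 0 := hc'.1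
  have H0 : ∀ s t : 𝕜, k * (c 0 * (s ^ 2 * t) + t ^ 3) =
      e * (k' * (c' 0 * ((p * s + q * t) ^ 2 * (r * s + w * t)) + (r * s + w * t) ^ 3)) := by
    intro s t
    have h := congrFun (H s t) (Sum.inl 0)
    simp only [cubicMap, curveFrame, Pi.add_apply, Pi.smul_apply, smul_eq_mul, Matrix.cons_val,
      vec4_inl_zero, ← hk, ← hk'] at h
    linear_combination h / 2
  -- Adding 2b times the fourth coordinate to the second undoes the shear by `b`.
  have H1 : ∀ s t : 𝕜, k * (c 5 * (s ^ 2 * t) + c 6 * t ^ 3) =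
      e * (k' * (c' 5 * ((p * s + q * t) ^ 2 * (r * s + w * t)) +
        c' 6 * (r * s + w * t) ^ 3)) := by
    intro s t
    have h := congrFun (H s t) (Sum.inl 1)
    have h3 := congrFun (H s t) (Sum.inr 1)
    simp only [cubicMap, curveFrame, Pi.add_apply, Pi.smul_apply, smul_eq_mul, Matrix.cons_val,
      vec4_inl_one, vec4_inr_one, ← hk, ← hk'] at h h3
    linear_combination h / 2 + b * h3
  -- The forms in `H0` and `H1` both vanish at t = 0. On the right their only common zero is where
  -- the new parameter is 0, because the quadratic factors are linearly independent (k' ≠ 0). So the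
  -- change of parameter fixes t = 0.
  have hr : r = 0 := by
    by_contra hr
    have e0 := H0 1 0
    have e1 := H1 1 0
    have h0 : c' 0 * p ^ 2 + r ^ 2 = 0 := by
      refine mul_left_cancel₀ (mul_ne_zero (mul_ne_zero he hk0') hr) ?_
      linear_combination -e0
    have h1 : c' 5 * p ^ 2 + c' 6 * r ^ 2 = 0 := by
      refine mul_left_cancel₀ (mul_ne_zero (mul_ne_zero he hk0') hr) ?_
      linear_combination -e1
    have h2 : p = 0 := by
      have : k' * p ^ 2 = 0 := by rw [hk']; linear_combination c' 6 * h0 - h1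
      simpa [hk0'] using this
    rw [h2] at h0
    exact hr (by simpa using h0)
  subst hr
  have hp : p ≠ 0 := by rintro rfl; exact hdet (by ring)
  have hw : w ≠ 0 := by rintro rfl; exact hdet (by ring)
  -- The left side of `H0` is even in s, so the st² term on the right must vanish.
  have hq : q = 0 := by
    refine mul_left_cancel₀ (a := 4 * e * k' * c' 0 * p * w) (by simp [he, hk0', hc0', hp, hw]) ?_
    linear_combination H0 (-1) 1 - H0 1 1
  subst hq
  have hcoef : curveFrame b c = fun j : Fin 4 =>
      (e * p ^ (3 - (j : ℕ)) * w ^ (j : ℕ)) • curveFrame b c' j := by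
    refine cubicMap_injective fun s t => ?_
    rw [H]
    simp only [cubicMap, Fin.val_zero, Fin.val_one, Fin.val_two]
    norm_num
    module
  obtain ⟨l, hl⟩ : ∃ l, l = p / w := ⟨_, rfl⟩
  have hl0 : l ≠ 0 := hl ▸ div_ne_zero hp hw
  have hpl : p = l * w := by rw [hl]; field_simp
  obtain ⟨E, hE⟩ : ∃ E, E = e * w ^ 3 := ⟨_, rfl⟩
  have hE0 : E ≠ 0 := hE ▸ mul_ne_zero he (pow_ne_zero 3 hw)
  have f (j : Fin 4) (i : Fin 2 ⊕ Fin 2) : curveFrame b c j i =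
      E * l ^ (3 - (j : ℕ)) * curveFrame b c' j i := by
    have := congrFun (congrFun hcoef j) i
    rw [Pi.smul_apply, smul_eq_mul] at this
    rw [this, hE, hpl, mul_pow, ← pow_sub_mul_pow w (Nat.le_of_lt_succ j.2)]
    ring
  have f30 := f 3 (.inl 0)
  have f10 := f 1 (.inl 0)
  have f11 := f 1 (.inl 1)
  have f31 := f 3 (.inl 1)
  have f13 := f 1 (.inr 1)
  have f33 := f 3 (.inr 1)
  have f23 := f 2 (.inr 1)
  have f32 := f 3 (.inr 0)
  simp [curveFrame, zNum, wNum, ← hk, ← hk'] at f30 f10 f11 f31 f13 f33 f23 f32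
  have k0 : k = E * k' := by linear_combination f30 / 2
  have c0 : c 0 = l ^ 2 * c' 0 := by
    refine mul_left_cancel₀ hk0 ?_
    linear_combination f10 / 2 - l ^ 2 * c' 0 * k0
  have c5 : c 5 = l ^ 2 * c' 5 := by
    refine mul_left_cancel₀ hk0 ?_
    linear_combination f11 / 2 + b * f13 - l ^ 2 * c' 5 * k0
  have c6 : c 6 = c' 6 := by
    refine mul_left_cancel₀ hk0 ?_
    linear_combination f31 / 2 + b * f33 - c' 6 * k0
  -- The scalar is not free: b₀b₆ - b₅ has weight two under rescaling, while the leading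
  -- coefficients multiply it by `E`.
  have hEl : E = l ^ 2 := by
    refine mul_right_cancel₀ hk0' ?_
    rw [← k0, hk, hk', c0, c5, c6]
    ring
  subst hEl
  have c2 : c 2 = l ^ 3 * c' 2 := by
    linear_combination f23 / 3
  have c4 : c 4 = c' 4 := by
    refine mul_left_cancel₀ hk0 ?_
    rw [c6] at f32
    linear_combination f32 / 4 + c' 6 * f33 / 4 - c' 4 * k0
  have c3 : c 3 = l ^ 2 * c' 3 := by
    rw [c0, c4] at f33
    linear_combination -f33 / 2
  have c1 : c 1 = l ^ 4 * c' 1 := by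
    rw [c0, c3] at f13
    linear_combination -f13 / 4
  refine ⟨l, hl0, ?_⟩
  funext i
  fin_cases i <;> simp [rescale, c0, c1, c2, c3, c4, c5, c6, hl0]

/-- Equal curves give a stabilising matrix, hence an element of SL(2) that relates the two cubic
parametrizations. -/
theorem contactCurve_eq_iff (b : 𝕜) {c c' : Fin 7 → 𝕜} (hc : Admissible c)
    (hc' : Admissible c') :
    contactCurve b c = contactCurve b c' ↔ ∃ l : 𝕜, l ≠ 0 ∧ c' = rescale l c := by
  constructor
  · intro h
    obtain ⟨g, k, hk, hg, hgm⟩ := exists_contactCurve_eq_smul b hc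
    obtain ⟨g', k', hk', hg', hgm'⟩ := exists_contactCurve_eq_smul b hc'
    have hstab : (g'⁻¹ * g) • stdCurve 𝕜 = stdCurve 𝕜 := by
      rw [mul_smul, ← hg, h, hg', inv_smul_smul]
    obtain ⟨m, hm⟩ := exists_cubicRep_of_stab hstab
    have hdet := m.2
    rw [Matrix.det_fin_two] at hdet
    have hgg : g = g' * cubicRep m := by rw [hm, mul_inv_cancel_left]
    refine eq_rescale_of_cubicMap_eq (b := b) hc hc' (e := k ^ 2 * (k' ^ 2)⁻¹) (p := m.1 0 0)
      (q := m.1 0 1 * -k⁻¹) (r := -k' * m.1 1 0) (w := -k' * (m.1 1 1 * -k⁻¹))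
      (mul_ne_zero (pow_ne_zero 2 hk) (inv_ne_zero (pow_ne_zero 2 hk'))) ?_ fun s t => ?_
    · have : m.1 0 0 * (-k' * (m.1 1 1 * -k⁻¹)) - m.1 0 1 * -k⁻¹ * (-k' * m.1 1 0) = k' * k⁻¹ := by
        linear_combination k' * k⁻¹ * hdet
      rw [this]
      exact mul_ne_zero hk' (inv_ne_zero hk)
    · have h1 := hgm s (-k⁻¹ * t)
      have h2 : -k * (-k⁻¹ * t) = t := by field_simp
      rw [hgg, mul_smul, cubicRep_smul_stdMap, hgm', h2] at h1
      rw [mul_smul, eq_comm]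
      convert congrArg (fun v => k ^ 2 • v) h1 using 2
      · congr 2 <;> ring
      · rw [smul_smul, mul_inv_cancel₀ (pow_ne_zero 2 hk), one_smul]
  · rintro ⟨l, hl, rfl⟩
    exact (contactCurve_rescale hl b c).symm

end Parameters

end SubmaximalODE
end

noncomputable section
set_option linter.unusedSectionVars false
namespace SubmaximalODE

/-! ### At most three values of `b` -/

section CountB

variable {𝕜 : Type*} [RCLike 𝕜]

theorem encard_image_roots_le {P : Polynomial 𝕜} {n : ℕ} (hP : P ≠ 0) (hn : P.natDegree ≤ n)
    (F : 𝕜 → 𝕜) : (F '' {t | P.eval t = 0}).encard ≤ n := by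
  have h : {t | P.eval t = 0} ⊆ (P.roots.toFinset : Set 𝕜) := by
    intro t ht
    simpa [hP] using ht
  refine ((Set.encard_image_le F _).trans (Set.encard_le_encard h)).trans ?_
  rw [Set.encard_coe_eq_coe_finsetCard]
  exact_mod_cast (Multiset.toFinset_card_le _).trans ((P.card_roots').trans hn)

/-- At t = 0 the curve meets the plane at infinity, where the first homogeneous coordinate vanishes.
There the ratio of the second to the fourth coordinate is -2b. -/
theorem exists_b_of_contactCurve_eq {b : 𝕜} {c : Fin 7 → 𝕜} (hc : Admissible c) {g : Sp4 𝕜}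
    (h : contactCurve b c = g • stdCurve 𝕜) :
    (∃ t : 𝕜, (g • stdMap 1 t) (Sum.inl 0) = 0 ∧
      b = -(g • stdMap 1 t) (Sum.inl 1) / (2 * (g • stdMap 1 t) (Sum.inr 1))) ∨
    ((g • stdMap (0 : 𝕜) 1) (Sum.inl 0) = 0 ∧
      b = -(g • stdMap (0 : 𝕜) 1) (Sum.inl 1) / (2 * (g • stdMap (0 : 𝕜) 1) (Sum.inr 1))) := by
  obtain ⟨g', k, hk, hg', hgm'⟩ := exists_contactCurve_eq_smul b hc
  have hne : g' • stdMap (1 : 𝕜) 0 ≠ 0 := (smul_ne_zero_iff_ne g').2 (stdMap_ne_zero (by simp))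
  have hmem := smul_stdMap_mem g' hne
  rw [← hg', h, mk_mem_smul_stdCurve] at hmem
  have hz : zNum c 0 ≠ 0 := by simpa [zNum] using ⟨hc.1, hc.2.1⟩
  have key : ∀ (l : 𝕜) (u : V4 𝕜), g⁻¹ • g' • stdMap (1 : 𝕜) 0 = l • u →
      (g • u) (Sum.inl 0) = 0 ∧
        b = -(g • u) (Sum.inl 1) / (2 * (g • u) (Sum.inr 1)) := by
    intro l u hu
    rw [inv_smul_eq_iff, sp_smul_smul, hgm'] at hu
    have h0 := congrFun hu (Sum.inl 0)
    have h1 := congrFun hu (Sum.inl 1)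
    have h3 := congrFun hu (Sum.inr 1)
    simp [cubicMap, curveFrame] at h0 h1 h3
    have hl : l ≠ 0 := by
      rintro rfl
      simp [hk, hz] at h3
    have h3' : (g • u) (Sum.inr 1) ≠ 0 := by
      intro h
      rw [h] at h3
      simp [hk, hz] at h3
    refine ⟨h0.resolve_left hl, ?_⟩
    rw [eq_div_iff (mul_ne_zero two_ne_zero h3')]
    refine mul_left_cancel₀ hl ?_
    linear_combination -2 * b * h3 - h1
  obtain ⟨l, t, hl⟩ | ⟨l, hl⟩ := hmem.exists_stdMap
  · exact Or.inl ⟨t, key l _ hl⟩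
  · exact Or.inr (key l _ hl)

/-- Each `b` comes from a point of the cubic in the plane at infinity. These points are the zeros of
a binary cubic form, which is nonzero because an invertible matrix has no zero row. -/
theorem encard_b_le_three (C : Set (P3 𝕜)) :
    {b : 𝕜 | ∃ c : Fin 7 → 𝕜, Admissible c ∧ contactCurve b c = C}.encard ≤ 3 := by
  rcases Set.eq_empty_or_nonempty
    {b : 𝕜 | ∃ c : Fin 7 → 𝕜, Admissible c ∧ contactCurve b c = C} with h | ⟨b, c, hc, rfl⟩
  · rw [h]; simp
  obtain ⟨g, -, -, hg, -⟩ := exists_contactCurve_eq_smul b hc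
  rw [hg]
  obtain ⟨F, hF⟩ : ∃ F : 𝕜 → 𝕜, F = fun t =>
    -(g • stdMap 1 t) (Sum.inl 1) / (2 * (g • stdMap 1 t) (Sum.inr 1)) := ⟨_, rfl⟩
  obtain ⟨P, hP⟩ : ∃ P : Polynomial 𝕜, P = .C (g.1 (.inl 0) (.inl 0)) +
    .C (g.1 (.inl 0) (.inl 1)) * .X + .C (-3 * g.1 (.inl 0) (.inr 1)) * .X ^ 2 +
      .C (g.1 (.inl 0) (.inr 0)) * .X ^ 3 := ⟨_, rfl⟩
  have hPt : ∀ t, P.eval t = (g • stdMap 1 t) (Sum.inl 0) := by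
    intro t
    simp [hP, sp_smul_eq, Matrix.mulVec, dotProduct, Fintype.sum_sum_type, stdMap]
    ring
  have h01 : (g • stdMap (0 : 𝕜) 1) (Sum.inl 0) = g.1 (.inl 0) (.inr 0) := by
    simp [sp_smul_eq, Matrix.mulVec, dotProduct, Fintype.sum_sum_type, stdMap]
  have hP0 : P ≠ 0 := by
    intro h0
    have hPe : ∀ t : 𝕜, g.1 (.inl 0) (.inl 0) + g.1 (.inl 0) (.inl 1) * t
        - 3 * g.1 (.inl 0) (.inr 1) * t ^ 2 + g.1 (.inl 0) (.inr 0) * t ^ 3 = 0 := by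
      intro t
      have := congrArg (Polynomial.eval t) h0
      simp [hP] at this
      linear_combination this
    have c0 : g.1 (.inl 0) (.inl 0) = 0 := by linear_combination hPe 0
    have c3 : g.1 (.inl 0) (.inr 1) = 0 := by
      linear_combination -(hPe 1 + hPe (-1)) / 6 + hPe 0 / 3
    have c2 : g.1 (.inl 0) (.inr 0) = 0 := by
      linear_combination (hPe 2 - 2 * hPe 1 + c0 + 6 * c3) / 6
    have c1 : g.1 (.inl 0) (.inl 1) = 0 := by
      linear_combination hPe 1 - c0 + 3 * c3 - c2
    have : (g • g⁻¹ • vec4 (1 : 𝕜) 0 0 0) (Sum.inl 0) = 0 := by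
      rw [sp_smul_eq g]
      simp [Matrix.mulVec, dotProduct, Fintype.sum_sum_type, c0, c1, c2, c3]
    rw [smul_inv_smul] at this
    simp at this
  -- If the top coefficient vanishes, [0 : 1] lies at infinity and accounts for one value of `b`,
  -- but the polynomial then has degree at most two.
  by_cases h3 : g.1 (.inl 0) (.inr 0) = 0
  · have hdeg : P.natDegree ≤ 2 := by
      rw [hP, h3]
      simp only [map_zero, zero_mul, add_zero]
      compute_degree
    have hsub : {b : 𝕜 | ∃ c : Fin 7 → 𝕜, Admissible c ∧ contactCurve b c = g • stdCurve 𝕜} ⊆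
        insert (-(g • stdMap (0 : 𝕜) 1) (Sum.inl 1) / (2 * (g • stdMap (0 : 𝕜) 1) (Sum.inr 1)))
          (F '' {t | P.eval t = 0}) := by
      rintro b ⟨c, hc, h⟩
      obtain ⟨t, ht, hb⟩ | ⟨-, hb⟩ := exists_b_of_contactCurve_eq hc h
      · exact Or.inr ⟨t, (hPt t).trans ht, by rw [hF, hb]⟩
      · exact Or.inl hb
    refine (Set.encard_le_encard hsub).trans ((Set.encard_insert_le _ _).trans ?_)
    exact (add_le_add_left (encard_image_roots_le hP0 hdeg F) 1).trans (by norm_num)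
  · have hdeg : P.natDegree ≤ 3 := by
      rw [hP]
      compute_degree
    refine (Set.encard_le_encard ?_).trans (encard_image_roots_le hP0 hdeg F)
    rintro b ⟨c, hc, h⟩
    obtain ⟨t, ht, hb⟩ | ⟨h0, -⟩ := exists_b_of_contactCurve_eq hc h
    · exact ⟨t, (hPt t).trans ht, by rw [hF, hb]⟩
    · exact absurd (h01 ▸ h0) h3

end CountB

/-! ### The stabiliser of a contact cubic -/

section Stabilizer

variable {𝕜 : Type*} [RCLike 𝕜]

/-- The matrix entries of an element of `SL(2)`, as polynomials in those of its image in `Sp(4)`. -/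
def recoverEntries (A : Matrix (Fin 2 ⊕ Fin 2) (Fin 2 ⊕ Fin 2) 𝕜) : Matrix (Fin 2) (Fin 2) 𝕜 :=
  let f : Fin 4 → 𝕜 := ![A (.inl 0) (.inl 0), A (.inl 1) (.inl 0), -A (.inr 1) (.inl 0) / 3,
    A (.inr 0) (.inl 0)]
  let G : Fin 4 → 𝕜 := ![-A (.inl 0) (.inr 1), -A (.inl 1) (.inr 1), A (.inr 1) (.inr 1) / 3,
    -A (.inr 0) (.inr 1)]
  let h : Fin 4 → 𝕜 := ![A (.inl 0) (.inr 0), A (.inl 1) (.inr 0), -A (.inr 1) (.inr 0) / 3,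
    A (.inr 0) (.inr 0)]
  let pp := 3 * (f 0 * G 2 - 2 * f 1 * G 1 + f 2 * G 0)
  let pr := 3 * (f 0 * G 3 - 2 * f 1 * G 2 + f 2 * G 1)
  let rr := 3 * (f 1 * G 3 - 2 * f 2 * G 2 + f 3 * G 1)
  !![3 * (pp * G 2 - 2 * pr * G 1 + rr * G 0), pp * h 2 - 2 * pr * h 1 + rr * h 0;
    3 * (pp * G 3 - 2 * pr * G 2 + rr * G 1), pp * h 3 - 2 * pr * h 2 + rr * h 1]

/-- The columns used are the coefficients of ℓ³, ℓm² and m³ for the linear forms ℓ = (p, r) and m =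
(q, w). Second transvectants give first det²·ℓ² and then det⁴·ℓ and det⁴·m. The inverse is therefore
polynomial, which yields both injectivity and continuity. -/
theorem recoverEntries_cubicRep (m : Matrix.SpecialLinearGroup (Fin 2) 𝕜) :
    recoverEntries (cubicRep m).1 = m.1 := by
  have hdet := m.2
  rw [Matrix.det_fin_two] at hdet
  have e := fun i j => cubicRep_apply m i j
  have h4 : (m.1 0 0 * m.1 1 1 - m.1 0 1 * m.1 1 0) ^ 4 = 1 := by rw [hdet, one_pow]
  ext i j
  fin_cases i <;> fin_cases j <;>
    simp only [recoverEntries, e, cubicCol, Fin.zero_eta, Fin.mk_one, Fin.isValue, Sum.elim_inl,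
      Sum.elim_inr, Matrix.cons_val, Matrix.of_apply, vec4_inl_zero, vec4_inl_one, vec4_inr_zero,
      vec4_inr_one]
  · linear_combination m.1 0 0 * h4
  · linear_combination m.1 0 1 * h4
  · linear_combination m.1 1 0 * h4
  · linear_combination m.1 1 1 * h4

theorem continuous_recoverEntries : Continuous (recoverEntries (𝕜 := 𝕜)) := by
  refine continuous_matrix fun i j => ?_
  fin_cases i <;> fin_cases j <;>
    simp only [recoverEntries, Fin.zero_eta, Fin.mk_one, Fin.isValue, Matrix.cons_val,
      Matrix.of_apply] <;>
    fun_prop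

theorem continuous_coe_cubicRep :
    Continuous fun m : Matrix.SpecialLinearGroup (Fin 2) 𝕜 => (cubicRep m).1 := by
  have h : ∀ i j, Continuous fun m : Matrix.SpecialLinearGroup (Fin 2) 𝕜 => m.1 i j :=
    fun i j => (continuous_apply_apply i j).comp continuous_subtype_val
  have h00 := h 0 0
  have h01 := h 0 1
  have h10 := h 1 0
  have h11 := h 1 1
  refine continuous_matrix fun i j => ?_
  simp only [cubicRep_apply]
  rcases i with i | i <;> rcases j with j | j <;> fin_cases i <;> fin_cases j <;>
    simp only [cubicCol, Fin.zero_eta, Fin.mk_one, Fin.isValue, Sum.elim_inl,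
      Sum.elim_inr, Matrix.cons_val, vec4_inl_zero, vec4_inl_one, vec4_inr_zero,
      vec4_inr_one] <;>
    fun_prop

theorem conj_cubicRep_mem_stabilizer (g : Sp4 𝕜) (m : Matrix.SpecialLinearGroup (Fin 2) 𝕜) :
    MulAut.conj g (cubicRep m) ∈ MulAction.stabilizer (Sp4 𝕜) (g • stdCurve 𝕜) := by
  rw [MulAction.mem_stabilizer_iff, MulAut.conj_apply, mul_smul, inv_smul_smul, mul_smul,
    cubicRep_smul_stdCurve]

/-- `SL(2)` acts on the translate by `g` of the standard contact cubic. -/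
def stabHom (g : Sp4 𝕜) : Matrix.SpecialLinearGroup (Fin 2) 𝕜 →*
    MulAction.stabilizer (Sp4 𝕜) (g • stdCurve 𝕜) :=
  ((MulAut.conj g).toMonoidHom.comp cubicRep).codRestrict _ (conj_cubicRep_mem_stabilizer g)

theorem stabHom_bijective (g : Sp4 𝕜) : Function.Bijective (stabHom g) := by
  constructor
  · intro m n h
    have h1 : MulAut.conj g (cubicRep m) = MulAut.conj g (cubicRep n) := congrArg Subtype.val h
    have h2 := (MulAut.conj g).injective h1
    apply Subtype.ext
    rw [← recoverEntries_cubicRep m, h2, recoverEntries_cubicRep]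
  · rintro ⟨h, hh⟩
    have h1 : (g⁻¹ * h * g) • stdCurve 𝕜 = stdCurve 𝕜 := by
      rw [mul_smul, mul_smul, MulAction.mem_stabilizer_iff.1 hh, inv_smul_smul]
    obtain ⟨m, hm⟩ := exists_cubicRep_of_stab h1
    refine ⟨m, Subtype.ext ?_⟩
    change MulAut.conj g (cubicRep m) = h
    rw [hm, MulAut.conj_apply]
    group

/-- The stabiliser of a contact cubic is isomorphic to `SL(2)`. -/
def stabEquiv (g : Sp4 𝕜) : Matrix.SpecialLinearGroup (Fin 2) 𝕜 ≃ₜ*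
    MulAction.stabilizer (Sp4 𝕜) (g • stdCurve 𝕜) :=
  { MulEquiv.ofBijective (stabHom g) (stabHom_bijective g) with
    continuous_toFun := by
      refine Continuous.subtype_mk (Continuous.subtype_mk ?_ _) _
      exact (continuous_const.matrix_mul continuous_coe_cubicRep).matrix_mul continuous_const
    continuous_invFun := by
      refine continuous_induced_rng.2 ?_
      have h : ∀ x : MulAction.stabilizer (Sp4 𝕜) (g • stdCurve 𝕜),
          ((MulEquiv.ofBijective (stabHom g) (stabHom_bijective g)).symm x).1 =
            recoverEntries ((g⁻¹).1 * x.1.1 * g.1) := by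
        intro x
        obtain ⟨m, rfl⟩ := (MulEquiv.ofBijective (stabHom g) (stabHom_bijective g)).surjective x
        rw [MulEquiv.symm_apply_apply, ← recoverEntries_cubicRep m]
        congr 1
        have : g⁻¹ * (g * cubicRep m * g⁻¹) * g = cubicRep m := by group
        exact (congrArg Subtype.val this).symm
      refine Continuous.congr ?_ fun x => (h x).symm
      refine continuous_recoverEntries.comp ?_
      exact (continuous_const.matrix_mul
        (continuous_subtype_val.comp continuous_subtype_val)).matrix_mul continuous_const }

theorem contactFamily_eq_orbit {C : Set (P3 𝕜)} (hC : C ∈ contactFamily 𝕜) :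
    contactFamily 𝕜 = MulAction.orbit (Sp4 𝕜) C := by
  obtain ⟨g, rfl⟩ := mem_contactFamily_iff.1 hC
  rw [MulAction.orbit_smul]
  ext C
  rw [mem_contactFamily_iff, MulAction.mem_orbit_iff]
  simp only [eq_comm]

theorem stabilizer_and_quotient {C : Set (P3 𝕜)} (hC : C ∈ contactFamily 𝕜) :
    Nonempty (Matrix.SpecialLinearGroup (Fin 2) 𝕜 ≃ₜ* MulAction.stabilizer (Sp4 𝕜) C) ∧
      ∃ e : (Sp4 𝕜 ⧸ MulAction.stabilizer (Sp4 𝕜) C) ≃ contactFamily 𝕜,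
        ∀ g : Sp4 𝕜, (e (QuotientGroup.mk g) : Set (P3 𝕜)) = g • C := by
  constructor
  · obtain ⟨g, rfl⟩ := mem_contactFamily_iff.1 hC
    exact ⟨stabEquiv g⟩
  · refine ⟨(MulAction.orbitEquivQuotientStabilizer (Sp4 𝕜) C).symm.trans
      (Equiv.setCongr (contactFamily_eq_orbit hC).symm), fun g => rfl⟩

end Stabilizer

end SubmaximalODE
end

noncomputable section
set_option linter.unusedSectionVars false
namespace SubmaximalODE

/-! ### Connectedness of the symplectic group -/

section Connected

variable {𝕜 : Type*} [RCLike 𝕜]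

instance : IsTopologicalGroup (Sp4 𝕜) where
  continuous_inv := by
    refine continuous_induced_rng.2 ?_
    change Continuous fun A : Sp4 𝕜 => (-Matrix.J (Fin 2) 𝕜) * (A.1).transpose * Matrix.J (Fin 2) 𝕜
    exact (continuous_const.matrix_mul continuous_subtype_val.matrix_transpose).matrix_mul
      continuous_const

/-- The matrix of the symplectic transvection `u ↦ u + a ω(v, u) v`. -/
def transvectionMatrix (v : V4 𝕜) (a : 𝕜) : Matrix (Fin 2 ⊕ Fin 2) (Fin 2 ⊕ Fin 2) 𝕜 :=
  Matrix.of fun i j => (Pi.single j 1 : V4 𝕜) i + a * sympForm v (Pi.single j 1) * v i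

theorem transvectionMatrix_mem (v : V4 𝕜) (a : 𝕜) :
    transvectionMatrix v a ∈ Matrix.symplecticGroup (Fin 2) 𝕜 := by
  rw [mem_symplecticGroup_iff]
  have hcol : ∀ j, (transvectionMatrix v a).col j =
      Pi.single j 1 + (a * sympForm v (Pi.single j 1)) • v := fun j => rfl
  have h1 : (1 : Matrix (Fin 2 ⊕ Fin 2) (Fin 2 ⊕ Fin 2) 𝕜) ∈ Matrix.symplecticGroup (Fin 2) 𝕜 :=
    one_mem _
  intro i j
  have h2 := mem_symplecticGroup_iff.1 h1 i j
  have hcol1 : ∀ j, (1 : Matrix (Fin 2 ⊕ Fin 2) (Fin 2 ⊕ Fin 2) 𝕜).col j = Pi.single j 1 := by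
    intro j
    funext i
    simp [Matrix.one_apply, Pi.single_apply]
  rw [hcol1, hcol1] at h2
  rw [← h2, hcol, hcol]
  simp only [sympForm_add_left, sympForm_add_right, sympForm_smul_left, sympForm_smul_right,
    sympForm_self, sympForm_swap (Pi.single i 1) v]
  ring

/-- The symplectic transvection `u ↦ u + a ω(v, u) v`. -/
def transvection (v : V4 𝕜) (a : 𝕜) : Sp4 𝕜 := ⟨transvectionMatrix v a, transvectionMatrix_mem v a⟩

theorem transvection_smul (v : V4 𝕜) (a : 𝕜) (u : V4 𝕜) :
    transvection v a • u = u + (a * sympForm v u) • v := by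
  rw [sp_smul_eq]
  refine V4.ext ?_ ?_ ?_ ?_ <;>
    simp [transvection, transvectionMatrix, Matrix.mulVec, dotProduct, Fintype.sum_sum_type,
      sympForm_eq, Pi.single_apply] <;> ring

theorem sp_ext_smul {g h : Sp4 𝕜} (H : ∀ v : V4 𝕜, g • v = h • v) : g = h :=
  sp_ext_stdMap fun _ _ => H _

theorem transvection_mem_connectedComponent (v : V4 𝕜) (a : 𝕜) :
    transvection v a ∈ Subgroup.connectedComponentOfOne (Sp4 𝕜) := by
  have hcont : Continuous fun a => transvection v a := by
    refine continuous_induced_rng.2 (continuous_matrix fun i j => ?_)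
    change Continuous fun a => (Pi.single j 1 : V4 𝕜) i + a * sympForm v (Pi.single j 1) * v i
    fun_prop
  have h0 : transvection v 0 = 1 := by
    refine sp_ext_smul fun u => ?_
    rw [transvection_smul, zero_mul, zero_smul, add_zero, one_smul]
  have hpre : IsPreconnected (Set.range fun a => transvection v a) :=
    isPreconnected_range hcont
  exact hpre.subset_connectedComponent ⟨0, h0⟩ ⟨a, rfl⟩

/-- The transvection is along `w - v`. It fixes all vectors orthogonal to `w - v`, which allows
later steps to keep what earlier ones have achieved. -/
theorem exists_transvection {v w : V4 𝕜} (h : sympForm v w ≠ 0) :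
    ∃ g ∈ Subgroup.connectedComponentOfOne (Sp4 𝕜), g • v = w ∧
      ∀ x, sympForm v x = sympForm w x → g • x = x := by
  refine ⟨transvection (w - v) (-(sympForm v w)⁻¹), transvection_mem_connectedComponent _ _,
    ?_, fun x hx => ?_⟩
  · rw [transvection_smul, sympForm_sub_left, sympForm_self, sympForm_swap w v]
    have : -(sympForm v w)⁻¹ * (-sympForm v w - 0) = 1 := by field_simp; ring
    rw [this, one_smul, add_sub_cancel]
  · rw [transvection_smul, sympForm_sub_left, hx, sub_self, mul_zero, zero_smul, add_zero]

theorem exists_transvections {v u w : V4 𝕜} (h1 : sympForm v u ≠ 0) (h2 : sympForm u w ≠ 0) :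
    ∃ g ∈ Subgroup.connectedComponentOfOne (Sp4 𝕜), g • v = w ∧
      ∀ x, sympForm v x = sympForm u x → sympForm u x = sympForm w x → g • x = x := by
  obtain ⟨g, hg, hgv, hgx⟩ := exists_transvection h1
  obtain ⟨g', hg', hgv', hgx'⟩ := exists_transvection h2
  refine ⟨g' * g, mul_mem hg' hg, by rw [mul_smul, hgv, hgv'], fun x hx hx' => ?_⟩
  rw [mul_smul, hgx x hx, hgx' x hx']

/-- If f and f' are orthogonal, no single transvection joins them, and the path goes through f + e,
which pairs nontrivially with both. -/
theorem exists_transvections_pair {e f f' : V4 𝕜} (h1 : sympForm e f = 1)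
    (h2 : sympForm e f' = 1) :
    ∃ g ∈ Subgroup.connectedComponentOfOne (Sp4 𝕜), g • e = e ∧ g • f = f' ∧
      ∀ x, sympForm e x = 0 → sympForm f x = 0 → sympForm f' x = 0 → g • x = x := by
  have hfe : sympForm f e = sympForm f' e := by
    rw [sympForm_swap f, sympForm_swap f', h1, h2]
  by_cases h : sympForm f f' = 0
  · obtain ⟨g, hg, hgv, hgx⟩ := exists_transvections (v := f) (u := f + e) (w := f')
      (by rw [sympForm_add_right, sympForm_self, sympForm_swap, h1]; simp)
      (by rw [sympForm_add_left, h, h2]; simp)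
    refine ⟨g, hg, hgx e ?_ ?_, hgv, fun x hex hfx hfx' => hgx x ?_ ?_⟩
    · rw [sympForm_add_left, sympForm_self, add_zero]
    · rw [sympForm_add_left, sympForm_self, add_zero, hfe]
    · rw [sympForm_add_left, hex, add_zero]
    · rw [sympForm_add_left, hex, hfx, hfx', add_zero]
  · obtain ⟨g, hg, hgv, hgx⟩ := exists_transvection h
    exact ⟨g, hg, hgx e hfe, hgv, fun x _ hfx hfx' => hgx x (hfx.trans hfx'.symm)⟩

theorem exists_sympForm_ne_zero {v : V4 𝕜} (hv : v ≠ 0) : ∃ u, sympForm v u ≠ 0 := by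
  by_contra! h
  refine hv (V4.ext ?_ ?_ ?_ ?_)
  · simpa [sympForm_eq] using h (vec4 0 0 1 0)
  · simpa [sympForm_eq] using h (vec4 0 0 0 1)
  · simpa [sympForm_eq] using h (vec4 1 0 0 0)
  · simpa [sympForm_eq] using h (vec4 0 1 0 0)

/-- A vector space is not the union of two proper subspaces. -/
theorem exists_sympForm_ne_zero_pair {v w : V4 𝕜} (hv : v ≠ 0) (hw : w ≠ 0) :
    ∃ u, sympForm v u ≠ 0 ∧ sympForm u w ≠ 0 := by
  obtain ⟨x, hx⟩ := exists_sympForm_ne_zero hv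
  obtain ⟨y, hy⟩ := exists_sympForm_ne_zero hw
  rw [sympForm_swap, neg_ne_zero] at hy
  by_cases hxw : sympForm x w = 0
  · by_cases hvy : sympForm v y = 0
    · exact ⟨x + y, by rwa [sympForm_add_right, hvy, add_zero],
        by rwa [sympForm_add_left, hxw, zero_add]⟩
    · exact ⟨y, hvy, hy⟩
  · exact ⟨x, hx, hxw⟩

/-- `Sp(4)` is connected. -/
theorem mem_connectedComponentOfOne (g : Sp4 𝕜) :
    g ∈ Subgroup.connectedComponentOfOne (Sp4 𝕜) := by
  have e0 : vec4 (1 : 𝕜) 0 0 0 ≠ 0 := by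
    intro h
    simpa using congrFun h (Sum.inl 0)
  obtain ⟨u, hu1, hu2⟩ := exists_sympForm_ne_zero_pair ((smul_ne_zero_iff_ne g).2 e0) e0
  obtain ⟨h1, hh1, hv1, -⟩ := exists_transvections hu1 hu2
  -- The first and third basis vectors pair to -1, so the partner of the first in a hyperbolic pair
  -- carries the sign -1.
  obtain ⟨h2, hh2, hv2, hw2, -⟩ := exists_transvections_pair (e := vec4 (1 : 𝕜) 0 0 0)
    (f := h1 • g • vec4 0 0 (-1) 0) (f' := vec4 0 0 (-1) 0)
    (by
      conv_lhs => rw [← hv1]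
      rw [sympForm_sp_smul, sympForm_sp_smul]
      simp [sympForm_eq])
    (by simp [sympForm_eq])
  have f0 : (h2 * h1 * g) • vec4 (1 : 𝕜) 0 0 0 = vec4 1 0 0 0 := by
    rw [mul_smul, mul_smul, hv1, hv2]
  have f2 : (h2 * h1 * g) • vec4 (0 : 𝕜) 0 (-1) 0 = vec4 0 0 (-1) 0 := by
    rw [mul_smul, mul_smul, hw2]
  have hmem : h2 * h1 * g ∈ Subgroup.connectedComponentOfOne (Sp4 𝕜) →
      g ∈ Subgroup.connectedComponentOfOne (Sp4 𝕜) := fun h =>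
    (Subgroup.mul_mem_cancel_left _ (mul_mem hh2 hh1)).1 h
  apply hmem
  clear hmem hv1 hv2 hw2 hu1 hu2
  generalize h2 * h1 * g = k at *
  -- `k` fixes the first hyperbolic pair, hence preserves its orthogonal complement. The second pair
  -- is treated there by transvections that fix the first.
  have horth : ∀ x : V4 𝕜, x (Sum.inl 0) = 0 → x (Sum.inr 0) = 0 →
      (k • x) (Sum.inl 0) = 0 ∧ (k • x) (Sum.inr 0) = 0 := by
    intro x hx0 hx2
    constructor
    · have := sympForm_sp_smul k (vec4 (0 : 𝕜) 0 (-1) 0) x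
      rw [f2] at this
      simpa [sympForm_eq, hx0] using this
    · have := sympForm_sp_smul k (vec4 (1 : 𝕜) 0 0 0) x
      rw [f0] at this
      simpa [sympForm_eq, hx2] using this
  obtain ⟨hv0, hv2⟩ := horth (vec4 0 1 0 0) rfl rfl
  have hvne : k • vec4 (0 : 𝕜) 1 0 0 ≠ 0 := by
    refine (smul_ne_zero_iff_ne k).2 fun h => ?_
    simpa using congrFun h (Sum.inl 1)
  obtain ⟨h3, hh3, hv3, hx3⟩ : ∃ h ∈ Subgroup.connectedComponentOfOne (Sp4 𝕜),
      h • k • vec4 (0 : 𝕜) 1 0 0 = vec4 0 1 0 0 ∧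
        ∀ a b : 𝕜, h • vec4 a 0 b 0 = vec4 a 0 b 0 := by
    -- This coordinate is the pairing with the target vector. When it vanishes, the last basis
    -- vector serves as an intermediate stop.
    by_cases h : (k • vec4 (0 : 𝕜) 1 0 0) (Sum.inr 1) = 0
    · obtain ⟨h, hh, hv, hx⟩ := exists_transvections (v := k • vec4 (0 : 𝕜) 1 0 0)
        (u := vec4 0 0 0 1) (w := vec4 0 1 0 0)
        (by
          simp only [sympForm_eq, vec4_inl_zero, vec4_inl_one, vec4_inr_zero, vec4_inr_one]
          intro h1
          refine hvne (V4.ext hv0 ?_ hv2 h)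
          simpa using h1)
        (by simp [sympForm_eq])
      exact ⟨h, hh, hv, fun a b => hx _ (by simp [sympForm_eq, hv0, hv2]) (by simp [sympForm_eq])⟩
    · obtain ⟨h, hh, hv, hx⟩ := exists_transvection (v := k • vec4 (0 : 𝕜) 1 0 0)
        (w := vec4 0 1 0 0) (by simpa [sympForm_eq] using h)
      exact ⟨h, hh, hv, fun a b => hx _ (by simp [sympForm_eq, hv0, hv2])⟩
  have horth3 : (h3 • k • vec4 (0 : 𝕜) 0 0 (-1)) (Sum.inl 0) = 0 ∧
      (h3 • k • vec4 (0 : 𝕜) 0 0 (-1)) (Sum.inr 0) = 0 := by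
    obtain ⟨hw0, hw2⟩ := horth (vec4 0 0 0 (-1)) rfl rfl
    constructor
    · have := sympForm_sp_smul h3 (vec4 (0 : 𝕜) 0 (-1) 0) (k • vec4 0 0 0 (-1))
      rw [hx3] at this
      simpa [sympForm_eq, hw0] using this
    · have := sympForm_sp_smul h3 (vec4 (1 : 𝕜) 0 0 0) (k • vec4 0 0 0 (-1))
      rw [hx3] at this
      simpa [sympForm_eq, hw2] using this
  obtain ⟨h4, hh4, hv4, hw4, hx4⟩ := exists_transvections_pair (e := vec4 (0 : 𝕜) 1 0 0)
    (f := h3 • k • vec4 0 0 0 (-1)) (f' := vec4 0 0 0 (-1))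
    (by
      conv_lhs => rw [← hv3]
      rw [sympForm_sp_smul, sympForm_sp_smul]
      simp [sympForm_eq])
    (by simp [sympForm_eq])
  have hx4' : ∀ a b : 𝕜, h4 • vec4 a 0 b 0 = vec4 a 0 b 0 := fun a b =>
    hx4 _ (by simp [sympForm_eq]) (by simp [sympForm_eq, horth3.1, horth3.2])
      (by simp [sympForm_eq])
  have hone : h4 * h3 * k = 1 := by
    refine sp_ext_smul fun v => ?_
    have hv : v = v (Sum.inl 0) • vec4 1 0 0 0 + (-v (Sum.inr 0)) • vec4 0 0 (-1) 0 +
        v (Sum.inl 1) • vec4 0 1 0 0 + (-v (Sum.inr 1)) • vec4 0 0 0 (-1) := by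
      refine V4.ext ?_ ?_ ?_ ?_ <;> simp
    rw [one_smul, hv]
    simp only [sp_smul_add, sp_smul_smul]
    simp only [mul_smul, f0, f2, hx3, hx4', hv3, hv4, hw4]
  have : h4 * h3 * k ∈ Subgroup.connectedComponentOfOne (Sp4 𝕜) := hone ▸ one_mem _
  exact (Subgroup.mul_mem_cancel_left _ (mul_mem hh4 hh3)).1 this

theorem exists_connectedComponent_smul_eq {C C' : Set (P3 𝕜)} (hC : C ∈ contactFamily 𝕜)
    (hC' : C' ∈ contactFamily 𝕜) : ∃ g ∈ connectedComponent (1 : Sp4 𝕜), g • C = C' := by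
  obtain ⟨g, rfl⟩ := mem_contactFamily_iff.1 hC
  obtain ⟨g', rfl⟩ := mem_contactFamily_iff.1 hC'
  exact ⟨g' * g⁻¹, mem_connectedComponentOfOne _, by rw [mul_smul, inv_smul_smul]⟩

end Connected

end SubmaximalODE
end

noncomputable section
set_option linter.unusedSectionVars false
namespace SubmaximalODE

/-! ### Real and complex curves -/

section BaseChange

variable {K L : Type*} [Field K] [Field L]

/-- Applying a ring homomorphism to the coordinates of a vector. -/
def mapVec (σ : K →+* L) (v : V4 K) : V4 L := fun i => σ (v i)

theorem mapVec_ne_zero (σ : K →+* L) {v : V4 K} (hv : v ≠ 0) : mapVec σ v ≠ 0 := by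
  intro h
  refine hv (funext fun i => σ.injective ?_)
  simpa [mapVec] using congrFun h i

theorem applyCoords_mk (σ : K →+* L) {v : V4 K} (hv : v ≠ 0) :
    applyCoords σ (Projectivization.mk K v hv) =
      Projectivization.mk L (mapVec σ v) (mapVec_ne_zero σ hv) := rfl

/-- Applying a ring homomorphism to the entries of a symplectic matrix. -/
def mapSp (σ : K →+* L) : Sp4 K →* Sp4 L where
  toFun g := ⟨g.1.map σ, SymplecticGroup.map_mem g.2 σ⟩
  map_one' := Subtype.ext (by simp)
  map_mul' g h := Subtype.ext (by simp [Matrix.map_mul])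

theorem mapVec_smul (σ : K →+* L) (g : Sp4 K) (v : V4 K) :
    mapVec σ (g • v) = mapSp σ g • mapVec σ v := by
  funext i
  simp [mapVec, sp_smul_eq, mapSp, Matrix.mulVec, dotProduct]

theorem applyCoords_smul (σ : K →+* L) (g : Sp4 K) (p : P3 K) :
    applyCoords σ (g • p) = mapSp σ g • applyCoords σ p := by
  rw [← p.mk_rep, Projectivization.smul_mk, applyCoords_mk, applyCoords_mk,
    Projectivization.smul_mk]
  congr 1
  exact mapVec_smul σ g _

theorem image_applyCoords_smul (σ : K →+* L) (g : Sp4 K) (C : Set (P3 K)) :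
    applyCoords σ '' (g • C) = mapSp σ g • applyCoords σ '' C := by
  rw [← Set.image_smul, ← Set.image_smul, Set.image_image, Set.image_image]
  simp only [applyCoords_smul]

theorem inCone_mapVec_iff (σ : K →+* L) {v : V4 K} : InCone (mapVec σ v) ↔ InCone v := by
  have h3 : σ 3 = 3 := map_ofNat σ 3
  have h9 : σ 9 = 9 := map_ofNat σ 9
  simp only [InCone, mapVec, ← h3, ← h9, ← map_mul, ← map_pow, ← map_add, ← map_sub,
    map_eq_zero_iff σ σ.injective]

theorem mapVec_stdMap (σ : K →+* L) (s t : K) :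
    mapVec σ (stdMap s t) = stdMap (σ s) (σ t) := by
  have h3 : σ 3 = 3 := map_ofNat σ 3
  refine V4.ext ?_ ?_ ?_ ?_ <;> simp [mapVec, stdMap, h3]

theorem applyCoords_mem_smul_stdCurve_iff (σ : K →+* L) (g : Sp4 K) {p : P3 K} :
    applyCoords σ p ∈ mapSp σ g • stdCurve L ↔ p ∈ g • stdCurve K := by
  rw [← p.mk_rep, applyCoords_mk, mk_mem_smul_stdCurve, mk_mem_smul_stdCurve, ← map_inv,
    ← mapVec_smul, inCone_mapVec_iff]

/-- The cone equations have rational coefficients, so a curve over `K` is recovered as the set of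
`K`-points of its base change. -/
theorem smul_stdCurve_injective_mapSp (σ : K →+* L) {g h : Sp4 K}
    (H : mapSp σ g • stdCurve L = mapSp σ h • stdCurve L) :
    g • stdCurve K = h • stdCurve K := by
  ext p
  rw [← applyCoords_mem_smul_stdCurve_iff σ, H, applyCoords_mem_smul_stdCurve_iff]

theorem image_applyCoords_stdCurve_subset (σ : K →+* L) :
    applyCoords σ '' stdCurve K ⊆ stdCurve L := by
  rintro _ ⟨p, hp, rfl⟩
  have := (applyCoords_mem_smul_stdCurve_iff σ 1).2 (by simpa using hp)
  simpa using this

theorem mapSp_cubicRep [CharZero K] [CharZero L] (σ : K →+* L)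
    (m : Matrix.SpecialLinearGroup (Fin 2) K) :
    mapSp σ (cubicRep m) = cubicRep (Matrix.SpecialLinearGroup.map σ m) := by
  have h2 : σ 2 = 2 := map_ofNat σ 2
  have h3 : σ 3 = 3 := map_ofNat σ 3
  apply Subtype.ext
  ext i j
  change σ ((cubicRep m).1 i j) = _
  rw [cubicRep_apply, cubicRep_apply]
  rcases i with i | i <;> rcases j with j | j <;> fin_cases i <;> fin_cases j <;>
    simp [cubicCol, h2, h3]

end BaseChange

section Complex

theorem complexify_stdCurve : complexify (stdCurve ℝ) = stdCurve ℂ := by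
  refine zariskiClosure_eq_stdCurve (image_applyCoords_stdCurve_subset _) ?_
  refine (Set.infinite_range_of_injective Complex.ofReal_injective).mono ?_
  rintro _ ⟨t, rfl⟩
  have ht : stdMap (1 : ℝ) t ≠ 0 := stdMap_ne_zero (by simp)
  refine ⟨stdMap_ne_zero (by simp), Projectivization.mk ℝ (stdMap 1 t) ht,
    (mk_mem_stdCurve ht).2 (inCone_stdMap 1 t), ?_⟩
  rw [applyCoords_mk]
  congr 1
  rw [mapVec_stdMap]
  simp

theorem complexify_smul (g : Sp4 ℝ) (C : Set (P3 ℝ)) :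
    complexify (g • C) = mapSp Complex.ofRealHom g • complexify C := by
  rw [complexify, image_applyCoords_smul, zariskiClosure_smul, complexify]

theorem complexify_smul_stdCurve (g : Sp4 ℝ) :
    complexify (g • stdCurve ℝ) = mapSp Complex.ofRealHom g • stdCurve ℂ := by
  rw [complexify_smul, complexify_stdCurve]

theorem mapSp_conj_conj (g : Sp4 ℂ) :
    mapSp (starRingEnd ℂ) (mapSp (starRingEnd ℂ) g) = g := by
  apply Subtype.ext
  ext i j
  exact Complex.conj_conj _

theorem applyCoords_conj_conj (p : P3 ℂ) :
    applyCoords (starRingEnd ℂ) (applyCoords (starRingEnd ℂ) p) = p := by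
  rw [← p.mk_rep, applyCoords_mk, applyCoords_mk]
  congr 1
  funext i
  exact Complex.conj_conj _

theorem conjCurve_stdCurve : conjCurve (stdCurve ℂ) = stdCurve ℂ := by
  refine (image_applyCoords_stdCurve_subset _).antisymm fun p hp => ?_
  exact ⟨applyCoords (starRingEnd ℂ) p, image_applyCoords_stdCurve_subset _ ⟨p, hp, rfl⟩,
    applyCoords_conj_conj p⟩

theorem conjCurve_smul_stdCurve (g : Sp4 ℂ) :
    conjCurve (g • stdCurve ℂ) = mapSp (starRingEnd ℂ) g • stdCurve ℂ := by
  rw [conjCurve, image_applyCoords_smul]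
  exact congrArg _ conjCurve_stdCurve

theorem cubicRep_injective {𝕜 : Type*} [RCLike 𝕜] :
    Function.Injective (cubicRep (𝕜 := 𝕜)) := by
  intro m n h
  apply Subtype.ext
  rw [← recoverEntries_cubicRep m, h, recoverEntries_cubicRep]

/-- Hilbert's Theorem 90 for `SL(2)` and the extension `ℂ / ℝ`. -/
theorem exists_coboundary {m : Matrix.SpecialLinearGroup (Fin 2) ℂ}
    (hm : m * Matrix.SpecialLinearGroup.map (starRingEnd ℂ) m = 1) :
    ∃ n, m * Matrix.SpecialLinearGroup.map (starRingEnd ℂ) n = n := by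
  have hdet := m.2
  rw [Matrix.det_fin_two] at hdet
  have hinv : Matrix.SpecialLinearGroup.map (starRingEnd ℂ) m = m⁻¹ :=
    eq_inv_of_mul_eq_one_right hm
  have hadj := congrArg Subtype.val hinv
  rw [Matrix.SpecialLinearGroup.coe_inv, Matrix.adjugate_fin_two] at hadj
  have h00 : starRingEnd ℂ (m.1 0 0) = m.1 1 1 := congrFun (congrFun hadj 0) 0
  have h01 : starRingEnd ℂ (m.1 0 1) = -m.1 0 1 := congrFun (congrFun hadj 0) 1
  have h10 : starRingEnd ℂ (m.1 1 0) = -m.1 1 0 := congrFun (congrFun hadj 1) 0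
  have h11 : starRingEnd ℂ (m.1 1 1) = m.1 0 0 := congrFun (congrFun hadj 1) 1
  -- For every z, the matrix n = z + z̄·m satisfies m·n̄ = n, since m·m̄ = 1. Its determinant is
  -- real, so dividing the first column by it keeps this relation and gives determinant 1.
  have key : ∀ z : ℂ, (z + starRingEnd ℂ z * m.1 0 0) * (z + starRingEnd ℂ z * m.1 1 1) -
      (starRingEnd ℂ z * m.1 0 1) * (starRingEnd ℂ z * m.1 1 0) ≠ 0 →
      ∃ n, m * Matrix.SpecialLinearGroup.map (starRingEnd ℂ) n = n := by
    intro z hd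
    obtain ⟨d, hd'⟩ : ∃ d, d = (z + starRingEnd ℂ z * m.1 0 0) * (z + starRingEnd ℂ z * m.1 1 1) -
      (starRingEnd ℂ z * m.1 0 1) * (starRingEnd ℂ z * m.1 1 0) := ⟨_, rfl⟩
    rw [← hd'] at hd
    have hdc : starRingEnd ℂ d = d := by
      rw [hd']
      simp only [map_sub, map_mul, map_add, Complex.conj_conj, h00, h01, h10, h11]
      linear_combination (z ^ 2 - (starRingEnd ℂ z) ^ 2) * hdet
    obtain ⟨n, n00, n01, n10, n11⟩ := exists_SL2_entries
      (p := (z + starRingEnd ℂ z * m.1 0 0) / d) (q := starRingEnd ℂ z * m.1 0 1)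
      (r := starRingEnd ℂ z * m.1 1 0 / d) (w := z + starRingEnd ℂ z * m.1 1 1)
      (by field_simp; linear_combination -hd')
    refine ⟨n, Subtype.ext ?_⟩
    ext i j
    have e : ∀ i j, (Matrix.SpecialLinearGroup.map (starRingEnd ℂ) n).1 i j =
      starRingEnd ℂ (n.1 i j) := fun _ _ => rfl
    rw [Matrix.SpecialLinearGroup.coe_mul, Matrix.mul_apply, Fin.sum_univ_two, e, e]
    fin_cases i <;> fin_cases j <;>
      simp only [Fin.zero_eta, Fin.mk_one, Fin.isValue, n00, n01, n10, n11, map_div₀, map_mul,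
        map_add, Complex.conj_conj, h00, h01, h10, h11, hdc]
    · field_simp
      linear_combination z * hdet
    · ring
    · field_simp
      ring
    · linear_combination z * hdet
  -- The determinant is tr m + 2 for z = 1 and tr m - 2 for z = i. They cannot both vanish.
  by_cases h : 2 + m.1 0 0 + m.1 1 1 = 0
  · refine key Complex.I fun h0 => ?_
    rw [Complex.conj_I] at h0
    have h4 : (4 : ℂ) = 0 := by
      linear_combination h - h0 + (2 + m.1 0 0 * m.1 1 1 - m.1 0 1 * m.1 1 0 -
        1 - m.1 0 0 - m.1 1 1) * Complex.I_sq - hdet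
    norm_num at h4
  · refine key 1 fun h0 => h ?_
    rw [map_one] at h0
    linear_combination h0 - hdet

theorem exists_real_of_conj_eq {k : Sp4 ℂ} (hk : mapSp (starRingEnd ℂ) k = k) :
    ∃ g : Sp4 ℝ, mapSp Complex.ofRealHom g = k := by
  have hre : (k.1.map Complex.re).map Complex.ofRealHom = k.1 := by
    ext i j
    exact Complex.conj_eq_iff_re.1 (congrFun (congrFun (congrArg Subtype.val hk) i) j)
  have hmem : k.1.map Complex.re ∈ Matrix.symplecticGroup (Fin 2) ℝ := by
    rw [SymplecticGroup.mem_iff]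
    have h := SymplecticGroup.mem_iff.1 k.2
    rw [← hre, ← Matrix.map_J (Fin 2) Complex.ofRealHom, ← Matrix.transpose_map, ← Matrix.map_mul,
      ← Matrix.map_mul] at h
    exact Matrix.map_injective Complex.ofRealHom.injective h
  exact ⟨⟨_, hmem⟩, Subtype.ext hre⟩

/-- Invariance makes g⁻¹ḡ a stabilising cocycle, the image of some m in SL(2). If m·n̄ = n, then g
times the image of n is real and gives the same curve. -/
theorem exists_real_form {g : Sp4 ℂ} (h : conjCurve (g • stdCurve ℂ) = g • stdCurve ℂ) :
    ∃ k : Sp4 ℝ, mapSp Complex.ofRealHom k • stdCurve ℂ = g • stdCurve ℂ := by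
  rw [conjCurve_smul_stdCurve] at h
  have hstab : (g⁻¹ * mapSp (starRingEnd ℂ) g) • stdCurve ℂ = stdCurve ℂ := by
    rw [mul_smul, h, inv_smul_smul]
  obtain ⟨m, hm⟩ := exists_cubicRep_of_stab hstab
  have hcocycle : m * Matrix.SpecialLinearGroup.map (starRingEnd ℂ) m = 1 := by
    apply cubicRep_injective
    rw [map_mul, ← mapSp_cubicRep, hm, map_mul, mapSp_conj_conj, map_inv, map_one]
    group
  obtain ⟨n, hn⟩ := exists_coboundary hcocycle
  have hreal : mapSp (starRingEnd ℂ) (g * cubicRep n) = g * cubicRep n := by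
    conv_rhs => rw [← hn, map_mul, hm, ← mapSp_cubicRep]
    rw [map_mul]
    group
  obtain ⟨k, hk⟩ := exists_real_of_conj_eq hreal
  exact ⟨k, by rw [hk, mul_smul, cubicRep_smul_stdCurve]⟩

theorem bijOn_complexify : Set.BijOn complexify (contactFamily ℝ)
    {C ∈ contactFamily ℂ | conjCurve C = C} := by
  refine ⟨fun C hC => ?_, fun C hC C' hC' h => ?_, fun C hC => ?_⟩
  · obtain ⟨g, rfl⟩ := mem_contactFamily_iff.1 hC
    rw [complexify_smul_stdCurve]
    refine ⟨mem_contactFamily_iff.2 ⟨_, rfl⟩, ?_⟩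
    rw [conjCurve_smul_stdCurve]
    congr 1
    apply Subtype.ext
    ext i j
    exact Complex.conj_ofReal _
  · obtain ⟨g, rfl⟩ := mem_contactFamily_iff.1 hC
    obtain ⟨g', rfl⟩ := mem_contactFamily_iff.1 hC'
    rw [complexify_smul_stdCurve, complexify_smul_stdCurve] at h
    exact smul_stdCurve_injective_mapSp _ h
  · obtain ⟨hC, hconj⟩ := hC
    obtain ⟨g, rfl⟩ := mem_contactFamily_iff.1 hC
    obtain ⟨k, hk⟩ := exists_real_form hconj
    exact ⟨k • stdCurve ℝ, mem_contactFamily_iff.2 ⟨k, rfl⟩, by rw [complexify_smul_stdCurve, hk]⟩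

theorem complexify_smul_of_coe_eq (g : Sp4 ℝ) (g' : Sp4 ℂ) (C : Set (P3 ℝ))
    (h : (g' : Matrix (Fin 2 ⊕ Fin 2) (Fin 2 ⊕ Fin 2) ℂ) =
      (g : Matrix (Fin 2 ⊕ Fin 2) (Fin 2 ⊕ Fin 2) ℝ).map Complex.ofReal) :
    complexify (g • C) = g' • complexify C := by
  rw [complexify_smul]
  congr 1
  exact Subtype.ext h.symm

end Complex

end SubmaximalODE
end

noncomputable section
set_option linter.unusedSectionVars false
namespace SubmaximalODE

/-! ### Lifts of functions to `ℝ⁴` -/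

section Jets

/-- On `I`, the functions `Y 0, …, Y 7` are the successive derivatives of `Y 0`. -/
def IsJetOn (Y : ℕ → ℝ → ℝ) (I : Set ℝ) : Prop :=
  ∀ k < 7, ∀ x ∈ I, HasDerivAt (Y k) (Y (k + 1) x) x

theorem isJetOn_iteratedDeriv {y : ℝ → ℝ} {I : Set ℝ} (hI : IsOpen I) (hy : ContDiffOn ℝ 7 y I) :
    IsJetOn (fun k => iteratedDeriv k y) I := by
  intro k hk x hx
  have h1 : DifferentiableOn ℝ (iteratedDerivWithin k y I) I :=
    hy.differentiableOn_iteratedDerivWithin (by exact_mod_cast hk) hI.uniqueDiffOn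
  have h2 : DifferentiableAt ℝ (iteratedDerivWithin k y I) x :=
    (h1 x hx).differentiableAt (hI.mem_nhds hx)
  have h3 : iteratedDeriv k y =ᶠ[nhds x] iteratedDerivWithin k y I :=
    Filter.eventuallyEq_of_mem (hI.mem_nhds hx) fun z hz => (iteratedDerivWithin_of_isOpen hI hz).symm
  have h4 := (h2.congr_of_eventuallyEq h3).hasDerivAt
  rwa [← iteratedDeriv_succ] at h4

/-- The lift of a function to `ℝ⁴`. -/
def jetVec (Y : ℕ → ℝ → ℝ) (x : ℝ) : V4 ℝ := vec4 1 x (2 * Y 0 x - x * Y 1 x) (Y 1 x)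

/-- The first derivative of `jetVec`. -/
def jetVec' (Y : ℕ → ℝ → ℝ) (x : ℝ) : V4 ℝ := vec4 0 1 (Y 1 x - x * Y 2 x) (Y 2 x)

/-- The direction of the second derivative of `jetVec`. -/
def fiberVec (x : ℝ) : V4 ℝ := vec4 0 0 (-x) 1

/-- The derivative of `fiberVec`. -/
def fiberVec' : V4 ℝ := vec4 0 0 (-1) 0

theorem hasDerivAt_vec4 {a b c d : ℝ → ℝ} {a' b' c' d' x : ℝ} (ha : HasDerivAt a a' x)
    (hb : HasDerivAt b b' x) (hc : HasDerivAt c c' x) (hd : HasDerivAt d d' x) :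
    HasDerivAt (fun x => vec4 (a x) (b x) (c x) (d x)) (vec4 a' b' c' d') x := by
  rw [hasDerivAt_pi]
  rintro (i | i) <;> fin_cases i <;> assumption

variable {Y : ℕ → ℝ → ℝ} {I : Set ℝ}

theorem IsJetOn.hasDerivAt_jetVec (hY : IsJetOn Y I) {x : ℝ} (hx : x ∈ I) :
    HasDerivAt (jetVec Y) (jetVec' Y x) x := by
  have h0 := hY 0 (by norm_num) x hx
  have h1 := hY 1 (by norm_num) x hx
  refine (hasDerivAt_vec4 (hasDerivAt_const x 1) (hasDerivAt_id x)
    ((h0.const_mul 2).sub ((hasDerivAt_id x).mul h1)) h1).congr_deriv ?_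
  refine V4.ext ?_ ?_ ?_ ?_ <;> simp [jetVec']
  ring

theorem IsJetOn.hasDerivAt_jetVec' (hY : IsJetOn Y I) {x : ℝ} (hx : x ∈ I) :
    HasDerivAt (jetVec' Y) (Y 3 x • fiberVec x) x := by
  have h1 := hY 1 (by norm_num) x hx
  have h2 := hY 2 (by norm_num) x hx
  refine (hasDerivAt_vec4 (hasDerivAt_const x 0) (hasDerivAt_const x 1)
    (h1.sub ((hasDerivAt_id x).mul h2)) h2).congr_deriv ?_
  refine V4.ext ?_ ?_ ?_ ?_ <;> simp [fiberVec]
  ring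

theorem hasDerivAt_fiberVec (x : ℝ) : HasDerivAt fiberVec fiberVec' x :=
  (hasDerivAt_vec4 (hasDerivAt_const x 0) (hasDerivAt_const x 0) (hasDerivAt_id x).neg
    (hasDerivAt_const x 1))

theorem HasDerivAt.sp_smul {f : ℝ → V4 ℝ} {f' : V4 ℝ} {x : ℝ} (h : HasDerivAt f f' x)
    (g : Sp4 ℝ) : HasDerivAt (fun x => g • f x) (g • f') x := by
  rw [hasDerivAt_pi] at h ⊢
  intro i
  simp only [sp_smul_eq, Matrix.mulVec, dotProduct]
  exact HasDerivAt.fun_sum fun j _ => (h j).const_mul _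

theorem HasDerivAt.sympForm_const {f : ℝ → V4 ℝ} {f' : V4 ℝ} {x : ℝ} (h : HasDerivAt f f' x)
    (u : V4 ℝ) : HasDerivAt (fun x => sympForm u (f x)) (sympForm u f') x := by
  rw [hasDerivAt_pi] at h
  simp only [sympForm_eq]
  exact ((((h _).const_mul _).add ((h _).const_mul _)).sub ((h _).const_mul _)).sub
    ((h _).const_mul _)

/-! ### The quadrics through the standard cubic -/

/-- Polar forms of three quadrics that cut out the standard contact cubic. -/
def coneForm (k : Fin 3) (u v : V4 ℝ) : ℝ :=
  ![u (.inl 0) * v (.inr 1) + v (.inl 0) * u (.inr 1) + 6 * (u (.inl 1) * v (.inl 1)),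
    3 * (u (.inl 0) * v (.inr 0) + v (.inl 0) * u (.inr 0)) +
      (u (.inl 1) * v (.inr 1) + v (.inl 1) * u (.inr 1)),
    2 * (u (.inr 1) * v (.inr 1)) - 9 * (u (.inl 1) * v (.inr 0) + v (.inl 1) * u (.inr 0))] k

theorem inCone_iff_coneForm {u : V4 ℝ} : InCone u ↔ ∀ k, coneForm k u u = 0 := by
  rw [Fin.forall_fin_succ, Fin.forall_fin_two]
  simp only [InCone, coneForm, Fin.succ_zero_eq_one, Fin.succ_one_eq_two, Matrix.cons_val]
  refine and_congr ?_ (and_congr ?_ ?_) <;> constructor <;> intro h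
  · linear_combination 2 * h
  · linear_combination h / 2
  · linear_combination 2 * h
  · linear_combination h / 2
  · linear_combination 2 * h
  · linear_combination h / 2

theorem coneForm_comm (k : Fin 3) (u v : V4 ℝ) : coneForm k u v = coneForm k v u := by
  fin_cases k <;> simp [coneForm] <;> ring

theorem coneForm_smul_right (k : Fin 3) (c : ℝ) (u v : V4 ℝ) :
    coneForm k u (c • v) = c * coneForm k u v := by
  fin_cases k <;> simp [coneForm] <;> ring

theorem coneForm_smul_left (k : Fin 3) (c : ℝ) (u v : V4 ℝ) :
    coneForm k (c • u) v = c * coneForm k u v := by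
  rw [coneForm_comm, coneForm_smul_right, coneForm_comm]

theorem HasDerivAt.coneForm {k : Fin 3} {f h : ℝ → V4 ℝ} {f' h' : V4 ℝ} {x : ℝ}
    (hf : HasDerivAt f f' x) (hh : HasDerivAt h h' x) :
    HasDerivAt (fun x => coneForm k (f x) (h x))
      (SubmaximalODE.coneForm k f' (h x) + SubmaximalODE.coneForm k (f x) h') x := by
  rw [hasDerivAt_pi] at hf hh
  fin_cases k
  · refine ((((hf (.inl 0)).mul (hh (.inr 1))).add ((hh (.inl 0)).mul (hf (.inr 1)))).add
      (((hf (.inl 1)).mul (hh (.inl 1))).const_mul 6)).congr_deriv ?_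
    simp [SubmaximalODE.coneForm]
    ring
  · refine (((((hf (.inl 0)).mul (hh (.inr 0))).add ((hh (.inl 0)).mul (hf (.inr 0)))).const_mul
      3).add (((hf (.inl 1)).mul (hh (.inr 1))).add
        ((hh (.inl 1)).mul (hf (.inr 1))))).congr_deriv ?_
    simp [SubmaximalODE.coneForm]
    ring
  · refine ((((hf (.inr 1)).mul (hh (.inr 1))).const_mul 2).sub
      ((((hf (.inl 1)).mul (hh (.inr 0))).add ((hh (.inl 1)).mul (hf (.inr 0)))).const_mul
        9)).congr_deriv ?_
    simp [SubmaximalODE.coneForm]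
    ring

/-- Apart from the squared determinant, the polar values are, up to constants, the coefficients of
the product of two linear forms. They vanish together only when one of the forms is zero. -/
theorem coneForm_stdMap (k : Fin 3) (s t s' t' : ℝ) :
    coneForm k (stdMap s t) (stdMap s' t') = (s * t' - s' * t) ^ 2 *
      ![-(3 * s * s'), 3 * (s * t' + s' * t), -(9 * (t * t'))] k := by
  fin_cases k <;> simp [coneForm, stdMap] <;> ring

/-- The standard cubic contains no line. -/
theorem exists_smul_of_coneForm {u v : V4 ℝ} (hu : ∀ k, coneForm k u u = 0)
    (hv : ∀ k, coneForm k v v = 0) (huv : ∀ k, coneForm k u v = 0) (hu0 : u ≠ 0) :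
    ∃ c : ℝ, v = c • u := by
  obtain ⟨l, s, t, hst, rfl⟩ := (inCone_iff_coneForm.2 hu).exists_stdMap'
  obtain ⟨l', s', t', hst', rfl⟩ := (inCone_iff_coneForm.2 hv).exists_stdMap'
  have hl : l ≠ 0 := by
    rintro rfl
    simp at hu0
  by_cases hl' : l' = 0
  · exact ⟨0, by rw [hl', zero_smul, zero_smul]⟩
  have h0 := huv 0
  have h1 := huv 1
  have h2 := huv 2
  simp only [coneForm_smul_left, coneForm_smul_right, coneForm_stdMap, Matrix.cons_val] at h0 h1 h2
  have hdet : s * t' - s' * t = 0 := by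
    by_contra hd
    simp [hl, hl', hd] at h0 h1 h2
    rcases h0 with rfl | rfl <;> rcases h2 with rfl | rfl <;> simp_all
  have hc : ∃ c : ℝ, s' = c * s ∧ t' = c * t := by
    rcases hst with h | h
    · exact ⟨s' / s, by field_simp, by field_simp; linear_combination hdet⟩
    · exact ⟨t' / t, by field_simp; linear_combination -hdet, by field_simp⟩
  obtain ⟨c, rfl, rfl⟩ := hc
  refine ⟨l' * c ^ 3 * l⁻¹, ?_⟩
  rw [stdMap_mul, smul_smul, smul_smul]
  congr 1
  field_simp

/-- A lift that runs in a contact cubic has no inflection, not even at an end point. -/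
theorem IsJetOn.third_ne_zero (hY : IsJetOn Y I) {U : Set ℝ} (hU : IsOpen U) (hUI : U ⊆ I)
    {g : Sp4 ℝ} (hg : ∀ x ∈ U, InCone (g • jetVec Y x)) {x : ℝ} (hx : x ∈ I)
    (hxU : x ∈ closure U) : Y 3 x ≠ 0 := by
  intro h3
  have hW : ∀ x ∈ I, HasDerivAt (fun x => g • jetVec Y x) (g • jetVec' Y x) x :=
    fun x hx => HasDerivAt.sp_smul (hY.hasDerivAt_jetVec hx) g
  have hW' : ∀ x ∈ I, HasDerivAt (fun x => g • jetVec' Y x) (Y 3 x • (g • fiberVec x)) x :=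
    fun x hx => by
      rw [← sp_smul_smul]
      exact HasDerivAt.sp_smul (hY.hasDerivAt_jetVec' hx) g
  -- Relations between derivatives hold on the open set `U` and pass to `x` in its closure by
  -- continuity.
  have hlim : ∀ {f : ℝ → ℝ}, ContinuousAt f x → (∀ z ∈ U, f z = 0) → f x = 0 := by
    intro f hf hfU
    have h := hf.continuousWithinAt.mem_closure_image (s := U) hxU
    have h2 : closure (f '' U) ⊆ {0} :=
      closure_minimal (by rintro _ ⟨z, hz, rfl⟩; exact hfU z hz) isClosed_singleton
    exact h2 h
  have d0 : ∀ k, ∀ z ∈ U, coneForm k (g • jetVec Y z) (g • jetVec Y z) = 0 :=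
    fun k z hz => inCone_iff_coneForm.1 (hg z hz) k
  have d1 : ∀ k, ∀ z ∈ U, coneForm k (g • jetVec Y z) (g • jetVec' Y z) = 0 := by
    intro k z hz
    have h1 := HasDerivAt.coneForm (k := k) (hW z (hUI hz)) (hW z (hUI hz))
    have h2 := h1.unique (((hasDerivAt_const z (0 : ℝ))).congr_of_eventuallyEq
      (Filter.eventuallyEq_of_mem (hU.mem_nhds hz) fun w hw => d0 k w hw))
    rw [coneForm_comm k (g • jetVec' Y z)] at h2
    linarith
  have d2 : ∀ k, ∀ z ∈ U, coneForm k (g • jetVec' Y z) (g • jetVec' Y z) +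
      Y 3 z * coneForm k (g • jetVec Y z) (g • fiberVec z) = 0 := by
    intro k z hz
    have h1 := HasDerivAt.coneForm (k := k) (hW z (hUI hz)) (hW' z (hUI hz))
    have h2 := h1.unique (((hasDerivAt_const z (0 : ℝ))).congr_of_eventuallyEq
      (Filter.eventuallyEq_of_mem (hU.mem_nhds hz) fun w hw => d1 k w hw))
    rwa [coneForm_smul_right] at h2
  have hE : HasDerivAt (fun x => g • fiberVec x) (g • fiberVec') x :=
    HasDerivAt.sp_smul (hasDerivAt_fiberVec x) g
  have e0 : ∀ k, coneForm k (g • jetVec Y x) (g • jetVec Y x) = 0 := fun k =>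
    hlim (HasDerivAt.coneForm (hW x hx) (hW x hx)).continuousAt (d0 k)
  have e1 : ∀ k, coneForm k (g • jetVec Y x) (g • jetVec' Y x) = 0 := fun k =>
    hlim (HasDerivAt.coneForm (hW x hx) (hW' x hx)).continuousAt (d1 k)
  -- As y''' vanishes at `x`, the second derivative of the quadrics shows that W' is also in the
  -- cone. The line through W and W' would then lie in the cubic, so W' would be proportional to W,
  -- which the first two coordinates exclude.
  have e2 : ∀ k, coneForm k (g • jetVec' Y x) (g • jetVec' Y x) = 0 := by
    intro k
    have := hlim ((HasDerivAt.coneForm (k := k) (hW' x hx) (hW' x hx)).continuousAt.add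
      ((hY 3 (by norm_num) x hx).continuousAt.mul
        (HasDerivAt.coneForm (k := k) (hW x hx) hE).continuousAt)) (d2 k)
    simpa [h3] using this
  have hne : g • jetVec Y x ≠ 0 := by
    refine (smul_ne_zero_iff_ne g).2 fun h => ?_
    simpa [jetVec] using congrFun h (Sum.inl 0)
  obtain ⟨c, hc⟩ := exists_smul_of_coneForm e0 e2 e1 hne
  rw [← sp_smul_smul] at hc
  have h := MulAction.injective g hc
  have h0 := congrFun h (Sum.inl 0)
  have h1 := congrFun h (Sum.inl 1)
  simp [jetVec, jetVec'] at h0 h1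
  simp [← h0] at h1

end Jets

end SubmaximalODE
end

noncomputable section
set_option linter.unusedSectionVars false
namespace SubmaximalODE

/-! ### Lifts in a contact cubic satisfy the equation -/

section CubicToODE

/-- The equation as a relation between the derivatives of order 3 to 7. -/
def JetEq (q q1 q2 q3 q4 : ℝ) : Prop :=
  10 * q ^ 3 * q4 - 70 * q ^ 2 * q1 * q3 - 49 * q ^ 2 * q2 ^ 2 + 280 * q * q1 ^ 2 * q2
    - 175 * q1 ^ 4 = 0

/-- The hypotheses `o2` to `o6` are the derivatives of Q(W, W) = 0 of orders two to six, up to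
constant factors, at a point where the tangent flag is standard. Here `e` and `f` stand for E and
E'. Orders two to five determine the coordinates of `e` and all coordinates of `f` that are needed;
order six then brings in y⁽⁷⁾. -/
theorem jetEq_of_orders {ρ τ q q1 q2 q3 q4 : ℝ} {W W1 e f : V4 ℝ} (hρ : ρ ≠ 0) (hτ : τ ≠ 0)
    (hq : q ≠ 0) (hW : W = vec4 ρ 0 0 0) (hW1 : W1 = vec4 0 τ 0 0)
    (o2 : ∀ k, coneForm k W1 W1 + q * coneForm k W e = 0)
    (o3 : ∀ k, 3 * q * coneForm k W1 e + q1 * coneForm k W e + q * coneForm k W f = 0)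
    (o4 : ∀ k, 3 * q ^ 2 * coneForm k e e + 4 * q * coneForm k W1 f + 4 * q1 * coneForm k W1 e +
      q2 * coneForm k W e + 2 * q1 * coneForm k W f = 0)
    (o5 : ∀ k, 10 * q ^ 2 * coneForm k e f + 10 * q * q1 * coneForm k e e +
      10 * q1 * coneForm k W1 f + 5 * q2 * coneForm k W1 e + q3 * coneForm k W e +
      3 * q2 * coneForm k W f = 0)
    (o6 : ∀ k, 10 * q ^ 2 * coneForm k f f + 50 * q * q1 * coneForm k e f +
      (10 * q1 ^ 2 + 15 * q * q2) * coneForm k e e + 18 * q2 * coneForm k W1 f +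
      6 * q3 * coneForm k W1 e + q4 * coneForm k W e + 4 * q3 * coneForm k W f = 0) :
    JetEq q q1 q2 q3 q4 := by
  subst hW hW1
  have a2 := o2 0
  have b2 := o2 1
  have a3 := o3 0
  have b3 := o3 1
  have a4 := o4 0
  have b4 := o4 1
  have a5 := o5 0
  have b5 := o5 1
  have a6 := o6 0
  clear o2 o3 o4 o5 o6
  simp only [coneForm, Matrix.cons_val, vec4_inl_zero, vec4_inl_one, vec4_inr_zero,
    vec4_inr_one, zero_mul, mul_zero, add_zero, zero_add] at *
  generalize e (Sum.inl 0) = e0 at *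
  generalize e (Sum.inl 1) = e1 at *
  generalize e (Sum.inr 0) = e2 at *
  generalize e (Sum.inr 1) = e3 at *
  generalize f (Sum.inl 0) = f0 at *
  generalize f (Sum.inl 1) = f1 at *
  generalize f (Sum.inr 0) = f2 at *
  generalize f (Sum.inr 1) = f3 at *
  obtain rfl : e2 = 0 := by simpa [hq, hρ] using b2
  have he3 : e3 = -6 * τ ^ 2 / (q * ρ) := by field_simp; linear_combination a2
  have he3n : e3 ≠ 0 := by rw [he3]; positivity
  have hf2 : f2 = -τ * e3 / ρ := by
    field_simp
    exact mul_left_cancel₀ hq (by linear_combination b3 / 3)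
  have hf3 : f3 = -(18 * q * τ * e1 + q1 * ρ * e3) / (q * ρ) := by
    field_simp; linear_combination a3
  have he1 : e1 = q1 * τ / (3 * q ^ 2) := by
    rw [hf3, hf2] at b4
    field_simp at b4 ⊢
    rw [he3] at b4
    field_simp at b4
    exact mul_left_cancel₀ (pow_ne_zero 2 hτ) (by linear_combination -b4 / 36)
  obtain rfl : f3 = 0 := by
    rw [hf3, he1, he3]
    field_simp
    ring
  clear hf3 a3 b3 b2 b4
  have hf1 : 10 * q ^ 2 * f1 = 30 * q ^ 2 * e0 * τ / ρ - 20 * q1 ^ 2 * τ / (3 * q) + 4 * q2 * τ := by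
    rw [hf2, he1] at b5
    field_simp at b5 ⊢
    refine mul_left_cancel₀ he3n ?_
    linear_combination b5
  have he0 : e0 = ρ * (q1 ^ 2 / (6 * q ^ 3) - q2 / (10 * q ^ 2)) := by
    have hf1' : f1 = (30 * q ^ 2 * e0 * τ / ρ - 20 * q1 ^ 2 * τ / (3 * q) + 4 * q2 * τ) /
      (10 * q ^ 2) := by rw [← hf1]; field_simp
    rw [he3, he1, hf1'] at a4
    field_simp at a4 ⊢
    refine mul_left_cancel₀ (pow_ne_zero 2 hτ) ?_
    linear_combination a4 / 18
  obtain rfl : f1 = -τ * (q1 ^ 2 / (6 * q ^ 3) - q2 / (10 * q ^ 2)) := by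
    rw [he0] at hf1
    refine mul_left_cancel₀ (by positivity : 10 * q ^ 2 ≠ 0) (hf1.trans ?_)
    field_simp
    ring
  -- The undetermined coordinate `f0` enters `a5` and `a6` only through Q(e, f), and this
  -- combination cancels it.
  have h := congrArg (q * ·) a6
  have h5 := congrArg (5 * q1 * ·) a5
  beta_reduce at h h5
  rw [he0, he1] at h h5
  have h7 := congrArg₂ (· - ·) h h5
  beta_reduce at h7
  rw [he3] at h7
  field_simp at h7
  refine mul_left_cancel₀ (mul_ne_zero (pow_ne_zero 2 hτ) hρ) ?_
  linear_combination -h7 / 324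

theorem inCone_cubicRep_smul {𝕜 : Type*} [Field 𝕜] [CharZero 𝕜]
    (m : Matrix.SpecialLinearGroup (Fin 2) 𝕜) {u : V4 𝕜} (hu : InCone u) :
    InCone (cubicRep m • u) := by
  obtain ⟨l, s, t, -, rfl⟩ := hu.exists_stdMap'
  rw [sp_smul_smul, cubicRep_smul_stdMap]
  exact (inCone_stdMap _ _).smul l

/-- `SL(2)` acts transitively on the tangent flags of the standard cubic. -/
theorem exists_cubicRep_normal_form {W W1 : V4 ℝ} (hW : ∀ k, coneForm k W W = 0)
    (hW1 : ∀ k, coneForm k W W1 = 0) (hind : ∀ a b : ℝ, a • W + b • W1 = 0 → a = 0 ∧ b = 0) :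
    ∃ (m : Matrix.SpecialLinearGroup (Fin 2) ℝ) (ρ τ : ℝ), ρ ≠ 0 ∧ τ ≠ 0 ∧
      cubicRep m • W = vec4 ρ 0 0 0 ∧ cubicRep m • W1 = vec4 0 τ 0 0 := by
  rcases (inCone_iff_coneForm.2 hW).exists_stdMap with ⟨l, t, rfl⟩ | ⟨l, rfl⟩
  · have hl : l ≠ 0 := fun h => by simpa using (hind 1 0 (by rw [h]; simp)).1
    have h0 : W1 (.inr 1) = 3 * t ^ 2 * W1 (.inl 0) - 6 * t * W1 (.inl 1) := by
      have := hW1 0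
      rw [coneForm_smul_left] at this
      have := (mul_eq_zero.1 this).resolve_left hl
      simp [coneForm, stdMap] at this
      linear_combination this
    have h1 : W1 (.inr 0) = -2 * t ^ 3 * W1 (.inl 0) + 3 * t ^ 2 * W1 (.inl 1) := by
      have := hW1 1
      rw [coneForm_smul_left] at this
      have := (mul_eq_zero.1 this).resolve_left hl
      simp [coneForm, stdMap] at this
      linear_combination this / 3 - t / 3 * h0
    have hb : W1 (.inl 1) - t * W1 (.inl 0) ≠ 0 := by
      intro hb
      have hb' : W1 (.inl 1) = t * W1 (.inl 0) := sub_eq_zero.1 hb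
      have := (hind (-W1 (.inl 0)) l (by
        refine V4.ext ?_ ?_ ?_ ?_ <;> simp [stdMap, h0, h1, hb'] <;> ring)).2
      exact hl this
    -- A lower unipotent matrix moves the point to [1 : 0]. An upper unipotent one, with this entry
    -- `n`, then removes the component of W1 along W.
    set n := -W1 (.inl 0) / (3 * (W1 (.inl 1) - t * W1 (.inl 0))) with hn
    have hn' : n * (3 * (W1 (.inl 1) - t * W1 (.inl 0))) = -W1 (.inl 0) := by
      rw [hn, div_mul_cancel₀ _ (mul_ne_zero three_ne_zero hb)]
    obtain ⟨m, m00, m01, m10, m11⟩ := exists_SL2_entries (p := 1 - n * t) (q := n) (r := -t)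
      (w := 1) (by ring)
    refine ⟨m, l, _, hl, hb, ?_, ?_⟩
    · rw [sp_smul_smul, cubicRep_smul_stdMap, m00, m01, m10, m11]
      refine V4.ext ?_ ?_ ?_ ?_ <;> simp [stdMap]
    · rw [sp_smul_eq]
      refine V4.ext ?_ ?_ ?_ ?_ <;>
        simp [Matrix.mulVec, dotProduct, Fintype.sum_sum_type, cubicRep_apply, cubicCol, m00, m01,
          m10, m11, h0, h1]
      · linear_combination hn'
      all_goals ring
  · have hl : l ≠ 0 := fun h => by simpa using (hind 1 0 (by rw [h]; simp)).1
    have h0 : W1 (.inl 0) = 0 := by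
      have := hW1 1
      rw [coneForm_smul_left] at this
      simpa [coneForm, stdMap, hl] using this
    have h1 : W1 (.inl 1) = 0 := by
      have := hW1 2
      rw [coneForm_smul_left] at this
      simpa [coneForm, stdMap, hl] using this
    have hb : W1 (.inr 1) ≠ 0 := by
      intro hb
      have := (hind (-W1 (.inr 0)) l (by
        refine V4.ext ?_ ?_ ?_ ?_ <;> simp [stdMap, h0, h1, hb]; ring)).2
      exact hl this
    obtain ⟨m, m00, m01, m10, m11⟩ := exists_SL2_entries (p := W1 (.inr 0) / W1 (.inr 1)) (q := 1)
      (r := -1) (w := 0) (by ring)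
    refine ⟨m, l, W1 (.inr 1) / 3, hl, by positivity, ?_, ?_⟩
    · rw [sp_smul_smul, cubicRep_smul_stdMap, m00, m01, m10, m11]
      refine V4.ext ?_ ?_ ?_ ?_ <;> simp [stdMap]
    · rw [sp_smul_eq]
      refine V4.ext ?_ ?_ ?_ ?_ <;>
        simp [Matrix.mulVec, dotProduct, Fintype.sum_sum_type, cubicRep_apply, cubicCol, m00, m01,
          m10, m11, h0, h1]
      · field_simp
        ring
      all_goals ring

variable {Y : ℕ → ℝ → ℝ} {I : Set ℝ}

/-- A lift that runs in a contact cubic satisfies the equation. -/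
theorem IsJetOn.jetEq_of_inCone (hY : IsJetOn Y I) (hI : IsOpen I) {g : Sp4 ℝ}
    (hg : ∀ x ∈ I, InCone (g • jetVec Y x)) {x₀ : ℝ} (hx₀ : x₀ ∈ I) :
    JetEq (Y 3 x₀) (Y 4 x₀) (Y 5 x₀) (Y 6 x₀) (Y 7 x₀) := by
  have hq : Y 3 x₀ ≠ 0 := hY.third_ne_zero hI subset_rfl hg hx₀ (subset_closure hx₀)
  have orders : ∀ h : Sp4 ℝ, (∀ x ∈ I, InCone (h • jetVec Y x)) → ∀ k, ∀ x ∈ I,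
      coneForm k (h • jetVec Y x) (h • jetVec Y x) = 0 ∧
      coneForm k (h • jetVec Y x) (h • jetVec' Y x) = 0 ∧
      coneForm k (h • jetVec' Y x) (h • jetVec' Y x) +
        Y 3 x * coneForm k (h • jetVec Y x) (h • fiberVec x) = 0 ∧
      3 * Y 3 x * coneForm k (h • jetVec' Y x) (h • fiberVec x) +
        Y 4 x * coneForm k (h • jetVec Y x) (h • fiberVec x) +
        Y 3 x * coneForm k (h • jetVec Y x) (h • fiberVec') = 0 ∧
      3 * Y 3 x ^ 2 * coneForm k (h • fiberVec x) (h • fiberVec x) +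
        4 * Y 3 x * coneForm k (h • jetVec' Y x) (h • fiberVec') +
        4 * Y 4 x * coneForm k (h • jetVec' Y x) (h • fiberVec x) +
        Y 5 x * coneForm k (h • jetVec Y x) (h • fiberVec x) +
        2 * Y 4 x * coneForm k (h • jetVec Y x) (h • fiberVec') = 0 ∧
      10 * Y 3 x ^ 2 * coneForm k (h • fiberVec x) (h • fiberVec') +
        10 * Y 3 x * Y 4 x * coneForm k (h • fiberVec x) (h • fiberVec x) +
        10 * Y 4 x * coneForm k (h • jetVec' Y x) (h • fiberVec') +
        5 * Y 5 x * coneForm k (h • jetVec' Y x) (h • fiberVec x) +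
        Y 6 x * coneForm k (h • jetVec Y x) (h • fiberVec x) +
        3 * Y 5 x * coneForm k (h • jetVec Y x) (h • fiberVec') = 0 ∧
      10 * Y 3 x ^ 2 * coneForm k (h • fiberVec') (h • fiberVec') +
        50 * Y 3 x * Y 4 x * coneForm k (h • fiberVec x) (h • fiberVec') +
        (10 * Y 4 x ^ 2 + 15 * Y 3 x * Y 5 x) *
          coneForm k (h • fiberVec x) (h • fiberVec x) +
        18 * Y 5 x * coneForm k (h • jetVec' Y x) (h • fiberVec') +
        6 * Y 6 x * coneForm k (h • jetVec' Y x) (h • fiberVec x) +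
        Y 7 x * coneForm k (h • jetVec Y x) (h • fiberVec x) +
        4 * Y 6 x * coneForm k (h • jetVec Y x) (h • fiberVec') = 0 := by
    intro h hcone k
    have dz : ∀ {f : ℝ → ℝ} {f' x : ℝ}, (∀ z ∈ I, f z = 0) → x ∈ I → HasDerivAt f f' x →
        f' = 0 := fun hf hx hd => hd.unique ((hasDerivAt_const _ (0 : ℝ)).congr_of_eventuallyEq
      (Filter.eventuallyEq_of_mem (hI.mem_nhds hx) hf))
    have hW : ∀ x ∈ I, HasDerivAt (fun x => h • jetVec Y x) (h • jetVec' Y x) x :=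
      fun x hx => HasDerivAt.sp_smul (hY.hasDerivAt_jetVec hx) h
    have hW1 : ∀ x ∈ I, HasDerivAt (fun x => h • jetVec' Y x) (Y 3 x • (h • fiberVec x)) x :=
      fun x hx => by
        rw [← sp_smul_smul]
        exact HasDerivAt.sp_smul (hY.hasDerivAt_jetVec' hx) h
    have hE : ∀ x, HasDerivAt (fun x => h • fiberVec x) (h • fiberVec') x :=
      fun x => HasDerivAt.sp_smul (hasDerivAt_fiberVec x) h
    have hF : ∀ x : ℝ, HasDerivAt (fun _ => h • fiberVec') 0 x := fun x => hasDerivAt_const x _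
    have hz : ∀ u : V4 ℝ, coneForm k u 0 = 0 := fun u => by
      simpa using coneForm_smul_right k 0 u 0
    have q3 := hY 3 (by norm_num)
    have q4 := hY 4 (by norm_num)
    have q5 := hY 5 (by norm_num)
    have q6 := hY 6 (by norm_num)
    generalize hWd : (fun x => h • jetVec Y x) = W at *
    generalize hW1d : (fun x => h • jetVec' Y x) = W1 at *
    generalize hEd : (fun x => h • fiberVec x) = E at *
    generalize h • fiberVec' = F at *
    replace hWd : ∀ x, h • jetVec Y x = W x := fun x => congrFun hWd x
    replace hW1d : ∀ x, h • jetVec' Y x = W1 x := fun x => congrFun hW1d x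
    replace hEd : ∀ x, h • fiberVec x = E x := fun x => congrFun hEd x
    simp only [hWd, hW1d, hEd] at *
    have dWW1 : ∀ x ∈ I, HasDerivAt (fun x => coneForm k (W x) (W1 x))
        (coneForm k (W1 x) (W1 x) + Y 3 x * coneForm k (W x) (E x)) x := fun x hx =>
      (HasDerivAt.coneForm (hW x hx) (hW1 x hx)).congr_deriv (by rw [coneForm_smul_right])
    have dW1W1 : ∀ x ∈ I, HasDerivAt (fun x => coneForm k (W1 x) (W1 x))
        (2 * (Y 3 x * coneForm k (W1 x) (E x))) x := fun x hx =>
      (HasDerivAt.coneForm (hW1 x hx) (hW1 x hx)).congr_deriv (by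
        rw [coneForm_smul_right, coneForm_smul_left, coneForm_comm k (E x)]; ring)
    have dWE : ∀ x ∈ I, HasDerivAt (fun x => coneForm k (W x) (E x))
        (coneForm k (W1 x) (E x) + coneForm k (W x) F) x := fun x hx =>
      HasDerivAt.coneForm (hW x hx) (hE x)
    have dWF : ∀ x ∈ I, HasDerivAt (fun x => coneForm k (W x) F) (coneForm k (W1 x) F) x :=
      fun x hx => (HasDerivAt.coneForm (hW x hx) (hF x)).congr_deriv (by rw [hz, add_zero])
    have dW1E : ∀ x ∈ I, HasDerivAt (fun x => coneForm k (W1 x) (E x))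
        (Y 3 x * coneForm k (E x) (E x) + coneForm k (W1 x) F) x := fun x hx =>
      (HasDerivAt.coneForm (hW1 x hx) (hE x)).congr_deriv (by rw [coneForm_smul_left])
    have dW1F : ∀ x ∈ I, HasDerivAt (fun x => coneForm k (W1 x) F)
        (Y 3 x * coneForm k (E x) F) x := fun x hx =>
      (HasDerivAt.coneForm (hW1 x hx) (hF x)).congr_deriv (by
        rw [coneForm_smul_left, hz, add_zero])
    have dEE : ∀ x ∈ I, HasDerivAt (fun x => coneForm k (E x) (E x))
        (2 * coneForm k (E x) F) x := fun x _ =>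
      (HasDerivAt.coneForm (hE x) (hE x)).congr_deriv (by rw [coneForm_comm k F]; ring)
    have dEF : ∀ x ∈ I, HasDerivAt (fun x => coneForm k (E x) F) (coneForm k F F) x :=
      fun x _ => (HasDerivAt.coneForm (hE x) (hF x)).congr_deriv (by rw [hz, add_zero])
    have o0 : ∀ x ∈ I, coneForm k (W x) (W x) = 0 := fun x hx => inCone_iff_coneForm.1 (hcone x hx) k
    have o1 : ∀ x ∈ I, coneForm k (W x) (W1 x) = 0 := fun x hx => by
      have := dz o0 hx (HasDerivAt.coneForm (hW x hx) (hW x hx))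
      rw [coneForm_comm k (W1 x)] at this
      linarith
    have o2 := fun x hx => dz o1 hx (dWW1 x hx)
    have o3 := fun x hx => dz o2 hx ((dW1W1 x hx).add ((q3 x hx).mul (dWE x hx)))
    have o3' : ∀ x ∈ I, 3 * (Y 3 x * coneForm k (W1 x) (E x)) +
        Y 4 x * coneForm k (W x) (E x) + Y 3 x * coneForm k (W x) F = 0 := fun x hx => by
      linear_combination o3 x hx
    have o4 := fun x hx => dz o3' hx (((((q3 x hx).mul (dW1E x hx)).const_mul 3).add
      ((q4 x hx).mul (dWE x hx))).add ((q3 x hx).mul (dWF x hx)))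
    have o4' : ∀ x ∈ I, 3 * (Y 3 x ^ 2 * coneForm k (E x) (E x)) +
        4 * (Y 3 x * coneForm k (W1 x) F) + 4 * (Y 4 x * coneForm k (W1 x) (E x)) +
        Y 5 x * coneForm k (W x) (E x) + 2 * (Y 4 x * coneForm k (W x) F) = 0 := fun x hx => by
      linear_combination o4 x hx
    have o5 := fun x hx => dz o4' hx (((((((((q3 x hx).fun_pow 2).mul (dEE x hx)).const_mul 3).add
      (((q3 x hx).mul (dW1F x hx)).const_mul 4)).add (((q4 x hx).mul (dW1E x hx)).const_mul 4)).add
      ((q5 x hx).mul (dWE x hx))).add (((q4 x hx).mul (dWF x hx)).const_mul 2)))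
    have o5' : ∀ x ∈ I, 10 * (Y 3 x ^ 2 * coneForm k (E x) F) +
        10 * (Y 3 x * Y 4 x * coneForm k (E x) (E x)) + 10 * (Y 4 x * coneForm k (W1 x) F) +
        5 * (Y 5 x * coneForm k (W1 x) (E x)) + Y 6 x * coneForm k (W x) (E x) +
        3 * (Y 5 x * coneForm k (W x) F) = 0 := fun x hx => by
      linear_combination o5 x hx
    have o6 := fun x hx => dz o5' hx ((((((((((q3 x hx).fun_pow 2).mul (dEF x hx)).const_mul 10).add
      ((((q3 x hx).fun_mul (q4 x hx)).mul (dEE x hx)).const_mul 10)).add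
      (((q4 x hx).mul (dW1F x hx)).const_mul 10)).add
      (((q5 x hx).mul (dW1E x hx)).const_mul 5)).add
      ((q6 x hx).mul (dWE x hx))).add (((q5 x hx).mul (dWF x hx)).const_mul 3)))
    intro x hx
    refine ⟨o0 x hx, o1 x hx, o2 x hx, ?_, ?_, ?_, ?_⟩
    · linear_combination o3' x hx
    · linear_combination o4' x hx
    · linear_combination o5' x hx
    · linear_combination o6 x hx
  -- An element of SL(2) preserves the cone, so the flag at `x₀` may be put in normal form without
  -- losing the relations on all of `I`.
  obtain ⟨m, ρ, τ, hρ, hτ, hW, hW1⟩ := exists_cubicRep_normal_form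
    (W := g • jetVec Y x₀) (W1 := g • jetVec' Y x₀) (fun k => (orders g hg k x₀ hx₀).1)
    (fun k => (orders g hg k x₀ hx₀).2.1) (by
      intro a b h
      rw [← sp_smul_smul, ← sp_smul_smul, ← sp_smul_add] at h
      have h' := (smul_eq_zero_iff_eq g).1 h
      have h0 := congrFun h' (Sum.inl 0)
      have h1 := congrFun h' (Sum.inl 1)
      simp [jetVec, jetVec'] at h0 h1
      simp [h0] at h1
      exact ⟨h0, h1⟩)
  have H := orders (cubicRep m * g) (fun x hx => by
    rw [mul_smul]
    exact inCone_cubicRep_smul m (hg x hx))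
  rw [← mul_smul] at hW hW1
  exact jetEq_of_orders hρ hτ hq hW hW1 (fun k => (H k x₀ hx₀).2.2.1)
    (fun k => (H k x₀ hx₀).2.2.2.1) (fun k => (H k x₀ hx₀).2.2.2.2.1)
    (fun k => (H k x₀ hx₀).2.2.2.2.2.1) (fun k => (H k x₀ hx₀).2.2.2.2.2.2)

end CubicToODE

end SubmaximalODE
end

noncomputable section
set_option linter.unusedSectionVars false
namespace SubmaximalODE

/-! ### Solutions of the equation run locally in a contact cubic -/

section ODEToCubic

/-- The cone over a contact cubic, in terms of the coefficient vectors of the cubic. -/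
theorem IsContactFrame.exists_sp_inCone {a : Fin 4 → V4 ℝ}
    {k : ℝ} (h : IsContactFrame a k) (hk : k ≠ 0) : ∃ g : Sp4 ℝ, ∀ u,
      3 * sympForm u (a 0) * sympForm u (a 2) - sympForm u (a 1) ^ 2 = 0 →
      9 * sympForm u (a 0) * sympForm u (a 3) - sympForm u (a 1) * sympForm u (a 2) = 0 →
      3 * sympForm u (a 1) * sympForm u (a 3) - sympForm u (a 2) ^ 2 = 0 → InCone (g • u) := by
  obtain ⟨g, hg⟩ := h.exists_sp hk
  refine ⟨g⁻¹, fun u hP hR hS => ?_⟩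
  have hframe : (fun i => g • stdFrame ℝ i) =
      fun i : Fin 4 => ((k ^ 2)⁻¹ * (-k) ^ (i : ℕ)) • a i := by
    refine cubicMap_injective fun s t => ?_
    rw [cubicMap_smul_stdFrame, hg]
    simp only [cubicMap, Fin.val_zero, Fin.val_one, Fin.val_two,
      show ((3 : Fin 4) : ℕ) = 3 from rfl]
    module
  have hw : ∀ i : Fin 4, sympForm (g⁻¹ • u) (stdFrame ℝ i) =
      (k ^ 2)⁻¹ * (-k) ^ (i : ℕ) * sympForm u (a i) := fun i => by
    rw [← sympForm_sp_smul g, smul_inv_smul, congrFun hframe i, sympForm_smul_right]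
  generalize g⁻¹ • u = w at hw
  have w0 := hw 0
  have w1 := hw 1
  have w2 := hw 2
  have w3 := hw 3
  clear hw
  generalize sympForm u (a 0) = A at *
  generalize sympForm u (a 1) = B at *
  generalize sympForm u (a 2) = C at *
  generalize sympForm u (a 3) = D at *
  simp only [stdFrame, Matrix.cons_val, sympForm_eq, vec4_inl_zero, vec4_inl_one, vec4_inr_zero,
    vec4_inr_one, Fin.val_zero, Fin.val_one, Fin.val_two,
    show ((3 : Fin 4) : ℕ) = 3 from rfl] at w0 w1 w2 w3
  replace w0 : w (.inr 0) = (k ^ 2)⁻¹ * A := by linear_combination w0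
  replace w1 : w (.inr 1) = -((k ^ 2)⁻¹ * k * B) := by linear_combination w1
  replace w2 : w (.inl 1) = (k ^ 2)⁻¹ * k ^ 2 * C / 3 := by linear_combination w2 / 3
  replace w3 : w (.inl 0) = (k ^ 2)⁻¹ * k ^ 3 * D := by linear_combination -w3
  refine ⟨?_, ?_, ?_⟩ <;> simp only [w0, w1, w2, w3] <;> field_simp
  · linear_combination -hS
  · linear_combination hR
  · linear_combination -hP * 3

/-- The only solution of a linear differential system that vanishes at a point is zero. -/
theorem eq_zero_of_linear_system {a b M x z : ℝ} {μ κ P R S : ℝ → ℝ}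
    (hμ : ∀ t ∈ Set.Ioo a b, |μ t| ≤ M) (hκ : ∀ t ∈ Set.Ioo a b, |κ t| ≤ M)
    (hP : ∀ t ∈ Set.Ioo a b, HasDerivAt P (R t + 2 * μ t * P t) t)
    (hR : ∀ t ∈ Set.Ioo a b, HasDerivAt R (2 * S t + 2 * κ t * P t + 3 * μ t * R t) t)
    (hS : ∀ t ∈ Set.Ioo a b, HasDerivAt S (κ t * R t + 4 * μ t * S t) t)
    (hx : x ∈ Set.Ioo a b) (hz : z ∈ Set.Ioo a b) (hPx : P x = 0) (hRx : R x = 0)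
    (hSx : S x = 0) : P z = 0 ∧ R z = 0 ∧ S z = 0 := by
  have hM : 0 ≤ M := (abs_nonneg _).trans (hμ x hx)
  obtain ⟨a', ha, hax, haz⟩ : ∃ a', a < a' ∧ a' < x ∧ a' < z := by
    obtain ⟨a', h1, h2⟩ := exists_between (lt_min hx.1 hz.1)
    exact ⟨a', h1, (lt_min_iff.1 h2).1, (lt_min_iff.1 h2).2⟩
  obtain ⟨b', hb, hbx, hbz⟩ : ∃ b', b' < b ∧ x < b' ∧ z < b' := by
    obtain ⟨b', h1, h2⟩ := exists_between (max_lt hx.2 hz.2)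
    exact ⟨b', h2, (max_lt_iff.1 h1).1, (max_lt_iff.1 h1).2⟩
  have hsub : ∀ t ∈ Set.Icc a' b', t ∈ Set.Ioo a b := fun t ht =>
    ⟨ha.trans_le ht.1, ht.2.trans_lt hb⟩
  have hd : ∀ t ∈ Set.Icc a' b', HasDerivAt (fun t => (P t, R t, S t))
      (R t + 2 * μ t * P t, 2 * S t + 2 * κ t * P t + 3 * μ t * R t, κ t * R t + 4 * μ t * S t) t :=
    fun t ht => (hP t (hsub t ht)).prodMk ((hR t (hsub t ht)).prodMk (hS t (hsub t ht)))
  -- In the supremum norm the second component of the system has the largest bound, 2 + 2M + 3M,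
  -- whence the Lipschitz constant.
  have key := ODE_solution_unique_of_mem_Icc (E := ℝ × ℝ × ℝ) (a := a') (b := b') (t₀ := x)
    (K := Real.toNNReal (2 + 5 * M)) (s := fun _ => Set.univ)
    (v := fun t p => (p.2.1 + 2 * μ t * p.1, 2 * p.2.2 + 2 * κ t * p.1 + 3 * μ t * p.2.1,
      κ t * p.2.1 + 4 * μ t * p.2.2)) (f := fun t => (P t, R t, S t)) (g := fun _ => 0)
    (fun t ht => by
      refine (LipschitzWith.of_dist_le_mul fun p q => ?_).lipschitzOnWith
      have m := hμ t (hsub t (Set.Ioo_subset_Icc_self ht))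
      have k := hκ t (hsub t (Set.Ioo_subset_Icc_self ht))
      rw [Real.coe_toNNReal _ (by positivity), dist_eq_norm, dist_eq_norm]
      have h1 : |p.1 - q.1| ≤ ‖p - q‖ := norm_fst_le (p - q)
      have h2 : |p.2.1 - q.2.1| ≤ ‖p - q‖ :=
        (norm_fst_le (p - q).2).trans (norm_snd_le (p - q))
      have h3 : |p.2.2 - q.2.2| ≤ ‖p - q‖ :=
        (norm_snd_le (p - q).2).trans (norm_snd_le (p - q))
      have hN := norm_nonneg (p - q)
      generalize ‖p - q‖ = N at *
      have bd : ∀ {c d : ℝ}, |c| ≤ M → |d| ≤ N → |c * d| ≤ M * N := fun hc hd => by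
        rw [abs_mul]
        exact mul_le_mul hc hd (abs_nonneg _) hM
      have e1 := abs_le.1 (bd m h1)
      have e2 := abs_le.1 (bd m h2)
      have e3 := abs_le.1 (bd m h3)
      have e4 := abs_le.1 (bd k h1)
      have e5 := abs_le.1 (bd k h2)
      have hMN := mul_nonneg hM hN
      rw [abs_le] at h1 h2 h3
      refine norm_prod_le_iff.2 ⟨?_, norm_prod_le_iff.2 ⟨?_, ?_⟩⟩ <;>
        simp only [Prod.fst_sub, Prod.snd_sub, Real.norm_eq_abs] <;> rw [abs_le] <;>
        constructor <;> linarith)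
    ⟨hax, hbx⟩ (fun t ht => (hd t ht).continuousAt.continuousWithinAt)
    (fun t ht => hd t (Set.Ioo_subset_Icc_self ht)) (fun _ _ => trivial) continuousOn_const
    (fun t _ => (hasDerivAt_const t _).congr_deriv (by simp; rfl)) (fun _ _ => trivial)
    (by simp [hPx, hRx, hSx])
  have h := key (Set.mem_Icc.2 ⟨haz.le, hbz.le⟩)
  simp only [Prod.ext_iff] at h
  exact ⟨h.1, h.2.1, h.2.2⟩

/-- Near a point without inflection, a solution of the equation runs in a contact cubic. -/
theorem IsJetOn.eventually_inCone {Y : ℕ → ℝ → ℝ} {I : Set ℝ} (hY : IsJetOn Y I)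
    (hI : IsOpen I) (hode : ∀ x ∈ I, JetEq (Y 3 x) (Y 4 x) (Y 5 x) (Y 6 x) (Y 7 x)) {z : ℝ}
    (hz : z ∈ I) (hq : Y 3 z ≠ 0) :
    ∃ g : Sp4 ℝ, ∀ᶠ x in nhds z, InCone (g • jetVec Y x) := by
  have hnear : {x | x ∈ I ∧ Y 3 x ≠ 0} ∈ nhds z :=
    Filter.inter_mem (hI.mem_nhds hz) ((hY 3 (by norm_num) z hz).continuousAt.eventually_ne hq)
  obtain ⟨ε, hε, hball⟩ := Metric.nhds_basis_closedBall.mem_iff.1 hnear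
  rw [Real.closedBall_eq_Icc] at hball
  set q := Y 3
  set q1 := Y 4
  set q2 := Y 5
  set q3 := Y 6
  set q4 := Y 7
  -- The frame is sought with derivative s∂ₜ + κt∂ₛ + μt∂ₜ acting on its cubic form. Matching the
  -- coefficient of E forces μ = q'/(3q), and then μ' = 2μ² - 10κ determines κ.
  set μ : ℝ → ℝ := fun x => q1 x / (3 * q x) with hμ
  set κ : ℝ → ℝ := fun x => q1 x ^ 2 / (18 * q x ^ 2) - q2 x / (30 * q x) with hκ
  set κ1 : ℝ → ℝ := fun x => 13 * (q1 x * q2 x) / (90 * q x ^ 2) - q1 x ^ 3 / (9 * q x ^ 3) -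
    q3 x / (30 * q x) with hκ1
  have d0 : ∀ x ∈ Set.Icc (z - ε) (z + ε), HasDerivAt q (q1 x) x :=
    fun x hx => hY 3 (by norm_num) x (hball hx).1
  have d1 : ∀ x ∈ Set.Icc (z - ε) (z + ε), HasDerivAt q1 (q2 x) x :=
    fun x hx => hY 4 (by norm_num) x (hball hx).1
  have d2 : ∀ x ∈ Set.Icc (z - ε) (z + ε), HasDerivAt q2 (q3 x) x :=
    fun x hx => hY 5 (by norm_num) x (hball hx).1
  have d3 : ∀ x ∈ Set.Icc (z - ε) (z + ε), HasDerivAt q3 (q4 x) x :=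
    fun x hx => hY 6 (by norm_num) x (hball hx).1
  have hq1 : ∀ x ∈ Set.Icc (z - ε) (z + ε), q1 x = 3 * q x * μ x := fun x hx => by
    have := (hball hx).2
    simp only [hμ]
    field_simp
  have dμ : ∀ x ∈ Set.Icc (z - ε) (z + ε), HasDerivAt μ (2 * μ x ^ 2 - 10 * κ x) x :=
    fun x hx => by
      have hx0 : q x ≠ 0 := (hball hx).2
      refine ((d1 x hx).div ((d0 x hx).const_mul 3) (by positivity)).congr_deriv ?_
      simp only [hμ, hκ]
      field_simp
      ring
  have dκ : ∀ x ∈ Set.Icc (z - ε) (z + ε), HasDerivAt κ (κ1 x) x := fun x hx => by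
    have hx0 : q x ≠ 0 := (hball hx).2
    refine ((((d1 x hx).fun_pow 2).div (((d0 x hx).fun_pow 2).const_mul 18) (by positivity)).sub
      ((d2 x hx).div ((d0 x hx).const_mul 30) (by positivity))).congr_deriv ?_
    simp only [hκ1]
    field_simp
    ring
  -- This is the only place where the differential equation enters. It is what closes the system for
  -- the last frame vector.
  have dκ1 : ∀ x ∈ Set.Icc (z - ε) (z + ε), HasDerivAt κ1
      (5 * κ1 x * μ x - 2 * κ x * μ x ^ 2 - 17 * κ x ^ 2) x := fun x hx => by
    have hx0 : q x ≠ 0 := (hball hx).2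
    have h := hode x (hball hx).1
    refine (((((d1 x hx).fun_mul (d2 x hx)).const_mul 13).div
      (((d0 x hx).fun_pow 2).const_mul 90) (by positivity)).sub
      (((d1 x hx).fun_pow 3).div (((d0 x hx).fun_pow 3).const_mul 9) (by positivity))).sub
      ((d3 x hx).div ((d0 x hx).const_mul 30) (by positivity)) |>.congr_deriv ?_
    simp only [hκ1, hκ, hμ]
    simp only [JetEq] at h
    field_simp
    linear_combination -7085880 * q x ^ 2 * h
  obtain ⟨M, hM⟩ := isCompact_Icc.exists_bound_of_continuousOn
    (f := fun x => (μ x, κ x)) fun x hx =>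
      ((dμ x hx).continuousAt.prodMk (dκ x hx).continuousAt).continuousWithinAt
  have hzε : z ∈ Set.Ioo (z - ε) (z + ε) := ⟨by linarith, by linarith⟩
  have hsub := @Set.Ioo_subset_Icc_self ℝ _ (z - ε) (z + ε)
  set a : Fin 4 → V4 ℝ := ![jetVec Y z, jetVec' Y z,
    (1 / 2 : ℝ) • (q z • fiberVec z - μ z • jetVec' Y z - (3 * κ z) • jetVec Y z),
    (1 / 6 : ℝ) • (q z • fiberVec' - (3 * (κ1 z - 2 * κ z * μ z)) • jetVec Y z +
      (3 * κ z) • jetVec' Y z)] with ha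
  have hframe : IsContactFrame a (q z / 6) := by
    constructor <;> simp [ha, sympForm_eq, jetVec, jetVec', fiberVec, fiberVec'] <;> ring
  obtain ⟨g, hg⟩ := hframe.exists_sp_inCone (by positivity)
  refine ⟨g, Filter.eventually_of_mem (Ioo_mem_nhds hzε.1 hzε.2) fun x hx => ?_⟩
  -- The point `x` is now fixed and the frame is moved to t. The Hessian coefficients of ω(u, frame
  -- at t) satisfy a homogeneous linear system in t and vanish at t = x, so they vanish at t = z:
  -- the point of the lift at `x` lies in the cubic of the frame at `z`.
  set u := jetVec Y x with hu
  have dA : ∀ t ∈ Set.Ioo (z - ε) (z + ε), HasDerivAt (fun t => sympForm u (jetVec Y t))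
      (sympForm u (jetVec' Y t)) t := fun t ht =>
    HasDerivAt.sympForm_const (hY.hasDerivAt_jetVec (hball (hsub ht)).1) u
  have dB : ∀ t ∈ Set.Ioo (z - ε) (z + ε), HasDerivAt (fun t => sympForm u (jetVec' Y t))
      (q t * sympForm u (fiberVec t)) t := fun t ht => by
    rw [← sympForm_smul_right]
    exact HasDerivAt.sympForm_const (hY.hasDerivAt_jetVec' (hball (hsub ht)).1) u
  have dE : ∀ t, HasDerivAt (fun t => sympForm u (fiberVec t)) (sympForm u fiberVec') t :=
    fun t => HasDerivAt.sympForm_const (hasDerivAt_fiberVec t) u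
  have hAx : sympForm u (jetVec Y x) = 0 := sympForm_self u
  have hBx : sympForm u (jetVec' Y x) = 0 := by
    simp [hu, sympForm_eq, jetVec, jetVec']
  have hEx : sympForm u (fiberVec x) = 0 := by
    simp [hu, sympForm_eq, jetVec, fiberVec]
  have hα : ∀ i, sympForm u (a i) = ![sympForm u (jetVec Y z), sympForm u (jetVec' Y z),
      (q z * sympForm u (fiberVec z) - μ z * sympForm u (jetVec' Y z) -
        3 * κ z * sympForm u (jetVec Y z)) / 2,
      (q z * sympForm u fiberVec' - 3 * (κ1 z - 2 * κ z * μ z) * sympForm u (jetVec Y z) +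
        3 * κ z * sympForm u (jetVec' Y z)) / 6] i := by
    intro i
    fin_cases i <;> simp [ha, sympForm_smul_right, sympForm_sub_right, sympForm_add_right] <;> ring
  have hgu := hg u
  rw [hα 0, hα 1, hα 2, hα 3] at hgu
  simp only [Matrix.cons_val] at hgu
  generalize hAd : (fun t => sympForm u (jetVec Y t)) = A at *
  generalize hBd : (fun t => sympForm u (jetVec' Y t)) = B at *
  generalize hEd : (fun t => sympForm u (fiberVec t)) = E at *
  generalize sympForm u fiberVec' = F at *
  replace hAd : ∀ t, sympForm u (jetVec Y t) = A t := fun t => congrFun hAd t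
  replace hBd : ∀ t, sympForm u (jetVec' Y t) = B t := fun t => congrFun hBd t
  replace hEd : ∀ t, sympForm u (fiberVec t) = E t := fun t => congrFun hEd t
  simp only [hAd, hBd, hEd] at hgu dA dB hAx hBx hEx
  set α2 : ℝ → ℝ := fun t => (q t * E t - μ t * B t - 3 * κ t * A t) / 2 with hα2
  set α3 : ℝ → ℝ := fun t =>
    (q t * F - 3 * (κ1 t - 2 * κ t * μ t) * A t + 3 * κ t * B t) / 6 with hα3
  have dB' : ∀ t ∈ Set.Ioo (z - ε) (z + ε),
      HasDerivAt B (3 * κ t * A t + μ t * B t + 2 * α2 t) t := fun t ht =>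
    (dB t ht).congr_deriv (by simp only [hα2]; ring)
  have dα2 : ∀ t ∈ Set.Ioo (z - ε) (z + ε),
      HasDerivAt α2 (2 * κ t * B t + 2 * μ t * α2 t + 3 * α3 t) t := fun t ht => by
    refine (((((d0 t (hsub ht)).mul (dE t)).sub ((dμ t (hsub ht)).mul (dB t ht))).sub
      (((dκ t (hsub ht)).const_mul 3).mul (dA t ht))).div_const 2).congr_deriv ?_
    simp only [hα2, hα3]
    linear_combination E t / 2 * hq1 t (hsub ht)
  have dα3 : ∀ t ∈ Set.Ioo (z - ε) (z + ε),
      HasDerivAt α3 (κ t * α2 t + 3 * μ t * α3 t) t := fun t ht => by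
    refine (((((d0 t (hsub ht)).mul_const F).sub ((((dκ1 t (hsub ht)).fun_sub
      (((dκ t (hsub ht)).const_mul 2).fun_mul (dμ t (hsub ht)))).const_mul 3).mul (dA t ht))).add
      (((dκ t (hsub ht)).const_mul 3).mul (dB t ht))).div_const 6).congr_deriv ?_
    simp only [hα2, hα3]
    linear_combination F / 6 * hq1 t (hsub ht)
  have key := eq_zero_of_linear_system (a := z - ε) (b := z + ε) (M := M) (x := x) (z := z)
    (μ := μ) (κ := κ) (P := fun t => 3 * A t * α2 t - B t ^ 2)
    (R := fun t => 9 * A t * α3 t - B t * α2 t) (S := fun t => 3 * B t * α3 t - α2 t ^ 2)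
    (fun t ht => (norm_fst_le (μ t, κ t)).trans (hM t (hsub ht)))
    (fun t ht => (norm_snd_le (μ t, κ t)).trans (hM t (hsub ht)))
    (fun t ht => ((((dA t ht).const_mul 3).mul (dα2 t ht)).sub
      ((dB' t ht).fun_pow 2)).congr_deriv (by ring))
    (fun t ht => ((((dA t ht).const_mul 9).mul (dα3 t ht)).sub
      ((dB' t ht).mul (dα2 t ht))).congr_deriv (by ring))
    (fun t ht => ((((dB' t ht).const_mul 3).mul (dα3 t ht)).sub
      ((dα2 t ht).fun_pow 2)).congr_deriv (by ring))
    hx hzε (by simp [hAx, hBx]) (by simp [hAx, hBx]) (by simp [hα2, hAx, hBx, hEx])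
  exact hgu key.1 key.2.1 key.2.2

end ODEToCubic

end SubmaximalODE
end

noncomputable section
set_option linter.unusedSectionVars false
namespace SubmaximalODE

/-! ### Solutions and contact cubics -/

section Solutions

variable {Y : ℕ → ℝ → ℝ} {I : Set ℝ}

theorem jetVec_ne_zero (Y : ℕ → ℝ → ℝ) (x : ℝ) : jetVec Y x ≠ 0 := fun h => by
  simpa [jetVec] using congrFun h (Sum.inl 0)

theorem jetVec_proportional {x x' : ℝ} {c : ℝ} (h : c • jetVec Y x = jetVec Y x') : x = x' := by
  have h0 := congrFun h (Sum.inl 0)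
  have h1 := congrFun h (Sum.inl 1)
  simp [jetVec] at h0 h1
  rw [h0, one_mul] at h1
  exact h1

/-- The lift of a function to `ℙ³(ℝ)`. -/
def liftCurve (Y : ℕ → ℝ → ℝ) (I : Set ℝ) : Set (P3 ℝ) :=
  (fun x => Projectivization.mk ℝ (jetVec Y x) (jetVec_ne_zero Y x)) '' I

theorem liftCurve_infinite (hI : I.Infinite) : (liftCurve Y I).Infinite := by
  refine hI.image fun x _ x' _ h => ?_
  obtain ⟨c, hc⟩ := (Projectivization.mk_eq_mk_iff' ℝ _ _ _ _).1 h
  exact (jetVec_proportional hc).symm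

theorem liftCurve_subset_iff {g : Sp4 ℝ} :
    liftCurve Y I ⊆ g⁻¹ • stdCurve ℝ ↔ ∀ x ∈ I, InCone (g • jetVec Y x) := by
  rw [liftCurve, Set.image_subset_iff]
  simp only [Set.subset_def, Set.mem_preimage, mk_mem_smul_stdCurve, inv_inv]

/-- A solution of the equation that is not a quadratic polynomial runs in one contact cubic. -/
theorem IsJetOn.exists_inCone (hY : IsJetOn Y I) (hI : IsOpen I) (hI' : IsPreconnected I)
    (hode : ∀ x ∈ I, JetEq (Y 3 x) (Y 4 x) (Y 5 x) (Y 6 x) (Y 7 x)) {z : ℝ}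
    (hz : z ∈ I) (hq : Y 3 z ≠ 0) : ∃ g : Sp4 ℝ, ∀ x ∈ I, InCone (g • jetVec Y x) := by
  obtain ⟨g, hg⟩ := hY.eventually_inCone hI hode hz hq
  refine ⟨g, ?_⟩
  set U : Set ℝ := {x | ∀ᶠ x' in nhds x, x' ∈ I ∧ InCone (g • jetVec Y x')} with hU
  have hUo : IsOpen U := isOpen_setOfPred_eventually_nhds
  have hUI : U ⊆ I := fun x hx => hx.self_of_nhds.1
  have hUc : ∀ x ∈ U, InCone (g • jetVec Y x) := fun x hx => hx.self_of_nhds.2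
  have hsub : I ⊆ U := by
    refine hI'.subset_of_closure_inter_subset hUo
      ⟨z, hz, (hI.eventually_mem hz).and hg⟩ ?_
    rintro x ⟨hxU, hxI⟩
    -- At a limit point of `U` there is still no inflection, so the local result applies there. The
    -- two cubics share infinitely many points of the overlap and hence coincide.
    have hx3 := hY.third_ne_zero hUo hUI hUc hxI hxU
    obtain ⟨h, hh⟩ := hY.eventually_inCone hI hode hxI hx3
    obtain ⟨V, hVh, hVo, hxV⟩ := eventually_nhds_iff.1 hh
    have hne : (V ∩ U).Nonempty := mem_closure_iff.1 hxU V hVo hxV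
    have hinf : (V ∩ U).Infinite := by
      obtain ⟨w, hw⟩ := hne
      exact infinite_of_mem_nhds w ((hVo.inter hUo).mem_nhds hw)
    have e1 := zariskiClosure_eq_smul_stdCurve g⁻¹
      (liftCurve_subset_iff.2 fun w hw => hUc w hw.2) (liftCurve_infinite (Y := Y) hinf)
    have e2 := zariskiClosure_eq_smul_stdCurve h⁻¹
      (liftCurve_subset_iff.2 fun w hw => hVh w hw.1) (liftCurve_infinite (Y := Y) hinf)
    have e : h⁻¹ • stdCurve ℝ = g⁻¹ • stdCurve ℝ := e2.symm.trans e1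
    have hVg : ∀ w ∈ V, InCone (g • jetVec Y w) :=
      liftCurve_subset_iff.1 (e ▸ liftCurve_subset_iff.2 hVh)
    exact (hI.eventually_mem hxI).and ((hVo.eventually_mem hxV).mono hVg)
  exact fun x hx => hUc x (hsub hx)

theorem jetVec_iteratedDeriv (y : ℝ → ℝ) (x : ℝ) :
    jetVec (fun k => iteratedDeriv k y) x = chartVec (x, y x, deriv y x) := by
  simp only [jetVec, iteratedDeriv_zero, iteratedDeriv_one]
  rfl

theorem jetGraph_eq_liftCurve (y : ℝ → ℝ) (I : Set ℝ) :
    jetGraph y I = liftCurve (fun k => iteratedDeriv k y) I := by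
  ext p
  simp only [jetGraph, liftCurve, Set.mem_ofPred_eq, Set.mem_image, chart, jetVec_iteratedDeriv,
    eq_comm (a := p)]

theorem exists_contactFamily_iff_inCone {y : ℝ → ℝ} :
    (∃ C ∈ contactFamily ℝ, jetGraph y I ⊆ C) ↔
      ∃ g : Sp4 ℝ, ∀ x ∈ I, InCone (g • jetVec (fun k => iteratedDeriv k y) x) := by
  simp only [mem_contactFamily_iff, jetGraph_eq_liftCurve]
  constructor
  · rintro ⟨_, ⟨g, rfl⟩, h⟩
    refine ⟨g⁻¹, liftCurve_subset_iff.1 ?_⟩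
    rwa [inv_inv]
  · rintro ⟨g, h⟩
    exact ⟨_, ⟨g⁻¹, rfl⟩, liftCurve_subset_iff.2 h⟩

/-- A single point with y''' ≠ 0 is enough: the lift then stays in one cubic, which forces y''' ≠ 0
on the whole of `I`. -/
theorem isSolutionOn_iff {y : ℝ → ℝ} (hI : IsOpen I) (hI' : IsConnected I)
    (hy : ContDiffOn ℝ 7 y I) :
    IsSolutionOn y I ↔ ∃ C ∈ contactFamily ℝ, jetGraph y I ⊆ C := by
  have hY := isJetOn_iteratedDeriv hI hy
  rw [exists_contactFamily_iff_inCone]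
  constructor
  · rintro ⟨hode, z, hz, hq⟩
    exact hY.exists_inCone hI hI'.isPreconnected hode hz hq
  · rintro ⟨g, hg⟩
    obtain ⟨z, hz⟩ := hI'.nonempty
    exact ⟨fun x hx => hY.jetEq_of_inCone hI hg hx, z, hz,
      hY.third_ne_zero hI subset_rfl hg hz (subset_closure hz)⟩

theorem zariskiClosure_jetGraph {y : ℝ → ℝ} (hI : IsOpen I) (hI' : I.Nonempty) {C : Set (P3 ℝ)}
    (hC : C ∈ contactFamily ℝ) (h : jetGraph y I ⊆ C) : zariskiClosure (jetGraph y I) = C := by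
  obtain ⟨g, rfl⟩ := mem_contactFamily_iff.1 hC
  obtain ⟨w, hw⟩ := hI'
  refine zariskiClosure_eq_smul_stdCurve g h ?_
  rw [jetGraph_eq_liftCurve]
  exact liftCurve_infinite (infinite_of_mem_nhds w (hI.mem_nhds hw))

theorem solutionSpace_subset : solutionSpace ⊆ contactFamily ℝ := by
  rintro _ ⟨I, y, hI, hI', hy, hsol, rfl⟩
  obtain ⟨C, hC, h⟩ := (isSolutionOn_iff hI hI' hy).1 hsol
  rwa [zariskiClosure_jetGraph hI hI'.nonempty hC h]

end Solutions

end SubmaximalODE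
end

noncomputable section
set_option linter.unusedSectionVars false
namespace SubmaximalODE

/-! ### Every contact cubic contains the lift of a solution -/

section Existence

theorem rows_sympForm (g : Sp4 ℝ) (i j : Fin 2 ⊕ Fin 2) :
    sympForm (g.1 i) (g.1 j) = Matrix.J (Fin 2) ℝ i j :=
  mem_symplecticGroup_iff.1 (SymplecticGroup.transpose_mem g.2) i j

theorem smul_stdMap_apply (g : Sp4 ℝ) (s t : ℝ) (i : Fin 2 ⊕ Fin 2) :
    (g • stdMap s t) i = g.1 i (.inl 0) * s ^ 3 + g.1 i (.inl 1) * (s ^ 2 * t) +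
      g.1 i (.inr 0) * t ^ 3 + g.1 i (.inr 1) * (-3 * s * t ^ 2) := by
  simp [sp_smul_eq, Matrix.mulVec, dotProduct, Fintype.sum_sum_type, stdMap]
  ring

/-- The derivative of `stdMap 1`. -/
def stdMap' (t : ℝ) : V4 ℝ := vec4 0 1 (3 * t ^ 2) (-6 * t)

theorem hasDerivAt_stdMap (t : ℝ) : HasDerivAt (fun t : ℝ => stdMap 1 t) (stdMap' t) t := by
  refine (hasDerivAt_vec4 (hasDerivAt_const t _) ((hasDerivAt_id t).const_mul _)
    ((hasDerivAt_id t).fun_pow 3) (((hasDerivAt_id t).fun_pow 2).const_mul _)).congr_deriv ?_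
  refine V4.ext ?_ ?_ ?_ ?_ <;> simp [stdMap']
  ring

theorem sympForm_stdMap_stdMap' (t : ℝ) : sympForm (stdMap 1 t) (stdMap' t) = 0 := by
  simp [sympForm_eq, stdMap, stdMap']
  ring

theorem smul_stdMap'_apply (g : Sp4 ℝ) (t : ℝ) (i : Fin 2 ⊕ Fin 2) :
    (g • stdMap' t) i = g.1 i (.inl 1) + g.1 i (.inr 0) * (3 * t ^ 2) +
      g.1 i (.inr 1) * (-6 * t) := by
  simp [sp_smul_eq, Matrix.mulVec, dotProduct, Fintype.sum_sum_type, stdMap']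
  ring

/-- A contact cubic is not contained in a pencil of planes through a Lagrangian line. -/
theorem exists_wronskian_ne_zero (g : Sp4 ℝ) : ∃ t : ℝ, (g • stdMap 1 t) (.inl 0) ≠ 0 ∧
    (g • stdMap 1 t) (.inl 0) * (g • stdMap' t) (.inl 1) -
      (g • stdMap 1 t) (.inl 1) * (g • stdMap' t) (.inl 0) ≠ 0 := by
  have r01 := rows_sympForm g (.inl 0) (.inl 1)
  have r02 := rows_sympForm g (.inl 0) (.inr 0)
  have r13 := rows_sympForm g (.inl 1) (.inr 1)
  have r12 := rows_sympForm g (.inl 1) (.inr 0)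
  simp [Matrix.J, sympForm_eq] at r01 r02 r13 r12
  by_contra! h
  simp only [smul_stdMap_apply, smul_stdMap'_apply] at h
  generalize g.1 (.inl 0) (.inl 0) = a0 at *
  generalize g.1 (.inl 0) (.inl 1) = a1 at *
  generalize g.1 (.inl 0) (.inr 0) = a3 at *
  generalize g.1 (.inl 0) (.inr 1) = a2 at *
  generalize g.1 (.inl 1) (.inl 0) = b0 at *
  generalize g.1 (.inl 1) (.inl 1) = b1 at *
  generalize g.1 (.inl 1) (.inr 0) = b3 at *
  generalize g.1 (.inl 1) (.inr 1) = b2 at *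
  let pol : ℝ → ℝ → ℝ → ℝ → Polynomial ℝ := fun c0 c1 c2 c3 =>
    Polynomial.C c0 + Polynomial.C c1 * Polynomial.X + Polynomial.C (-3 * c2) * Polynomial.X ^ 2 +
      Polynomial.C c3 * Polynomial.X ^ 3
  let pol' : ℝ → ℝ → ℝ → Polynomial ℝ := fun c1 c2 c3 =>
    Polynomial.C c1 + Polynomial.C (-6 * c2) * Polynomial.X +
      Polynomial.C (3 * c3) * Polynomial.X ^ 2
  -- The Wronskian is only known to vanish where the first coordinate does not. The product of the
  -- two polynomials vanishes everywhere, so one of them is zero.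
  have hpol : pol a0 a1 a2 a3 *
      (pol a0 a1 a2 a3 * pol' b1 b2 b3 - pol b0 b1 b2 b3 * pol' a1 a2 a3) = 0 := by
    refine Polynomial.funext fun t => ?_
    by_cases h0 : (pol a0 a1 a2 a3).eval t = 0
    · rw [Polynomial.eval_mul, h0, zero_mul, Polynomial.eval_zero]
    · rw [Polynomial.eval_mul, Polynomial.eval_zero]
      simp [pol] at h0
      have := h t (fun h => h0 (by linear_combination h))
      simp [pol, pol']
      right
      linear_combination this
  rcases mul_eq_zero.1 hpol with h0 | h0
  · have e : ∀ t, a0 + a1 * t - 3 * a2 * t ^ 2 + a3 * t ^ 3 = 0 := fun t => by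
      have := congrArg (Polynomial.eval t) h0
      simp [pol] at this
      linear_combination this
    have e0 := e 0
    have e1 := e 1
    have e2 := e (-1)
    have e3 := e 2
    obtain rfl : a0 = 0 := by linarith
    obtain rfl : a1 = 0 := by linarith
    obtain rfl : a2 = 0 := by linarith
    obtain rfl : a3 = 0 := by linarith
    simp at r02
  · have e : ∀ t, (a0 * b1 - a1 * b0) + 2 * (-3 * (a0 * b2 - a2 * b0)) * t +
        (3 * (a0 * b3 - a3 * b0) - 3 * (a1 * b2 - a2 * b1)) * t ^ 2 +
        2 * (a1 * b3 - a3 * b1) * t ^ 3 - 3 * (a2 * b3 - a3 * b2) * t ^ 4 = 0 := fun t => by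
      have := congrArg (Polynomial.eval t) h0
      simp [pol, pol'] at this
      linear_combination this
    have e0 := e 0
    have e1 := e 1
    have e2 := e (-1)
    have e3 := e 2
    have e4 := e (-2)
    have m01 : a0 * b1 - a1 * b0 = 0 := by linarith
    have m02 : a0 * b2 - a2 * b0 = 0 := by linarith
    have m13 : a1 * b3 - a3 * b1 = 0 := by linarith
    have m23 : a2 * b3 - a3 * b2 = 0 := by linarith
    -- The t² coefficient gives only m03 = m12. The missing relation m03 + m12 = 0 is the
    -- orthogonality `r01` of the two rows.
    have m03 : a0 * b3 - a3 * b0 = 0 := by linarith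
    have m12 : a1 * b2 - a2 * b1 = 0 := by linarith
    generalize g.1 (.inr 0) (.inl 0) = c0 at *
    generalize g.1 (.inr 0) (.inl 1) = c1 at *
    generalize g.1 (.inr 0) (.inr 0) = c3 at *
    generalize g.1 (.inr 0) (.inr 1) = c2 at *
    -- With all minors zero the two rows are proportional. Pairing with a third row, which is
    -- orthogonal to the second but not to the first, shows that the second row is zero.
    obtain rfl : b0 = 0 := by
      linear_combination b0 * r02 - a0 * r12 + c0 * m03 + c1 * m02 - c2 * m01
    obtain rfl : b1 = 0 := by
      linear_combination b1 * r02 - a1 * r12 + c0 * m13 + c1 * m12 + c3 * m01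
    obtain rfl : b2 = 0 := by
      linear_combination b2 * r02 - a2 * r12 + c0 * m23 + c3 * m02 + c2 * m12
    obtain rfl : b3 = 0 := by
      linear_combination b3 * r02 - a3 * r12 - c1 * m23 + c3 * m03 + c2 * m13
    simp at r13

/-- Where the Wronskian of the first two coordinates is nonzero, x has nonzero derivative along the
cubic and can be inverted locally. The contact condition then says that z is dy/dx. -/
theorem exists_jetGraph_subset (g : Sp4 ℝ) :
    ∃ (I : Set ℝ) (y : ℝ → ℝ), IsOpen I ∧ IsConnected I ∧ ContDiffOn ℝ 7 y I ∧
      jetGraph y I ⊆ g • stdCurve ℝ := by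
  obtain ⟨t₀, h0, hW⟩ := exists_wronskian_ne_zero g
  set u : Fin 2 ⊕ Fin 2 → ℝ → ℝ := fun i t => (g • stdMap 1 t) i with hu
  set u' : Fin 2 ⊕ Fin 2 → ℝ → ℝ := fun i t => (g • stdMap' t) i with hu'
  have du : ∀ i t, HasDerivAt (u i) (u' i t) t := fun i t =>
    hasDerivAt_pi.1 (HasDerivAt.sp_smul (hasDerivAt_stdMap t) g) i
  have cu : ∀ i, ContDiff ℝ 7 (u i) := fun i => by
    simp only [hu, smul_stdMap_apply]
    fun_prop
  have cu' : ∀ i, Continuous (u' i) := fun i => by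
    simp only [hu', smul_stdMap'_apply]
    fun_prop
  have hcontact : ∀ t, u (.inr 0) t * u' (.inl 0) t + u (.inr 1) t * u' (.inl 1) t -
      u (.inl 0) t * u' (.inr 0) t - u (.inl 1) t * u' (.inr 1) t = 0 := fun t => by
    rw [← sympForm_stdMap_stdMap' t, ← sympForm_sp_smul g, sympForm_eq]
  set T : Set ℝ := {t | u (.inl 0) t ≠ 0 ∧
    u (.inl 0) t * u' (.inl 1) t - u (.inl 1) t * u' (.inl 0) t ≠ 0} with hT
  have hTo : IsOpen T :=
    (isOpen_ne_fun (cu _).continuous continuous_const).inter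
      (isOpen_ne_fun (((cu _).continuous.mul (cu' _)).sub ((cu _).continuous.mul (cu' _)))
        continuous_const)
  set X : ℝ → ℝ := fun t => u (.inl 1) t / u (.inl 0) t with hX
  set X' : ℝ → ℝ := fun t => (u' (.inl 1) t * u (.inl 0) t - u (.inl 1) t * u' (.inl 0) t) /
    u (.inl 0) t ^ 2 with hX'
  -- This solves 2y - xz = u₂/u₀ for y, with x = u₁/u₀ and z = u₃/u₀, where the coordinates are
  -- numbered in the order of `vec4`.
  set Yt : ℝ → ℝ := fun t => (u (.inr 0) t * u (.inl 0) t + u (.inl 1) t * u (.inr 1) t) /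
    (2 * u (.inl 0) t ^ 2) with hYt
  have dX : ∀ t ∈ T, HasDerivAt X (X' t) t := fun t ht => (du _ t).div (du _ t) ht.1
  have hX0 : ∀ t ∈ T, X' t ≠ 0 := fun t ht =>
    div_ne_zero (by rw [mul_comm]; exact ht.2) (pow_ne_zero 2 ht.1)
  have dY : ∀ t ∈ T, HasDerivAt Yt (u (.inr 1) t / u (.inl 0) t * X' t) t := fun t ht => by
    have ht0 : u (.inl 0) t ≠ 0 := ht.1
    refine ((((du (.inr 0) t).mul (du (.inl 0) t)).add ((du (.inl 1) t).mul (du (.inr 1) t))).div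
      (((du (.inl 0) t).fun_pow 2).const_mul 2) (by positivity)).congr_deriv ?_
    simp only [hX', Pi.add_apply, Pi.mul_apply]
    field_simp
    linear_combination -(u (.inl 0) t) ^ 2 * hcontact t
  have cX : ∀ t ∈ T, ContDiffAt ℝ 7 X t := fun t ht =>
    (cu _).contDiffAt.div (cu _).contDiffAt ht.1
  have cY : ∀ t ∈ T, ContDiffAt ℝ 7 Yt t := fun t ht =>
    (((cu _).mul (cu _)).add ((cu _).mul (cu _))).contDiffAt.div
      (contDiff_const.mul ((cu _).pow 2)).contDiffAt (mul_ne_zero two_ne_zero (pow_ne_zero 2 ht.1))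
  have ht₀ : t₀ ∈ T := ⟨h0, hW⟩
  set e := (cX t₀ ht₀).toOpenPartialHomeomorph X ((dX t₀ ht₀).hasFDerivAt_equiv (hX0 t₀ ht₀))
    (by norm_num) with he
  have heX : ∀ t, e t = X t := fun t => rfl
  have ht₀e : t₀ ∈ e.source := (cX t₀ ht₀).mem_toOpenPartialHomeomorph_source _ _
  have hmem : X t₀ ∈ e.target ∩ e.symm ⁻¹' T := by
    refine ⟨e.map_source ht₀e, ?_⟩
    rw [Set.mem_preimage, ← heX, e.left_inv ht₀e]
    exact ht₀
  obtain ⟨ε, hε, hball⟩ := Metric.isOpen_iff.1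
    (e.symm.isOpen_inter_preimage hTo) (X t₀) hmem
  refine ⟨Metric.ball (X t₀) ε, fun x => Yt (e.symm x), Metric.isOpen_ball,
    ⟨⟨_, Metric.mem_ball_self hε⟩, (convex_ball _ _).isPreconnected⟩, ?_, ?_⟩
  · intro x hx
    obtain ⟨hxt, hxT⟩ := hball hx
    exact ((cY _ hxT).comp x (e.contDiffAt_symm_deriv (hX0 _ hxT) hxt (dX _ hxT)
      (cX _ hxT))).contDiffWithinAt
  · rintro _ ⟨x, hx, rfl⟩
    obtain ⟨hxt, hxT⟩ := hball hx
    have hd : HasDerivAt (fun x => Yt (e.symm x))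
        (u (.inr 1) (e.symm x) / u (.inl 0) (e.symm x)) x :=
      ((dY _ hxT).comp x (e.hasDerivAt_symm hxt (hX0 _ hxT) (dX _ hxT))).congr_deriv (by
        rw [mul_assoc, mul_inv_cancel₀ (hX0 _ hxT), mul_one])
    have hxX : X (e.symm x) = x := e.right_inv hxt
    rw [hd.deriv, chart, mk_mem_smul_stdCurve]
    have hxT0 : u (.inl 0) (e.symm x) ≠ 0 := hxT.1
    have hv : chartVec (x, Yt (e.symm x), u (.inr 1) (e.symm x) / u (.inl 0) (e.symm x)) =
        (u (.inl 0) (e.symm x))⁻¹ • (g • stdMap 1 (e.symm x)) := by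
      have hi : ∀ i, (g • stdMap 1 (e.symm x)) i = u i (e.symm x) := fun i => rfl
      refine V4.ext ?_ ?_ ?_ ?_ <;> rw [Pi.smul_apply, hi, smul_eq_mul]
      · exact (inv_mul_cancel₀ hxT0).symm
      · exact hxX.symm.trans (div_eq_inv_mul _ _)
      · change 2 * Yt (e.symm x) - x * (u (.inr 1) (e.symm x) / u (.inl 0) (e.symm x)) = _
        have : x * (u (.inr 1) (e.symm x) / u (.inl 0) (e.symm x)) =
          X (e.symm x) * (u (.inr 1) (e.symm x) / u (.inl 0) (e.symm x)) := by rw [hxX]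
        rw [this]
        simp only [hX, hYt]
        field_simp
        ring
      · exact div_eq_inv_mul _ _
    rw [hv, sp_smul_smul, inv_smul_smul]
    exact (inCone_stdMap _ _).smul _

theorem solutionSpace_eq : solutionSpace = contactFamily ℝ := by
  refine solutionSpace_subset.antisymm fun C hC => ?_
  obtain ⟨g, hg⟩ := mem_contactFamily_iff.1 hC
  obtain ⟨I, y, hI, hI', hy, h⟩ := exists_jetGraph_subset g
  rw [← hg] at h
  exact ⟨I, y, hI, hI', hy, (isSolutionOn_iff hI hI' hy).2 ⟨C, hC, h⟩,
    (zariskiClosure_jetGraph hI hI'.nonempty hC h).symm⟩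

end Existence

end SubmaximalODE
end

theorem mainTheorem3 :
    (∀ (𝕜 : Type) [RCLike 𝕜],
      -- the contact transformations generated by `z²`, and the quartic family
      SubmaximalODE.IsContactFlow (𝕜 := 𝕜) (fun _ _ z => z ^ 2) SubmaximalODE.flowZSq ∧
      SubmaximalODE.quarticCurves 𝕜 =
        {Γ | ∃ c : Fin 7 → 𝕜, SubmaximalODE.Admissible c ∧ Γ = SubmaximalODE.planeCurve c} ∧
      -- the curves obtained are rational contact curves depending on exactly seven parameters
      (∀ (b : 𝕜) (c : Fin 7 → 𝕜), SubmaximalODE.Admissible c →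
        SubmaximalODE.IsRationalContactCubic (SubmaximalODE.contactCurve b c)) ∧
      (∀ (b : 𝕜) (c c' : Fin 7 → 𝕜),
        SubmaximalODE.Admissible c → SubmaximalODE.Admissible c' →
        (SubmaximalODE.contactCurve b c = SubmaximalODE.contactCurve b c' ↔
          ∃ l : 𝕜, l ≠ 0 ∧ c' = SubmaximalODE.rescale l c)) ∧
      (∀ C : Set (SubmaximalODE.P3 𝕜),
        {b : 𝕜 | ∃ c : Fin 7 → 𝕜, SubmaximalODE.Admissible c ∧
          SubmaximalODE.contactCurve b c = C}.encard ≤ 3) ∧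
      -- the identity component of `Sp(4)` acts transitively
      (∀ C ∈ SubmaximalODE.contactFamily 𝕜, ∀ C' ∈ SubmaximalODE.contactFamily 𝕜,
        ∃ g ∈ connectedComponent (1 : SubmaximalODE.Sp4 𝕜), g • C = C') ∧
      -- the stabiliser is `SL(2)`, and the family is `Sp(4)/SL(2)`
      (∀ C ∈ SubmaximalODE.contactFamily 𝕜,
        Nonempty (Matrix.SpecialLinearGroup (Fin 2) 𝕜 ≃ₜ*
          MulAction.stabilizer (SubmaximalODE.Sp4 𝕜) C) ∧
        ∃ e : (SubmaximalODE.Sp4 𝕜 ⧸ MulAction.stabilizer (SubmaximalODE.Sp4 𝕜) C) ≃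
            SubmaximalODE.contactFamily 𝕜,
          ∀ g : SubmaximalODE.Sp4 𝕜,
            (e (QuotientGroup.mk g) : Set (SubmaximalODE.P3 𝕜)) = g • C)) ∧
    -- the real family is the solution space of the equation
    (∀ (I : Set ℝ) (y : ℝ → ℝ), IsOpen I → IsConnected I → ContDiffOn ℝ 7 y I →
      (SubmaximalODE.IsSolutionOn y I ↔
        ∃ C ∈ SubmaximalODE.contactFamily ℝ, SubmaximalODE.jetGraph y I ⊆ C)) ∧
    SubmaximalODE.solutionSpace = SubmaximalODE.contactFamily ℝ ∧
    -- the real family is the fixed locus of complex conjugation in the complex family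
    Set.BijOn SubmaximalODE.complexify SubmaximalODE.solutionSpace
      {C ∈ SubmaximalODE.contactFamily ℂ | SubmaximalODE.conjCurve C = C} ∧
    (∀ (g : SubmaximalODE.Sp4 ℝ) (g' : SubmaximalODE.Sp4 ℂ) (C : Set (SubmaximalODE.P3 ℝ)),
      (g' : Matrix (Fin 2 ⊕ Fin 2) (Fin 2 ⊕ Fin 2) ℂ) =
        (g : Matrix (Fin 2 ⊕ Fin 2) (Fin 2 ⊕ Fin 2) ℝ).map Complex.ofReal →
      SubmaximalODE.complexify (g • C) = g' • SubmaximalODE.complexify C) := by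
  refine ⟨fun 𝕜 _ => ⟨SubmaximalODE.isContactFlow_flowZSq, SubmaximalODE.quarticCurves_eq,
    fun b c hc => SubmaximalODE.isRationalContactCubic_contactCurve b hc,
    fun b c c' hc hc' => SubmaximalODE.contactCurve_eq_iff b hc hc',
    fun C => SubmaximalODE.encard_b_le_three C,
    fun C hC C' hC' => SubmaximalODE.exists_connectedComponent_smul_eq hC hC',
    fun C hC => SubmaximalODE.stabilizer_and_quotient hC⟩,
    fun I y hI hI' hy => SubmaximalODE.isSolutionOn_iff hI hI' hy,
    SubmaximalODE.solutionSpace_eq, ?_,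
    fun g g' C h => SubmaximalODE.complexify_smul_of_coe_eq g g' C h⟩
  rw [SubmaximalODE.solutionSpace_eq]
  exact SubmaximalODE.bijOn_complexify
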